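/- **Setting.** Let $s$ be one of the functions: (I) $s(x)=x$; (II) $s(x)=\frac1r\sin(rx)$; (III) $s(x)=\frac a\pi\sinh(\pi x/a)$; (IV) $s(x)=\frac1r e^{ra/4}\vartheta_1(rx\,|\,ira/\pi)$, with $r,a>0$ and $\vartheta_1(z|\tau)=2e^{i\pi\tau/4}\sin z\prod_{n\ge1}(1-e^{2\pi in\tau})(1-2e^{2\pi in\tau}\cos 2z+e^{4\pi in\tau})$. Put $\rho=0,1,1,3$ in the cases (I)–(IV), $\omega_0=0$, $\omega_1=\pi/r$ in (II),(IV), $\omega_1=ia$ in (III), $\omega_2=ia$, $\omega_3=-\omega_1-\omega_2$, $\Omega=\sum_{\nu\le\rho}\mathbb Z\omega_\nu$, and $(\xi_0,\xi_1,\xi_2,\xi_3)=(0,0,-1,1)$. Let $\beta>0$, $\lambda\in\mathbb R\setminus\{0\}$, $g_0,\dots,g_{2\rho+1}\in\mathbb R$, $\mathcal N\ge0$, $m_1,\dots,m_{\mathcal N}\in\Lambda=\{1,-1,-1/\lambda,1/\lambda\}$, and assume $n\,i\beta/m\notin\Omega$ for all $m\in\Lambda$ and $n\in\mathbb Z\setminus\{0\}$.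 Put $d(g,m)=g$ if $m\in\{1,1/\lambda\}$ and $d(g,m)=g-(\lambda+1)/2$ otherwise, $B=2\lambda\sum_Jm_J+\sum_{\nu=0}^{2\rho+1}g_\nu-\frac12(\rho+1)(\lambda+1)$, and $$f_\pm(x;m,m')=\frac{s\bigl(x\mp i(m-m')(\lambda mm'-1)\beta/(4mm')\mp i\lambda m'\beta\bigr)}{s\bigl(x\mp i(m-m')(\lambda mm'-1)\beta/(4mm')\bigr)},$$ $$\mathcal V_J^\pm(X)=\frac{\prod_{\nu=0}^{2\rho+1}s(\pm X_J-id(g_\nu,m_J)\beta)}{s(\pm2X_J)\,s(\pm2X_J-i\beta/m_J)}\prod_{K\ne J}\prod_{\delta=\pm}f_\pm(X_J+\delta X_K;m_J,m_K),$$ $$\mathcal V^0(X)=-\frac14\Bigl(\prod_{\nu=1}^\rho s(\tfrac{\omega_\nu}2)\Bigr)^2\sum_{\nu=0}^\rho\frac{e^{-r\xi_\nu B\beta}}{\prod_{\mu\ne\nu}s(\frac{\omega_\nu-\omega_\mu}2)}\Bigl(P_\nu(1)\prod_{\delta=\pm}\prod_J\frac{s(\delta X_J+\frac{\omega_\nu}2+p_J-i\lambda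 m_J\beta)}{s(\delta X_J+\frac{\omega_\nu}2+p_J)}+P_\nu(\lambda)\prod_{\delta=\pm}\prod_J\frac{s(\delta X_J+\frac{\omega_\nu}2+q_J-i\lambda m_J\beta)}{s(\delta X_J+\frac{\omega_\nu}2+q_J)}\Bigr),$$ with $p_J=\frac i4[\lambda(m_J-1)+\frac1{m_J}+1]\beta$, $q_J=\frac i4[\lambda(m_J+1)+\frac1{m_J}-1]\beta$, $$P_\nu(1)=\frac{\prod_{\mu=0}^{2\rho+1}s(\frac{\omega_\nu}2+\frac{i\beta}2-ig_\mu\beta)}{\prod_{\mu=0}^\rho s(\frac12(\omega_\nu-\omega_\mu+i(1-\lambda)\beta))},\qquad P_\nu(\lambda)=\frac{\prod_{\mu=0}^{2\rho+1}s(\frac{\omega_\nu}2+\frac{i\lambda\beta}2-ig_\mu\beta)}{\prod_{\mu=0}^\rho s(\frac12(\omega_\nu-\omega_\mu+i(\lambda-1)\beta))}.$$ (The factor $e^{-r\xi_\nu B\beta}$ is $1$ in the cases (I)–(III).) Let $G(x;\alpha)$ satisfy, for each $\alpha$ with $\operatorname{Re}\alpha\neq0$, the equation $G(x+i\alpha/2;\alpha)=c\,s(x)\,G(x-i\alpha/2;\alpha)$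 with some $c\in\mathbb C^*$, for all $x$ with $s(x)\ne0$ (a meromorphic $G$ being given the value $0$ at its poles). Let $\Phi(X)=\prod_J\psi(X_J;m_J)\prod_{J<K}\prod_{\varepsilon,\varepsilon'=\pm}\phi(\varepsilon X_J+\varepsilon'X_K;m_J,m_K)$, where $$\psi(x;m)^2=\frac{G(2x+\frac{i\beta}{2m};\frac\beta m)\,G(-2x+\frac{i\beta}{2m};\frac\beta m)}{\prod_{\nu=0}^{2\rho+1}G(x+\frac{i\beta}{2m}-id(g_\nu,m)\beta;\frac\beta m)\,G(-x+\frac{i\beta}{2m}-id(g_\nu,m)\beta;\frac\beta m)}$$ and $\phi(x;m,m')^2$ equals $G(x+\frac{i\beta}{2m};\frac\beta m)/G(x-i\lambda m\beta+\frac{i\beta}{2m};\frac\beta m)$, $G(x-\frac{i\lambda m\beta}2;\frac\beta m)^2$, $s(x)$, $s(x-\frac{i\lambda m\beta}2+\frac{i\beta}{2m})^{-1}$ for $m'=m$, $-m$, $\frac1{\lambda m}$, $-\frac1{\lambda m}$ respectively (the first case that applies). Let $\exp(-\varepsilon i\frac\beta{m_J}\partial_J)$ denote the shift $X_J\mapsto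 X_J-\varepsilon i\beta/m_J$, and let $$\mathcal H=\sum_{\varepsilon=\pm}\sum_Js(i\lambda m_J\beta)(\mathcal V_J^\varepsilon)^{1/2}\exp\bigl(-\varepsilon i\tfrac\beta{m_J}\partial_J\bigr)(\mathcal V_J^{-\varepsilon})^{1/2}+\mathcal V^0,\qquad\mathcal A=\Phi^{-1}\circ\mathcal H\circ\Phi .$$ The operators act on arbitrary functions on a set $U\subset\mathbb C^{\mathcal N}$ that is invariant under all these shifts and on which neither $\Phi^2$, as given by the formulas above, nor any $\mathcal V_J^\pm$ has a zero or a pole; square roots are continuous branches on $U$ (roots of $\Phi^2$ and of the $\mathcal V_J^\pm$). **Lemma.** (1) In all four cases (I)–(IV), for all branches of $\Phi$ and $(\mathcal V_J^-)^{1/2}$ there are branches of $(\mathcal V_J^+)^{1/2}$ with $$\mathcal A=\sum_{\varepsilon=\pm}\sum_Js(i\lambda m_J\beta)\,\mathcal V_J^\varepsilon\exp\bigl(-\varepsilon i\tfrac\beta{m_J}\partial_J\bigr)+\mathcal V^0\quad\text{on }U;\tag{$*$}$$ and if $U$ is connected, then for any branches $(*)$ holds after multiplying each $(\mathcal V_J^+)^{1/2}$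 by a suitable constant sign $\sigma_J\in\{\pm1\}$. (2) Suppose that the $X$-independent denominators $s(\frac12(\omega_\nu-\omega_\mu\pm i(1-\lambda)\beta))$ of $\mathcal V^0$ do not vanish. In the cases (I), (II), (III), and in the case (IV) if the balancing condition $2\lambda\sum_Jm_J+\sum_{\nu=0}^7g_\nu-2(\lambda+1)=0$ holds, the operator on the right of $(*)$ equals $$\sum_{\varepsilon=\pm}\sum_Js(i\lambda m_J\beta)\,\mathcal V_J^\varepsilon\Bigl(\exp\bigl(-\varepsilon i\tfrac\beta{m_J}\partial_J\bigr)-1\Bigr)+\frac{\prod_{\nu=1}^\rho s(\frac{\omega_\nu}2)^2}4\,s\Bigl(i\beta B-\sum_{\nu=0}^\rho\omega_\nu\Bigr)\tag{$**$}$$ at every $X$ at which no denominator of $\mathcal V_J^\pm$, $\mathcal V^0$ vanishes; hence so does $\mathcal A$, with branches as in the first part of (1), at such points of $U$. Conversely, if $\mathcal N\ge1$, then in the case (IV) this equality (for the right-hand side of $(*)$, or for such an $\mathcal A$) on some non-empty open set of such points implies the balancing condition. -/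

import Mathlib

open Complex

noncomputable section

namespace SenOperator

/-- The odd Jacobi theta function `ϑ₁(z | τ)` (for `Im τ > 0`), by its product representation. -/
def theta1 (z τ : ℂ) : ℂ :=
  2 * exp (Real.pi * I * τ / 4) * sin z *
    ∏' n : ℕ, ((1 - exp (2 * Real.pi * I * (n + 1) * τ)) *
      (1 - 2 * exp (2 * Real.pi * I * (n + 1) * τ) * cos (2 * z) +
        exp (4 * Real.pi * I * (n + 1) * τ)))

/-- The four cases (I)-(IV) with their (positive) scale parameters. -/
inductive Kind where
  | rational : Kind
  | trigonometric (r : ℝ) : Kind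
  | hyperbolic (a : ℝ) : Kind
  | elliptic (r a : ℝ) : Kind

namespace Kind

/-- The scale parameters `r`, `a` are positive. -/
def Valid : Kind → Prop
  | rational => True
  | trigonometric r => 0 < r
  | hyperbolic a => 0 < a
  | elliptic r a => 0 < r ∧ 0 < a

/-- The function `s(x)`. -/
def s : Kind → ℂ → ℂ
  | rational, x => x
  | trigonometric r, x => (1 / (r : ℂ)) * sin (r * x)
  | hyperbolic a, x => ((a : ℂ) / Real.pi) * sinh (Real.pi * x / a)
  | elliptic r a, x =>
      (1 / (r : ℂ)) * exp (r * a / 4) * theta1 (r * x) (I * r * a / Real.pi)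

/-- The number `ρ`. -/
def rho : Kind → ℕ
  | rational => 0
  | trigonometric _ => 1
  | hyperbolic _ => 1
  | elliptic _ _ => 3

/-- `ω₁`; not used in the rational case. -/
def omega1 : Kind → ℂ
  | rational => 0
  | trigonometric r => Real.pi / r
  | hyperbolic a => I * a
  | elliptic r _ => Real.pi / r

/-- `ω₂ = i a`; used in the elliptic case only. -/
def omega2 : Kind → ℂ
  | elliptic _ a => I * a
  | _ => 0

/-- The periods `ω_ν`; only those with `ν ≤ ρ` are used. -/
def omega (K : Kind) : ℕ → ℂ
  | 0 => 0
  | 1 => K.omega1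
  | 2 => K.omega2
  | _ => -K.omega1 - K.omega2

/-- The lattice `Ω` generated by `ω_0, …, ω_ρ`. -/
def Omega (K : Kind) : AddSubgroup ℂ :=
  AddSubgroup.closure {w | ∃ ν, ν ≤ K.rho ∧ w = K.omega ν}

/-- The numbers `ξ_ν`: `(ξ_0, ξ_1, ξ_2, ξ_3) = (0, 0, -1, 1)`. -/
def xi : ℕ → ℂ
  | 2 => -1
  | 3 => 1
  | _ => 0

/-- The parameter `r` of the trigonometric and elliptic cases. It enters below only in products
`r ξ_ν` with `ν ≤ ρ`, which vanish in the cases without a parameter `r`. -/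
def rParam : Kind → ℂ
  | trigonometric r => r
  | elliptic r _ => r
  | _ => 0

end Kind

/-- `G(x; α)` is a Gamma function for `s`: for every `α` with `Re α ≠ 0` there is `c ≠ 0` with
`G(x + iα/2; α) / G(x - iα/2; α) = c s(x)`. The equation is multiplied out, and required off the
zeros of `s`, so that a meromorphic `G` that is given the value `0` at its poles qualifies. -/
def IsGammaFunction (s : ℂ → ℂ) (G : ℂ → ℂ → ℂ) : Prop :=
  ∀ α : ℂ, α.re ≠ 0 → ∃ c : ℂ, c ≠ 0 ∧
    ∀ x : ℂ, s x ≠ 0 → G (x + I * α / 2) α = c * s x * G (x - I * α / 2) α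

/-- The mass set `Λ = {1, -1, -1/λ, 1/λ}`. -/
def massSet (lam : ℝ) : Set ℝ := {1, -1, -1 / lam, 1 / lam}

/-- The data of the model: the case, the couplings `g_ν` (those with `ν ≤ 2ρ + 1` are used),
`λ`, `β` and the masses `m_J`. -/
structure Model (N : ℕ) where
  kind : Kind
  g : ℕ → ℝ
  lam : ℝ
  β : ℝ
  m : Fin N → ℝ

/-- Functions of `X = (X_1, …, X_N)`. -/
abbrev Fn (N : ℕ) : Type := (Fin N → ℂ) → ℂ

/-- Equality of two operators at the points of `U`, on all functions. -/
def OpEqOn {N : ℕ} (U : Set (Fin N → ℂ)) (T T' : Fn N → Fn N) : Prop :=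
  ∀ F : Fn N, ∀ X ∈ U, T F X = T' F X

/-- `R` is a continuous branch of `f^{1/2}` on `U`. -/
def IsRootOn {N : ℕ} (U : Set (Fin N → ℂ)) (R f : Fn N) : Prop :=
  ContinuousOn R U ∧ ∀ X ∈ U, R X ^ 2 = f X

/-- A sign as a complex number. -/
def sg (ε : ℤˣ) : ℂ := ((ε : ℤ) : ℂ)

namespace Model

variable {N : ℕ} (M : Model N)

/-- The function `s` of the model. -/
def s (x : ℂ) : ℂ := M.kind.s x

/-- Standing assumptions: positive scales, `β > 0`, `λ ≠ 0`, masses in `Λ`, and no nonzero integer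
multiple of `iβ/m`, `m ∈ Λ`, lies in `Ω`. -/
def Admissible : Prop :=
  M.kind.Valid ∧ 0 < M.β ∧ M.lam ≠ 0 ∧ (∀ J, M.m J ∈ massSet M.lam) ∧
    ∀ m ∈ massSet M.lam, ∀ n : ℤ, n ≠ 0 → (n : ℂ) * (I * M.β / m) ∉ M.kind.Omega

/-- `d(g, m)`. -/
def d (g m : ℝ) : ℝ := if m = 1 ∨ m = 1 / M.lam then g else g - (M.lam + 1) / 2

/-- The denominator of `f_ε(x; m, m')`. -/
def pairDen (ε : ℤˣ) (x : ℂ) (m m' : ℝ) : ℂ :=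
  M.s (x - sg ε * I * ((m - m') * (M.lam * m * m' - 1) * M.β / (4 * m * m')))

/-- The numerator of `f_ε(x; m, m')`. -/
def pairNum (ε : ℤˣ) (x : ℂ) (m m' : ℝ) : ℂ :=
  M.s (x - sg ε * I * ((m - m') * (M.lam * m * m' - 1) * M.β / (4 * m * m')) -
    sg ε * I * M.lam * m' * M.β)

/-- The coefficient `𝒱_J^ε`. -/
def V (ε : ℤˣ) (J : Fin N) : Fn N := fun X =>
  (∏ ν ∈ Finset.range (2 * M.kind.rho + 2),
      M.s (sg ε * X J - I * M.d (M.g ν) (M.m J) * M.β)) /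
    (M.s (sg ε * 2 * X J) * M.s (sg ε * 2 * X J - I * M.β / M.m J)) *
  ∏ K ∈ Finset.univ.erase J, ∏ δ : ℤˣ,
    M.pairNum ε (X J + sg δ * X K) (M.m J) (M.m K) /
      M.pairDen ε (X J + sg δ * X K) (M.m J) (M.m K)

/-- `2 λ |m| + |g| - (ρ + 1)(λ + 1)/2`. -/
def balance : ℝ :=
  2 * M.lam * ∑ J, M.m J + ∑ ν ∈ Finset.range (2 * M.kind.rho + 2), M.g ν -
    (1 / 2) * (M.kind.rho + 1) * (M.lam + 1)

/-- `∏_{ν=1}^ρ s(ω_ν / 2)`. -/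
def halfPeriodProd : ℂ := ∏ ν ∈ Finset.Icc 1 M.kind.rho, M.s (M.kind.omega ν / 2)

/-- The shift `¼ i [λ(m - 1) + 1/m + 1] β` in the first part of `𝒱^0`. -/
def shiftA (m : ℝ) : ℂ := (1 / 4) * I * (M.lam * (m - 1) + 1 / m + 1) * M.β

/-- The shift `¼ i [λ(m + 1) + 1/m - 1] β` in the second part of `𝒱^0`. -/
def shiftB (m : ℝ) : ℂ := (1 / 4) * I * (M.lam * (m + 1) + 1 / m - 1) * M.β

/-- The coefficient `𝒱^0`. -/
def V0 : Fn N := fun X =>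
  -(1 / 4) * M.halfPeriodProd ^ 2 *
  ∑ ν ∈ Finset.range (M.kind.rho + 1),
    exp (-M.kind.rParam * Kind.xi ν * M.balance * M.β) /
      (∏ μ ∈ (Finset.range (M.kind.rho + 1)).erase ν,
        M.s ((M.kind.omega ν - M.kind.omega μ) / 2)) *
    ((∏ μ ∈ Finset.range (2 * M.kind.rho + 2),
          M.s (M.kind.omega ν / 2 + I * M.β / 2 - I * M.g μ * M.β)) /
        (∏ μ ∈ Finset.range (M.kind.rho + 1),
          M.s ((M.kind.omega ν - M.kind.omega μ + I * (1 - M.lam) * M.β) / 2)) *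
        (∏ δ : ℤˣ, ∏ J,
          M.s (sg δ * X J + M.kind.omega ν / 2 + M.shiftA (M.m J) - I * M.lam * M.m J * M.β) /
            M.s (sg δ * X J + M.kind.omega ν / 2 + M.shiftA (M.m J))) +
      (∏ μ ∈ Finset.range (2 * M.kind.rho + 2),
          M.s (M.kind.omega ν / 2 + I * M.lam * M.β / 2 - I * M.g μ * M.β)) /
        (∏ μ ∈ Finset.range (M.kind.rho + 1),
          M.s ((M.kind.omega ν - M.kind.omega μ + I * (M.lam - 1) * M.β) / 2)) *
        (∏ δ : ℤˣ, ∏ J,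
          M.s (sg δ * X J + M.kind.omega ν / 2 + M.shiftB (M.m J) - I * M.lam * M.m J * M.β) /
            M.s (sg δ * X J + M.kind.omega ν / 2 + M.shiftB (M.m J))))

/-- The `X`-independent denominators of `𝒱^0` do not vanish. -/
def V0Defined : Prop :=
  ∀ ν ≤ M.kind.rho, ∀ μ ≤ M.kind.rho,
    M.s ((M.kind.omega ν - M.kind.omega μ + I * (1 - M.lam) * M.β) / 2) ≠ 0 ∧
    M.s ((M.kind.omega ν - M.kind.omega μ + I * (M.lam - 1) * M.β) / 2) ≠ 0

/-- The points at which no `X`-dependent denominator of `𝒱_J^±` or `𝒱^0` vanishes. -/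
def regularSet : Set (Fin N → ℂ) :=
  {X | (∀ (ε : ℤˣ) (J : Fin N),
        M.s (sg ε * 2 * X J) ≠ 0 ∧ M.s (sg ε * 2 * X J - I * M.β / M.m J) ≠ 0 ∧
        ∀ K, K ≠ J → ∀ δ : ℤˣ, M.pairDen ε (X J + sg δ * X K) (M.m J) (M.m K) ≠ 0) ∧
      ∀ ν ≤ M.kind.rho, ∀ (δ : ℤˣ) (J : Fin N),
        M.s (sg δ * X J + M.kind.omega ν / 2 + M.shiftA (M.m J)) ≠ 0 ∧
        M.s (sg δ * X J + M.kind.omega ν / 2 + M.shiftB (M.m J)) ≠ 0}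

/-- `ψ(x; m)²`. -/
def psiSq (G : ℂ → ℂ → ℂ) (x : ℂ) (m : ℝ) : ℂ :=
  (G (2 * x + I * M.β / (2 * m)) (M.β / m) * G (-2 * x + I * M.β / (2 * m)) (M.β / m)) /
    ∏ ν ∈ Finset.range (2 * M.kind.rho + 2),
      (G (x + I * M.β / (2 * m) - I * M.d (M.g ν) m * M.β) (M.β / m) *
        G (-x + I * M.β / (2 * m) - I * M.d (M.g ν) m * M.β) (M.β / m))

/-- `φ(x; m, m')²`; for masses in `Λ` the last case is `m' = -1/(λ m)`. -/
def phiSq (G : ℂ → ℂ → ℂ) (x : ℂ) (m m' : ℝ) : ℂ :=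
  if m' = m then
    G (x + I * M.β / (2 * m)) (M.β / m) /
      G (x - I * M.lam * m * M.β + I * M.β / (2 * m)) (M.β / m)
  else if m' = -m then
    G (x - I * M.lam * m * M.β / 2) (M.β / m) ^ 2
  else if m' = 1 / (M.lam * m) then
    M.s x
  else
    (M.s (x - I * M.lam * m * M.β / 2 + I * M.β / (2 * m)))⁻¹

/-- `Φ(X; m)²`. Division by zero counts as zero and so does, by convention, the value of `G` at a
pole, so `PhiSq G X ≠ 0` says that `X` is neither a zero nor a pole of a factor of `Φ`. -/
def PhiSq (G : ℂ → ℂ → ℂ) : Fn N := fun X =>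
  (∏ J, M.psiSq G (X J) (M.m J)) *
    ∏ J, ∏ K ∈ Finset.univ.filter (fun K => J < K), ∏ ε : ℤˣ, ∏ ε' : ℤˣ,
      M.phiSq G (sg ε * X J + sg ε' * X K) (M.m J) (M.m K)

/-- The point `X - ε i (β / m_J) e_J`. -/
def shiftPt (ε : ℤˣ) (J : Fin N) (X : Fin N → ℂ) : Fin N → ℂ :=
  Function.update X J (X J - sg ε * I * (M.β / M.m J))

/-- The operator `exp(-ε i (β / m_J) ∂/∂X_J)`. -/
def shiftOp (ε : ℤˣ) (J : Fin N) (F : Fn N) : Fn N := fun X => F (M.shiftPt ε J X)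

/-- The operator `ℋ`, for given branches `R ε J` of the roots of `𝒱_J^ε`. -/
def senOp (R : ℤˣ → Fin N → Fn N) (F : Fn N) : Fn N := fun X =>
  ∑ ε : ℤˣ, ∑ J, M.s (I * M.lam * M.m J * M.β) *
      (R ε J X * M.shiftOp ε J (fun Y => R (-ε) J Y * F Y) X) +
    M.V0 X * F X

/-- The operator `𝒜 = Φ⁻¹ ∘ ℋ ∘ Φ`, for given branches of the roots. -/
def conjOp (Φ : Fn N) (R : ℤˣ → Fin N → Fn N) (F : Fn N) : Fn N := fun X =>
  (Φ X)⁻¹ * M.senOp R (fun Y => Φ Y * F Y) X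

/-- The operator `∑ s(iλm_Jβ) 𝒱_J^ε exp(-ε i (β / m_J) ∂/∂X_J) + 𝒱^0`. -/
def reducedOp (F : Fn N) : Fn N := fun X =>
  ∑ ε : ℤˣ, ∑ J, M.s (I * M.lam * M.m J * M.β) * M.V ε J X * M.shiftOp ε J F X +
    M.V0 X * F X

/-- The constant `(1/4) ∏_{ν=1}^ρ s(ω_ν/2)² s(iβ[2λ|m| + |g| - (ρ+1)(λ+1)/2] - |ω|)`. -/
def eigenvalue : ℂ :=
  M.halfPeriodProd ^ 2 / 4 *
    M.s (I * M.β * M.balance - ∑ ν ∈ Finset.range (M.kind.rho + 1), M.kind.omega ν)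

/-- The operator `∑ s(iλm_Jβ) 𝒱_J^ε (exp(-ε i (β / m_J) ∂/∂X_J) - 1) + eigenvalue`. -/
def subtractedOp (F : Fn N) : Fn N := fun X =>
  ∑ ε : ℤˣ, ∑ J, M.s (I * M.lam * M.m J * M.β) * M.V ε J X * (M.shiftOp ε J F X - F X) +
    M.eigenvalue * F X

/-- The balancing condition in the elliptic case; no condition in the other cases. -/
def BalancedIfElliptic : Prop :=
  match M.kind with
  | Kind.elliptic _ _ => M.balance = 0
  | _ => True

/-- `U` is invariant under all the shifts, and neither `Φ` nor any `𝒱_J^±` has a zero or a pole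
on `U`, so that square roots of them can be considered there. -/
def IsDomain (G : ℂ → ℂ → ℂ) (U : Set (Fin N → ℂ)) : Prop :=
  (∀ X ∈ U, ∀ (ε : ℤˣ) (J : Fin N), M.shiftPt ε J X ∈ U) ∧
    ∀ X ∈ U, M.PhiSq G X ≠ 0 ∧ ∀ (ε : ℤˣ) (J : Fin N), M.V ε J X ≠ 0

/-- The choice of the branches `Rp J` for `𝒱_J^+` and `Rm J` for `𝒱_J^-`. -/
def branches (Rp Rm : Fin N → Fn N) (ε : ℤˣ) (J : Fin N) : Fn N :=
  if ε = 1 then Rp J else Rm J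

end Model

end SenOperator

end

/-! Conjugation. Let X' be X with X_J replaced by X_J - iβ/m_J. The first half rests on the
detailed-balance relation Φ²(X') 𝒱_J^-(X') = 𝒱_J^+(X) Φ²(X) (`PhiSq_mul_V_shift`). It splits over
particles and pairs: the difference equation of G produces the one-particle factor, and each of the
four possible relations between two masses of Λ produces the pair factor. If R is a root of 𝒱_J^-,
then 𝒱_J^+(X) Φ(X) / (R(X') Φ(X')) squares to 𝒱_J^+(X), and with this branch (`plusRoot`) all roots
disappear from Φ⁻¹ ∘ ℋ ∘ Φ (`conjOp_eq_reducedOp`). On a connected set any other branch differs from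
it by a constant sign.

Source identity. The operators (*) and (**) differ by a multiplication operator, so they agree
exactly when ∑ s(iλm_Jβ) 𝒱_J^ε + 𝒱^0 is the asserted constant. Consider z ↦ ∏ s(z - y_j)/s(z - x_j)
with poles at ω_ν/2 + iβ/2, at ω_ν/2 + iλβ/2 and at ±X_J - a_J, and with zeros at i g_ν β and at
±X_J - a_J + iλm_Jβ. Up to a common factor its residues at the first two families give 𝒱^0 (without
the exponentials) and, by the duplication formula of s, those at the third give s(iλm_Jβ) 𝒱_J^±. The
residues add up to s(∑(x_j - y_j)) (`residueSum_eq`): always in the cases (I)-(III), and in the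
elliptic case if ∑ x_j = ∑ y_j, which is the balancing condition because the ω_ν add up to 0. This
is obtained algebraically, by induction on the number of poles, from Weierstrass's three-term
relation; for theta functions that relation follows from Liouville's theorem.

Necessity. In the elliptic case the translation X_J ↦ X_J + k·ia fixes 𝒱^0 and the other 𝒱_K^±, and
multiplies 𝒱_J^± by u^{±k}, where u = e^{-2rβB}. If the sum is constant on an open set, it is
constant along a coordinate line by analytic continuation, so (u^k - 1) 𝒱_J^+ + (u^{-k} - 1) 𝒱_J^- =
0. The values k = 1, 2, at a point where 𝒱_J^+ ≠ 0, force u = 1 because u is real and positive;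
hence B = 0. -/

/-! ### The Euler product and the elliptic case of `s` -/

namespace SenOperator

/-- The Euler product `∏_{n ≥ 1} (1 - pⁿ u)`. -/
noncomputable def eulerProd (p u : ℂ) : ℂ := ∏' n : ℕ, (1 - p ^ (n + 1) * u)

theorem summable_norm_pow_succ_mul {p : ℂ} (hp : ‖p‖ < 1) (u : ℂ) :
    Summable fun n : ℕ => ‖-(p ^ (n + 1) * u)‖ := by
  simp only [norm_neg, norm_mul, norm_pow]
  exact ((summable_nat_add_iff 1).mpr
    (summable_geometric_of_lt_one (norm_nonneg _) hp)).mul_right _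

theorem multipliable_eulerProd {p : ℂ} (hp : ‖p‖ < 1) (u : ℂ) :
    Multipliable fun n : ℕ => 1 - p ^ (n + 1) * u := by
  simp_rw [sub_eq_add_neg]
  exact multipliable_one_add_of_summable (summable_norm_pow_succ_mul hp u)

/-- Splitting off the first factor gives the q-difference equation that is responsible for the
behaviour of the elliptic `s` under x ↦ x + ia. -/
theorem eulerProd_eq_mul {p : ℂ} (hp : ‖p‖ < 1) (u : ℂ) :
    eulerProd p u = (1 - p * u) * eulerProd p (p * u) := by
  have h := multipliable_eulerProd hp (p * u)
  unfold eulerProd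
  rw [tprod_eq_zero_mul' (f := fun n : ℕ => 1 - p ^ (n + 1) * u)]
  · congr 2
    · simp
    · ext n; ring
  · refine h.congr fun n => ?_
    ring

/-- An absolutely convergent product vanishes only if one of its factors does; this locates the
zeros of the elliptic `s`. -/
theorem exists_of_eulerProd_eq_zero {p : ℂ} (hp : ‖p‖ < 1) {u : ℂ} (h : eulerProd p u = 0) :
    ∃ n : ℕ, p ^ (n + 1) * u = 1 := by
  by_contra! hn
  refine tprod_one_add_ne_zero_of_summable (f := fun n : ℕ => -(p ^ (n + 1) * u)) ?_
    (summable_norm_pow_succ_mul hp u) ?_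
  · intro n hn'
    exact hn n (by linear_combination -hn')
  · simpa [eulerProd, sub_eq_add_neg] using h

theorem differentiable_eulerProd {p : ℂ} (hp : ‖p‖ < 1) : Differentiable ℂ (eulerProd p) := by
  have key : HasProdLocallyUniformlyOn (fun (n : ℕ) (u : ℂ) => 1 - p ^ (n + 1) * u)
      (eulerProd p) Set.univ := by
    simp_rw [sub_eq_add_neg]
    have : eulerProd p = fun u => ∏' n : ℕ, (1 + -(p ^ (n + 1) * u)) := by
      ext u; simp [eulerProd, sub_eq_add_neg]
    rw [this]
    apply hasProdLocallyUniformlyOn_of_forall_compact isOpen_univ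
    intro K _ hcK
    obtain ⟨R, hR⟩ := hcK.isBounded.exists_norm_le
    have hs : Summable fun n : ℕ => ‖p‖ ^ (n + 1) * |R| :=
      ((summable_nat_add_iff 1).mpr
        (summable_geometric_of_lt_one (norm_nonneg _) hp)).mul_right _
    refine hs.hasProdUniformlyOn_nat_one_add hcK (.of_forall fun n x hx => ?_)
      (fun _ => by fun_prop)
    rw [norm_neg, norm_mul, norm_pow]
    gcongr
    exact (hR x hx).trans (le_abs_self R)
  have h2 := key.differentiableOn
    (.of_forall fun _ => by
      simpa [Finset.prod_fn] using DifferentiableOn.finsetProd (fun _ _ => by fun_prop))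
    isOpen_univ
  exact differentiableOn_univ.mp h2

namespace Kind

/-- The nome `e^{-2ra}`. -/
noncomputable def nome (r a : ℝ) : ℂ := exp (-2 * r * a)

theorem norm_nome_lt_one {r a : ℝ} (hr : 0 < r) (ha : 0 < a) : ‖nome r a‖ < 1 := by
  rw [nome, norm_exp, Real.exp_lt_one_iff]
  simp
  positivity

/-- For τ = ira/π one has e^{2πiτ} = e^{-2ra}, and the prefactor e^{ra/4} cancels e^{iπτ/4}. Each
quadratic factor of the theta product splits into two linear ones, one for each Euler product. -/
theorem s_elliptic_eq {r a : ℝ} (hr : 0 < r) (ha : 0 < a) (x : ℂ) :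
    (elliptic r a).s x = 2 / r * eulerProd (nome r a) 1 * sin (r * x) *
      (eulerProd (nome r a) (exp (2 * I * r * x)) *
        eulerProd (nome r a) (exp (-(2 * I * r * x)))) := by
  have hp := norm_nome_lt_one hr ha
  have hpi : (Real.pi : ℂ) ≠ 0 := by exact_mod_cast Real.pi_ne_zero
  simp only [s, theta1, eulerProd]
  rw [← (multipliable_eulerProd hp _).tprod_mul (multipliable_eulerProd hp _),
    mul_right_comm (2 / (r : ℂ)) _ (sin _), mul_assoc (2 / (r : ℂ) * sin _),
    ← (multipliable_eulerProd hp _).tprod_mul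
      ((multipliable_eulerProd hp _).mul (multipliable_eulerProd hp _))]
  have e1 : exp (r * a / 4) * exp (Real.pi * I * (I * r * a / Real.pi) / 4) = 1 := by
    rw [← exp_add, exp_eq_one_iff]
    refine ⟨0, ?_⟩
    field_simp
    linear_combination (r * a : ℂ) * I_sq
  have e2 : ∀ n : ℕ, exp (2 * Real.pi * I * (n + 1) * (I * r * a / Real.pi)) =
      nome r a ^ (n + 1) := by
    intro n
    rw [nome, ← exp_nat_mul]
    congr 1
    field_simp
    push_cast
    linear_combination (r * a * (n + 1) : ℂ) * I_sq
  have e3 : ∀ n : ℕ, exp (4 * Real.pi * I * (n + 1) * (I * r * a / Real.pi)) =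
      (nome r a ^ (n + 1)) ^ 2 := by
    intro n
    rw [← e2, ← exp_nat_mul]
    congr 1
    push_cast
    ring
  have e4 : 2 * cos (2 * (r * x)) = exp (2 * I * r * x) + exp (-(2 * I * r * x)) := by
    rw [two_cos]
    congr 2 <;> ring
  have e5 : exp (2 * I * r * x) * exp (-(2 * I * r * x)) = 1 := by
    rw [← exp_add]; simp
  simp_rw [e2, e3]
  have : ∀ n : ℕ, (1 - nome r a ^ (n + 1)) *
      (1 - 2 * nome r a ^ (n + 1) * cos (2 * (r * x)) + (nome r a ^ (n + 1)) ^ 2) =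
      (1 - nome r a ^ (n + 1) * 1) * ((1 - nome r a ^ (n + 1) * exp (2 * I * r * x)) *
        (1 - nome r a ^ (n + 1) * exp (-(2 * I * r * x)))) := by
    intro n
    linear_combination (1 - nome r a ^ (n + 1)) * (-nome r a ^ (n + 1)) * e4
      - (1 - nome r a ^ (n + 1)) * (nome r a ^ (n + 1)) ^ 2 * e5
  simp_rw [this]
  linear_combination (2 / r * sin (r * x) * ∏' n : ℕ, (1 - nome r a ^ (n + 1) * 1) *
    ((1 - nome r a ^ (n + 1) * exp (2 * I * r * x)) *
        (1 - nome r a ^ (n + 1) * exp (-(2 * I * r * x)))) : ℂ) * e1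

theorem differentiable_s_elliptic {r a : ℝ} (hr : 0 < r) (ha : 0 < a) :
    Differentiable ℂ (elliptic r a).s := by
  have h : (elliptic r a).s = _ := funext (s_elliptic_eq hr ha)
  have := differentiable_eulerProd (norm_nome_lt_one hr ha)
  rw [h]
  fun_prop

theorem s_elliptic_neg {r a : ℝ} (hr : 0 < r) (ha : 0 < a) (x : ℂ) :
    (elliptic r a).s (-x) = -(elliptic r a).s x := by
  rw [s_elliptic_eq hr ha, s_elliptic_eq hr ha]
  simp only [mul_neg, sin_neg, neg_neg]
  ring

theorem s_elliptic_add_omega1 {r a : ℝ} (hr : 0 < r) (ha : 0 < a) (x : ℂ) :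
    (elliptic r a).s (x + Real.pi / r) = -(elliptic r a).s x := by
  have hr' : (r : ℂ) ≠ 0 := by exact_mod_cast hr.ne'
  rw [s_elliptic_eq hr ha, s_elliptic_eq hr ha]
  have e1 : (r : ℂ) * (x + Real.pi / r) = r * x + Real.pi := by field_simp
  have e2 : (2 * I * r * (x + Real.pi / r) : ℂ) = 2 * I * r * x + 2 * Real.pi * I := by
    field_simp
  rw [e2, e1, exp_add, exp_two_pi_mul_I, sin_add_pi, neg_add, exp_add, exp_neg (2 * Real.pi * I),
    exp_two_pi_mul_I]
  simp

/-- The shift multiplies e^{2irx} by the nome and divides e^{-2irx} by it. One application of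
`eulerProd_eq_mul` to each Euler product leaves two linear factors, which combine with the sines. -/
theorem s_elliptic_add_omega2 {r a : ℝ} (hr : 0 < r) (ha : 0 < a) (x : ℂ) :
    (elliptic r a).s (x + I * a) =
      -exp (r * a) * exp (-(2 * I * r * x)) * (elliptic r a).s x := by
  have hp := norm_nome_lt_one hr ha
  rw [s_elliptic_eq hr ha, s_elliptic_eq hr ha]
  have e2 : exp (2 * I * r * (x + I * a)) = nome r a * exp (2 * I * r * x) := by
    rw [nome, ← exp_add]
    congr 1
    linear_combination (2 * r * a : ℂ) * I_sq
  have e3 : exp (-(2 * I * r * x)) = nome r a * exp (-(2 * I * r * (x + I * a))) := by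
    rw [nome, ← exp_add]
    congr 1
    linear_combination (2 * r * a : ℂ) * I_sq
  have h1 := eulerProd_eq_mul hp (exp (2 * I * r * x))
  have h2 := eulerProd_eq_mul hp (exp (-(2 * I * r * (x + I * a))))
  rw [← e2] at h1
  rw [← e3] at h2
  rw [h1, h2]
  have s1 : sin (r * (x + I * a)) = (exp (-(I * r * x)) * exp (r * a) -
      exp (I * r * x) * exp (-(r * a))) * I / 2 := by
    rw [sin, ← exp_add, ← exp_add]
    congr 4
    · linear_combination (-r * a : ℂ) * I_sq
    · linear_combination (r * a : ℂ) * I_sq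
  have s2 : sin (r * x) = (exp (-(I * r * x)) - exp (I * r * x)) * I / 2 := by
    rw [sin]
    congr 4 <;> ring
  have t1 : exp (2 * I * r * x) = exp (I * r * x) ^ 2 := by
    rw [← exp_nat_mul]; congr 1; push_cast; ring
  have t2 : exp (-(2 * I * r * x)) = exp (-(I * r * x)) ^ 2 := by
    rw [← exp_nat_mul]; congr 1; push_cast; ring
  have t3 : nome r a = exp (-(r * a)) ^ 2 := by
    rw [nome, ← exp_nat_mul]; congr 1; push_cast; ring
  have u1 : exp (I * r * x) * exp (-(I * r * x)) = 1 := by rw [← exp_add]; simp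
  have u2 : exp (r * a : ℂ) * exp (-(r * a)) = 1 := by rw [← exp_add]; simp
  rw [e2, s1, s2, t1, t2, t3]
  -- What remains is a rational identity in v = e^{irx} and w = e^{ra}; the Euler products only go
  -- along as constants.
  generalize eulerProd _ _ = A
  generalize eulerProd _ _ = B
  generalize eulerProd _ _ = C
  generalize exp (I * r * x) = v at *
  generalize exp (-(I * r * x)) = v' at *
  generalize exp (r * a : ℂ) = w at *
  generalize exp (-(r * a : ℂ)) = w' at *
  have hv : v ≠ 0 := left_ne_zero_of_mul_eq_one u1
  have hw : w ≠ 0 := left_ne_zero_of_mul_eq_one u2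
  obtain rfl : v' = v⁻¹ := eq_inv_of_mul_eq_one_right u1
  obtain rfl : w' = w⁻¹ := eq_inv_of_mul_eq_one_right u2
  field_simp
  ring

theorem mem_Omega_elliptic (r a : ℝ) (k l : ℤ) :
    (k : ℂ) * (Real.pi / r) + l * (I * a) ∈ (elliptic r a).Omega := by
  refine add_mem ?_ ?_
  · rw [← zsmul_eq_mul]
    refine zsmul_mem (AddSubgroup.subset_closure ?_) _
    exact ⟨1, by simp [rho], by simp [omega, omega1]⟩
  · rw [← zsmul_eq_mul]
    refine zsmul_mem (AddSubgroup.subset_closure ?_) _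
    exact ⟨2, by simp [rho], by simp [omega, omega2]⟩

theorem eulerProd_nome_one_ne_zero {r a : ℝ} (hr : 0 < r) (ha : 0 < a) :
    eulerProd (nome r a) 1 ≠ 0 := by
  intro h
  have hp := norm_nome_lt_one hr ha
  obtain ⟨n, hn⟩ := exists_of_eulerProd_eq_zero hp h
  have := congrArg norm hn
  rw [mul_one, norm_pow, norm_one] at this
  exact (pow_lt_one₀ (norm_nonneg _) hp (Nat.succ_ne_zero n)).ne this

/-- The sine contributes the lattice points with l = 0, the two Euler products those with l < 0 and
l > 0. -/
theorem exists_of_s_elliptic_eq_zero {r a : ℝ} (hr : 0 < r) (ha : 0 < a) {x : ℂ}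
    (h : (elliptic r a).s x = 0) : ∃ k l : ℤ, x = k * (Real.pi / r) + l * (I * a) := by
  have hr' : (r : ℂ) ≠ 0 := by exact_mod_cast hr.ne'
  have hp := norm_nome_lt_one hr ha
  rw [s_elliptic_eq hr ha] at h
  have h0 := eulerProd_nome_one_ne_zero hr ha
  simp only [mul_eq_zero, div_eq_zero_iff, h0, hr', OfNat.ofNat_ne_zero, false_or] at h
  rcases h with h | h | h
  · obtain ⟨k, hk⟩ := sin_eq_zero_iff.mp h
    refine ⟨k, 0, ?_⟩
    field_simp
    push_cast
    linear_combination hk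
  · obtain ⟨n, hn⟩ := exists_of_eulerProd_eq_zero hp h
    rw [nome, ← exp_nat_mul, ← exp_add, exp_eq_one_iff] at hn
    obtain ⟨k, hk⟩ := hn
    refine ⟨k, -(n + 1), ?_⟩
    field_simp
    push_cast at hk ⊢
    linear_combination (-I / 2) * hk + (r * x - Real.pi * k : ℂ) * I_sq
  · obtain ⟨n, hn⟩ := exists_of_eulerProd_eq_zero hp h
    rw [nome, ← exp_nat_mul, ← exp_add, exp_eq_one_iff] at hn
    obtain ⟨k, hk⟩ := hn
    refine ⟨-k, n + 1, ?_⟩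
    field_simp
    push_cast at hk ⊢
    linear_combination (I / 2) * hk + (r * x + Real.pi * k : ℂ) * I_sq

/-- Only the sine vanishes at 0. What matters is that the derivative is nonzero: the zero at 0 is
simple. -/
theorem hasDerivAt_s_elliptic_zero {r a : ℝ} (hr : 0 < r) (ha : 0 < a) :
    HasDerivAt (elliptic r a).s (2 * eulerProd (nome r a) 1 ^ 3) 0 := by
  have hr' : (r : ℂ) ≠ 0 := by exact_mod_cast hr.ne'
  have h : (elliptic r a).s = _ := funext (s_elliptic_eq hr ha)
  have hd := differentiable_eulerProd (norm_nome_lt_one hr ha)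
  rw [h]
  have h1 : HasDerivAt (fun x : ℂ => 2 / r * eulerProd (nome r a) 1 * sin (r * x))
      (2 / r * eulerProd (nome r a) 1 * (cos (r * 0) * (r * 1))) 0 :=
    (((hasDerivAt_id (0 : ℂ)).const_mul (r : ℂ)).csin).const_mul _
  have h2 : DifferentiableAt ℂ (fun x : ℂ => eulerProd (nome r a) (exp (2 * I * r * x)) *
        eulerProd (nome r a) (exp (-(2 * I * r * x)))) 0 := by fun_prop
  refine (h1.mul h2.hasDerivAt).congr_deriv ?_
  simp
  field_simp

end Kind
end SenOperator

/-! ### Entire quotients and elliptic functions without poles -/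

namespace SenOperator

/-- The zeros of d are simple and are zeros of h, so the singularities of h/d are removable. Near
such a zero x the quotient is `dslope h x / dslope d x`, whose value at x is h'(x)/d'(x). -/
theorem exists_entire_quotient {h d : ℂ → ℂ} (hh : Differentiable ℂ h) (hd : Differentiable ℂ d)
    (hz : ∀ x, d x = 0 → h x = 0 ∧ deriv d x ≠ 0) :
    ∃ g : ℂ → ℂ, Differentiable ℂ g ∧ ∀ x, h x = g x * d x := by
  classical
  refine ⟨fun x => if d x = 0 then deriv h x / deriv d x else h x / d x, ?_, ?_⟩
  · intro x
    by_cases hx : d x = 0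
    · obtain ⟨hx1, hx2⟩ := hz x hx
      have h1 : Differentiable ℂ (dslope h x) :=
        differentiableOn_univ.mp ((differentiableOn_dslope Filter.univ_mem).mpr hh.differentiableOn)
      have h2 : Differentiable ℂ (dslope d x) :=
        differentiableOn_univ.mp ((differentiableOn_dslope Filter.univ_mem).mpr hd.differentiableOn)
      have h3 : dslope d x x ≠ 0 := by rwa [dslope_same]
      have h4 : ∀ᶠ y in nhds x, dslope d x y ≠ 0 := h2.continuous.continuousAt.eventually_ne h3
      refine ((h1 x).div (h2 x) h3).congr_of_eventuallyEq ?_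
      filter_upwards [h4] with y hy
      have e1 := sub_smul_dslope h x y
      have e2 := sub_smul_dslope d x y
      rw [hx1, sub_zero, smul_eq_mul] at e1
      rw [hx, sub_zero, smul_eq_mul] at e2
      by_cases hxy : y = x
      · subst hxy
        simp [hx]
      · have hxy' := sub_ne_zero.mpr hxy
        have : d y ≠ 0 := by
          rw [← e2]
          exact mul_ne_zero hxy' hy
        rw [if_neg this, Pi.div_apply, ← e1, ← e2, mul_div_mul_left _ _ hxy']
    · have h4 : ∀ᶠ y in nhds x, d y ≠ 0 := hd.continuous.continuousAt.eventually_ne hx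
      refine ((hh x).div (hd x) hx).congr_of_eventuallyEq ?_
      filter_upwards [h4] with y hy
      rw [if_neg hy, Pi.div_apply]
  · intro x
    by_cases hx : d x = 0
    · rw [hx, mul_zero, (hz x hx).1]
    · simp only [if_neg hx]
      field_simp

/-- Liouville's theorem: subtracting periods with the floor function moves every point into a fixed
compact ball, so g is bounded. -/
theorem eq_of_doubly_periodic {b a : ℝ} (hb : 0 < b) (ha : 0 < a) {g : ℂ → ℂ}
    (hg : Differentiable ℂ g) (h1 : Function.Periodic g (b : ℂ))
    (h2 : Function.Periodic g (I * a)) (x y : ℂ) : g x = g y := by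
  refine hg.apply_eq_apply_of_bounded ?_ x y
  obtain ⟨C, hC⟩ := (isCompact_closedBall (0 : ℂ) (b + a)).exists_bound_of_continuousOn
    hg.continuous.continuousOn
  refine (Metric.isBounded_closedBall (x := (0 : ℂ)) (r := C)).subset ?_
  rintro _ ⟨z, rfl⟩
  rw [mem_closedBall_zero_iff]
  rw [← h1.sub_zsmul_eq ⌊z.re / b⌋, ← h2.sub_zsmul_eq ⌊z.im / a⌋]
  apply hC
  rw [mem_closedBall_zero_iff]
  refine (norm_le_abs_re_add_abs_im _).trans ?_
  have r1 : ∀ t c : ℝ, 0 < c → |t - ⌊t / c⌋ * c| ≤ c := by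
    intro t c hc
    rw [abs_le]
    have u1 := Int.floor_le (t / c)
    have u2 := (Int.lt_floor_add_one (t / c)).le
    rw [le_div_iff₀ hc] at u1
    rw [div_le_iff₀ hc] at u2
    constructor <;> nlinarith
  have e1 := r1 z.re b hb
  have e2 := r1 z.im a ha
  refine add_le_add ?_ ?_
  · simpa using e1
  · simpa using e2

/-! ### Quasi-periods and Weierstrass's three-term relation for the elliptic `s` -/

/-- The numbers `w` such that `s(t + w) / s(t)` is an exponential function of `t`. -/
def quasiPeriods (s : ℂ → ℂ) : AddSubgroup ℂ where
  carrier := {w | ∃ A c : ℂ, A ≠ 0 ∧ ∀ t, s (t + w) = A * exp (c * t) * s t}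
  zero_mem' := ⟨1, 0, one_ne_zero, by simp⟩
  add_mem' := by
    rintro v w ⟨A, c, hA, h⟩ ⟨B, d, hB, h'⟩
    refine ⟨A * B * exp (d * v), c + d, by simp [hA, hB], fun t => ?_⟩
    rw [← add_assoc, h', h, add_mul, mul_add, exp_add, exp_add]
    ring
  neg_mem' := by
    rintro v ⟨A, c, hA, h⟩
    refine ⟨A⁻¹ * exp (c * v), -c, by simp [hA], fun t => ?_⟩
    have := h (t + -v)
    rw [neg_add_cancel_right] at this
    rw [this, mul_add, exp_add, neg_mul, exp_neg, mul_neg, exp_neg]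
    field_simp

theorem countable_affine_preimage {S : Set ℂ} (hS : S.Countable) {c : ℂ} (hc : c ≠ 0) (e : ℂ) :
    {z : ℂ | c * z + e ∈ S}.Countable := by
  refine hS.preimage_of_injOn (f := fun z => c * z + e) fun x _ y _ hxy => ?_
  exact mul_left_cancel₀ hc (add_right_cancel hxy)

namespace Kind

theorem countable_s_elliptic_eq_zero {r a : ℝ} (hr : 0 < r) (ha : 0 < a) :
    {x | (elliptic r a).s x = 0}.Countable := by
  refine (Set.countable_range fun n : ℤ × ℤ => (n.1 * (Real.pi / r) + n.2 * (I * a) : ℂ)).mono ?_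
  intro x hx
  obtain ⟨k, l, h⟩ := exists_of_s_elliptic_eq_zero hr ha hx
  exact ⟨(k, l), h.symm⟩

/-- Zeros are lattice points and quasi-periods form a group, so only the two generating periods have
to be checked. Thus `s` around any zero is an exponential times `s` around 0. -/
theorem mem_quasiPeriods_of_s_elliptic_eq_zero {r a : ℝ} (hr : 0 < r) (ha : 0 < a) {x : ℂ}
    (h : (elliptic r a).s x = 0) : x ∈ quasiPeriods (elliptic r a).s := by
  obtain ⟨k, l, rfl⟩ := exists_of_s_elliptic_eq_zero hr ha h
  refine add_mem ?_ ?_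
  · rw [← zsmul_eq_mul]
    refine zsmul_mem ?_ _
    refine ⟨-1, 0, by simp, fun t => ?_⟩
    simp [s_elliptic_add_omega1 hr ha]
  · rw [← zsmul_eq_mul]
    refine zsmul_mem ?_ _
    refine ⟨-exp (r * a), -(2 * I * r), by simp, fun t => ?_⟩
    rw [s_elliptic_add_omega2 hr ha]
    ring_nf

theorem s_elliptic_zero {r a : ℝ} (hr : 0 < r) (ha : 0 < a) : (elliptic r a).s 0 = 0 := by
  have := s_elliptic_neg hr ha 0
  rw [neg_zero] at this
  linear_combination this / 2

theorem deriv_s_elliptic_ne_zero {r a : ℝ} (hr : 0 < r) (ha : 0 < a) {x : ℂ}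
    (h : (elliptic r a).s x = 0) : deriv (elliptic r a).s x ≠ 0 := by
  obtain ⟨A, c, hA, hx⟩ := mem_quasiPeriods_of_s_elliptic_eq_zero hr ha h
  have h1 := hasDerivAt_s_elliptic_zero hr ha
  have h2 : HasDerivAt (fun t : ℂ => A * exp (c * t)) (A * (exp (c * 0) * (c * 1))) 0 :=
    (((hasDerivAt_id (0 : ℂ)).const_mul c).cexp).const_mul A
  have h3 := h2.mul h1
  rw [s_elliptic_zero hr ha] at h3
  have h4 : HasDerivAt (fun t : ℂ => (elliptic r a).s (t + x))
      (deriv (elliptic r a).s x) 0 := by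
    have := (differentiable_s_elliptic hr ha (0 + x)).hasDerivAt
    rw [zero_add] at this
    exact HasDerivAt.comp_add_const 0 x (by rwa [zero_add])
  have h5 : (fun t : ℂ => (elliptic r a).s (t + x)) =
    (fun t : ℂ => A * exp (c * t)) * (elliptic r a).s := funext hx
  rw [h5] at h4
  rw [h4.unique h3]
  simp [hA, eulerProd_nome_one_ne_zero hr ha]

/-- Weierstrass's three-term relation for a function `s`. -/
def ThreeTerm (s : ℂ → ℂ) : Prop :=
  ∀ x y z w : ℂ, s (x + y) * s (x - y) * (s (z + w) * s (z - w)) +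
    s (y + z) * s (y - z) * (s (x + w) * s (x - w)) +
    s (z + x) * s (z - x) * (s (y + w) * s (y - w)) = 0

/-- In terms of squares the relation becomes (X - Y)(Z - W) + (Y - Z)(X - W) + (Z - X)(Y - W) = 0.
-/
theorem threeTerm_of_sub_sq {s : ℂ → ℂ}
    (h : ∀ x y, s (x + y) * s (x - y) = s x ^ 2 - s y ^ 2) : ThreeTerm s := by
  intro x y z w
  simp only [h]
  ring

/-- As functions of x, the left side h and d = s(x - y) s(x + y) acquire the same multipliers under
both periods. For generic y the zeros of d are simple and h vanishes at them, so h/d is entire and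
doubly periodic, hence constant. It vanishes at x = w. -/
theorem threeTerm_elliptic {r a : ℝ} (hr : 0 < r) (ha : 0 < a) :
    ThreeTerm (elliptic r a).s := by
  intro x y z w
  set s := (elliptic r a).s with hs
  have hdiff : Differentiable ℂ s := differentiable_s_elliptic hr ha
  have hcont : Continuous s := hdiff.continuous
  have hneg : ∀ x, s (-x) = -s x := s_elliptic_neg hr ha
  have h0 : s 0 = 0 := s_elliptic_zero hr ha
  have hcount : {x | s x = 0}.Countable := countable_s_elliptic_eq_zero hr ha
  have hqp : ∀ x, s x = 0 → ∃ A c : ℂ, A ≠ 0 ∧ ∀ t, s (t + x) = A * exp (c * t) * s t :=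
    fun x hx => mem_quasiPeriods_of_s_elliptic_eq_zero hr ha hx
  have hd0 : ∀ x, s x = 0 → deriv s x ≠ 0 := fun x hx => deriv_s_elliptic_ne_zero hr ha hx
  have w1 : ∀ x, s (x + Real.pi / r) = -s x := s_elliptic_add_omega1 hr ha
  have w2 : ∀ x, s (x + I * a) = -exp (r * a) * exp (-(2 * I * r * x)) * s x :=
    s_elliptic_add_omega2 hr ha
  have hsub : ∀ x y, s (x - y) = -s (y - x) := fun x y => by rw [← hneg, neg_sub]
  clear_value s
  -- by density, a generic `y` suffices
  have hdense : Dense ({y : ℂ | 2 * y + 0 ∈ {x | s x = 0}} ∪ ({y : ℂ | 1 * y + w ∈ {x | s x = 0}} ∪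
      {y : ℂ | -1 * y + w ∈ {x | s x = 0}}))ᶜ :=
    ((countable_affine_preimage hcount two_ne_zero 0).union
      ((countable_affine_preimage hcount one_ne_zero w).union
        (countable_affine_preimage hcount (neg_ne_zero.mpr one_ne_zero) w))).dense_compl ℂ
  refine congrFun (Continuous.ext_on hdense (f := fun y => s (x + y) * s (x - y) *
    (s (z + w) * s (z - w)) + s (y + z) * s (y - z) * (s (x + w) * s (x - w)) +
    s (z + x) * s (z - x) * (s (y + w) * s (y - w))) (g := fun _ => 0)
    (by fun_prop) (by fun_prop) ?_) y
  intro y hy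
  simp only [Set.mem_compl_iff, Set.mem_union, Set.mem_ofPred_eq, not_or, add_zero, one_mul,
    neg_one_mul] at hy
  obtain ⟨hy1, hy2, hy3⟩ := hy
  replace hy3 : s (w - y) ≠ 0 := by rwa [sub_eq_neg_add]
  replace hy2 : s (w + y) ≠ 0 := by rwa [add_comm]
  let h : ℂ → ℂ := fun x => s (x + y) * s (x - y) * (s (z + w) * s (z - w)) +
    s (y + z) * s (y - z) * (s (x + w) * s (x - w)) +
    s (z + x) * s (z - x) * (s (y + w) * s (y - w))
  let d : ℂ → ℂ := fun x => s (x - y) * s (x + y)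
  have hzero : ∀ x, d x = 0 → h x = 0 ∧ deriv d x ≠ 0 := by
    intro x hx
    have hder : HasDerivAt d (deriv s (x - y) * s (x + y) + s (x - y) * deriv s (x + y)) x :=
      (HasDerivAt.comp_sub_const x y (hdiff _).hasDerivAt).mul
        (HasDerivAt.comp_add_const x y (hdiff _).hasDerivAt)
    rw [hder.deriv]
    -- If both factors vanished, 2y = (x + y) - (x - y) would be a zero, which the choice of y
    -- excludes; so the zeros of d are simple.
    have hboth : ¬ (s (x - y) = 0 ∧ s (x + y) = 0) := by
      rintro ⟨q1, q2⟩
      obtain ⟨A, c, hA, hq⟩ := hqp _ q1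
      have := hq (2 * y)
      rw [show 2 * y + (x - y) = x + y by ring, q2] at this
      simp [hA, hy1] at this
    rcases mul_eq_zero.mp hx with hx | hx
    · have hx' : s (x + y) ≠ 0 := fun q => hboth ⟨hx, q⟩
      refine ⟨?_, by simp [hx, hx', hd0 _ hx]⟩
      -- Here x - y is a quasi-period, so up to exponential multipliers x may be replaced by y; then
      -- the last two terms cancel.
      obtain ⟨A, c, hA, hq⟩ := hqp _ hx
      have q1 := hq (y + w)
      have q2 := hq (y - w)
      have q3 := hq (y + z)
      have q4 := hq (y - z)
      rw [show y + w + (x - y) = x + w by ring, mul_add, exp_add] at q1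
      rw [show y - w + (x - y) = x - w by ring, mul_sub, exp_sub] at q2
      rw [show y + z + (x - y) = x + z by ring, mul_add, exp_add] at q3
      rw [show y - z + (x - y) = x - z by ring, mul_sub, exp_sub] at q4
      simp only [h]
      rw [add_comm z x, hsub z x, q1, q2, q3, q4, hx]
      field_simp
      ring
    · have hx' : s (x - y) ≠ 0 := fun q => hboth ⟨q, hx⟩
      refine ⟨?_, by simp [hx, hx', hd0 _ hx]⟩
      -- Likewise with x replaced by -y.
      obtain ⟨A, c, hA, hq⟩ := hqp _ hx
      have q1 := hq (w - y)
      have q2 := hq (-(y + w))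
      have q3 := hq (z - y)
      have q4 := hq (-(y + z))
      rw [show w - y + (x + y) = x + w by ring, mul_sub, exp_sub] at q1
      rw [show -(y + w) + (x + y) = x - w by ring, mul_neg, exp_neg, mul_add, exp_add, hneg] at q2
      rw [show z - y + (x + y) = x + z by ring, mul_sub, exp_sub] at q3
      rw [show -(y + z) + (x + y) = x - z by ring, mul_neg, exp_neg, mul_add, exp_add, hneg] at q4
      simp only [h]
      rw [add_comm z x, hsub z x, q1, q2, q3, q4, hx, hsub y z, hsub y w]
      field_simp
      ring
  obtain ⟨g, hg, hgd⟩ := exists_entire_quotient (h := h) (d := d) (by fun_prop) (by fun_prop) hzero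
  have hdne : Dense {x | d x ≠ 0} := by
    have := ((countable_affine_preimage hcount one_ne_zero (-y)).union
      (countable_affine_preimage hcount one_ne_zero y)).dense_compl ℂ
    refine this.mono fun x hx => ?_
    simp only [Set.mem_compl_iff, Set.mem_union, Set.mem_ofPred_eq, one_mul, not_or] at hx
    exact mul_ne_zero (by simpa [sub_eq_add_neg] using hx.1) hx.2
  have hper : ∀ c : ℂ, (∀ x, ∃ u ≠ 0, h (x + c) = u * h x ∧ d (x + c) = u * d x) →
      Function.Periodic g c := by
    intro c hc
    refine congrFun (Continuous.ext_on hdne (f := fun x => g (x + c)) (g := g)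
      (hg.continuous.comp (by fun_prop)) hg.continuous fun x hx => ?_)
    obtain ⟨u, hu, e1, e2⟩ := hc x
    rw [hgd, hgd x, e2] at e1
    exact mul_right_cancel₀ (mul_ne_zero hu hx) (by linear_combination e1)
  have hb : 0 < Real.pi / r := div_pos Real.pi_pos hr
  have hg0 : ∀ x, g x = 0 := by
    intro x
    -- In a product s(x + y) s(x - y) the shift by π/r gives (-1)² = 1 and the shift by ia gives
    -- e^{2ra - 4irx}. Neither depends on y, so h and d share the multiplier.
    rw [eq_of_doubly_periodic hb ha hg (hper _ fun x => ⟨1, one_ne_zero, ?_⟩)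
      (hper _ fun x => ⟨exp (r * a) ^ 2 * exp (-(2 * I * r * x)) ^ 2, by simp, ?_⟩) x w]
    · have e1 := hgd w
      have e2 : h w = 0 := by
        simp only [h]
        rw [sub_self, h0, hsub w y, hsub z w, add_comm w y, add_comm z w]
        ring
      rw [e2] at e1
      exact (mul_eq_zero.mp e1.symm).resolve_right (mul_ne_zero hy3 hy2)
    · push_cast
      have e1 : ∀ y, s (x + Real.pi / r + y) = -s (x + y) := fun y => by
        rw [add_right_comm, w1]
      have e2 : ∀ y, s (x + Real.pi / r - y) = -s (x - y) := fun y => by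
        rw [sub_eq_add_neg, e1, ← sub_eq_add_neg]
      have e3 := e1 z
      have e4 := e2 z
      simp only [h, d, add_comm z, hsub z, e1, e2]
      constructor <;> ring
    · have e1 : ∀ y, s (x + I * a + y) =
          -exp (r * a) * exp (-(2 * I * r * x)) * exp (-(2 * I * r * y)) * s (x + y) := fun y => by
        rw [add_right_comm, w2, mul_add, neg_add, exp_add]
        ring
      have e2 : ∀ y, s (x + I * a - y) =
          -exp (r * a) * exp (-(2 * I * r * x)) / exp (-(2 * I * r * y)) * s (x - y) := fun y => by
        rw [sub_eq_add_neg, e1, ← sub_eq_add_neg, mul_neg, exp_neg, exp_neg, exp_neg]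
        field_simp
      simp only [h, d, add_comm z, hsub z, e1, e2]
      constructor
      · field_simp
      · field_simp
  have := hgd x
  rw [hg0, zero_mul] at this
  exact this

end Kind
end SenOperator

/-! ### Properties of `s` common to the four cases -/

namespace SenOperator

namespace Kind

/-- The cases (I)-(III). -/
def Degenerate : Kind → Prop
  | elliptic _ _ => False
  | _ => True

theorem differentiable_s {K : Kind} (hK : K.Valid) : Differentiable ℂ K.s := by
  cases K with
  | rational => exact differentiable_id
  | trigonometric r =>
    have : (trigonometric r).s = fun x => (1 / (r : ℂ)) * sin (r * x) := rfl
    rw [this]; fun_prop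
  | hyperbolic a =>
    have : (hyperbolic a).s = fun x => ((a : ℂ) / Real.pi) * sinh (Real.pi * x / a) := rfl
    rw [this]; fun_prop
  | elliptic r a => exact differentiable_s_elliptic hK.1 hK.2

theorem s_neg {K : Kind} (hK : K.Valid) (x : ℂ) : K.s (-x) = -K.s x := by
  cases K with
  | rational => rfl
  | trigonometric r => simp [s]
  | hyperbolic a => simp [s, neg_div]
  | elliptic r a => exact s_elliptic_neg hK.1 hK.2 x

theorem s_zero {K : Kind} (hK : K.Valid) : K.s 0 = 0 := by
  have := s_neg hK 0
  rw [neg_zero] at this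
  linear_combination this / 2

theorem s_sub_comm {K : Kind} (hK : K.Valid) (x y : ℂ) : K.s (x - y) = -K.s (y - x) := by
  rw [← s_neg hK, neg_sub]

theorem countable_s_eq_zero {K : Kind} (hK : K.Valid) : {x | K.s x = 0}.Countable := by
  have hpi : (Real.pi : ℂ) ≠ 0 := by exact_mod_cast Real.pi_ne_zero
  cases K with
  | rational =>
    refine (Set.countable_singleton (0 : ℂ)).mono fun x hx => ?_
    exact hx
  | trigonometric r =>
    have hr : (r : ℂ) ≠ 0 := by exact_mod_cast (show 0 < r from hK).ne'
    refine (Set.countable_range fun n : ℤ => (n * Real.pi / r : ℂ)).mono fun x hx => ?_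
    have hx' : (1 / (r : ℂ)) * sin (r * x) = 0 := hx
    obtain ⟨k, hk⟩ := sin_eq_zero_iff.mp ((mul_eq_zero.mp hx').resolve_left (by simp [hr]))
    refine ⟨k, ?_⟩
    simp only
    rw [← hk]
    field_simp
  | hyperbolic a =>
    have ha : (a : ℂ) ≠ 0 := by exact_mod_cast (show 0 < a from hK).ne'
    refine (Set.countable_range fun n : ℤ => (n * a / I : ℂ)).mono fun x hx => ?_
    have hx' : ((a : ℂ) / Real.pi) * sinh (Real.pi * x / a) = 0 := hx
    have hx2 : sin (Real.pi * x / a * I) = 0 := by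
      rw [sin_mul_I, (mul_eq_zero.mp hx').resolve_left (by simp [ha]), zero_mul]
    obtain ⟨k, hk⟩ := sin_eq_zero_iff.mp hx2
    refine ⟨k, ?_⟩
    simp only
    field_simp at hk ⊢
    linear_combination -hk
  | elliptic r a => exact countable_s_elliptic_eq_zero hK.1 hK.2

theorem s_mul_s {K : Kind} (hK : K.Valid) (hd : K.Degenerate) (x y : ℂ) :
    K.s (x + y) * K.s (x - y) = K.s x ^ 2 - K.s y ^ 2 := by
  cases K with
  | rational => simp only [s]; ring
  | trigonometric r =>
    simp only [s, mul_add, mul_sub, sin_add, sin_sub]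
    linear_combination (1 / (r : ℂ)) ^ 2 * (sin (r * x) ^ 2 * sin_sq_add_cos_sq (r * y) -
      sin (r * y) ^ 2 * sin_sq_add_cos_sq (r * x))
  | hyperbolic a =>
    simp only [s, mul_add, mul_sub, add_div, sub_div, sinh_add, sinh_sub]
    linear_combination ((a : ℂ) / Real.pi) ^ 2 *
      (sinh (Real.pi * x / a) ^ 2 * cosh_sq_sub_sinh_sq (Real.pi * y / a) -
      sinh (Real.pi * y / a) ^ 2 * cosh_sq_sub_sinh_sq (Real.pi * x / a))
  | elliptic r a => exact hd.elim

theorem threeTerm {K : Kind} (hK : K.Valid) : ThreeTerm K.s := by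
  by_cases hd : K.Degenerate
  · exact threeTerm_of_sub_sq (s_mul_s hK hd)
  · cases K with
    | elliptic r a => exact threeTerm_elliptic hK.1 hK.2
    | _ => exact absurd trivial hd

/-- The three-term relation at z + ω₁/4, z - ω₁/4, -ω₁/4, ω₂/2 + ω₁/4: its first term is the left
side, and quasi-periodicity turns each of the other two into the same product of s(z + ω_ν/2),
whence the factor 2. -/
theorem s_two_mul_elliptic {r a : ℝ} (hr : 0 < r) (ha : 0 < a) (z : ℂ) :
    (elliptic r a).s (2 * z) * ((elliptic r a).s ((Real.pi / r) / 2) *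
        (elliptic r a).s (I * a / 2) * (elliptic r a).s ((-(Real.pi / r) - I * a) / 2)) =
      2 * ((elliptic r a).s z * (elliptic r a).s (z + (Real.pi / r) / 2) *
        (elliptic r a).s (z + I * a / 2) *
        (elliptic r a).s (z + (-(Real.pi / r) - I * a) / 2)) := by
  have hr' : (r : ℂ) ≠ 0 := by exact_mod_cast hr.ne'
  have h3 := threeTerm_elliptic hr ha
  have hneg := s_elliptic_neg hr ha
  have w1 := s_elliptic_add_omega1 hr ha
  have w2 := s_elliptic_add_omega2 hr ha
  set b : ℂ := Real.pi / r with hb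
  set c : ℂ := I * a with hc
  set s := (elliptic r a).s
  have key := h3 (z + b / 2 / 2) (z - b / 2 / 2) (-(b / 2) / 2) (c / 2 + b / 2 / 2)
  have e1 : s (z - b / 2) = -s (z + b / 2) := by
    have := w1 (z - b / 2)
    rw [show z - b / 2 + b = z + b / 2 by ring] at this
    rw [this, neg_neg]
  have e2 : s (z + c / 2) = -exp (r * a) * exp (-(2 * I * r * (z - c / 2))) * s (z - c / 2) := by
    rw [← w2]
    ring_nf
  have e3 : s (z + b / 2 + c / 2) =
      -exp (r * a) * exp (-(2 * I * r * (z + b / 2 - c / 2))) * s (z + b / 2 - c / 2) := by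
    rw [← w2]
    ring_nf
  have e4 : s (z + b / 2 - c / 2) = -s (z - b / 2 - c / 2) := by
    rw [← w1]
    ring_nf
  have e5 : exp (-(2 * I * r * (z + b / 2 - c / 2))) =
      -exp (-(2 * I * r * (z - c / 2))) := by
    have : (-(2 * I * r * (z + b / 2 - c / 2)) : ℂ) =
        -(2 * I * r * (z - c / 2)) - Real.pi * I := by
      rw [hb]; field_simp; ring
    rw [this, exp_sub, exp_pi_mul_I]
    ring
  rw [show z + b / 2 / 2 + (z - b / 2 / 2) = 2 * z by ring,
    show z + b / 2 / 2 - (z - b / 2 / 2) = b / 2 by ring,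
    show -(b / 2) / 2 + (c / 2 + b / 2 / 2) = c / 2 by ring,
    show -(b / 2) / 2 - (c / 2 + b / 2 / 2) = (-b - c) / 2 by ring,
    show z - b / 2 / 2 + -(b / 2) / 2 = z - b / 2 by ring,
    show z - b / 2 / 2 - -(b / 2) / 2 = z by ring,
    show z + b / 2 / 2 + (c / 2 + b / 2 / 2) = z + b / 2 + c / 2 by ring,
    show z + b / 2 / 2 - (c / 2 + b / 2 / 2) = z - c / 2 by ring,
    show -(b / 2) / 2 + (z + b / 2 / 2) = z by ring,
    show -(b / 2) / 2 - (z + b / 2 / 2) = -(z + b / 2) by ring,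
    show z - b / 2 / 2 + (c / 2 + b / 2 / 2) = z + c / 2 by ring,
    show z - b / 2 / 2 - (c / 2 + b / 2 / 2) = z - b / 2 - c / 2 by ring, hneg, e1, e3, e4, e5] at key
  rw [show z + (-b - c) / 2 = z - b / 2 - c / 2 by ring, e2]
  rw [e2] at key
  linear_combination key

/-- The duplication formula of `s`. -/
theorem s_two_mul {K : Kind} (hK : K.Valid) (z : ℂ) :
    K.s (2 * z) * ∏ ν ∈ Finset.Icc 1 K.rho, K.s (K.omega ν / 2) =
      2 * ∏ μ ∈ Finset.range (K.rho + 1), K.s (z + K.omega μ / 2) := by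
  have hpi : (Real.pi : ℂ) ≠ 0 := by exact_mod_cast Real.pi_ne_zero
  cases K with
  | rational => simp [rho, s, omega]
  | trigonometric r =>
    have hr : (r : ℂ) ≠ 0 := by exact_mod_cast (show 0 < r from hK).ne'
    have e1 : (r : ℂ) * (Real.pi / r / 2) = Real.pi / 2 := by field_simp
    simp only [rho, s, omega, omega1, Finset.Icc_self, Finset.prod_singleton,
      Finset.prod_range_succ, Finset.prod_range_zero, one_mul, zero_div, mul_zero, add_zero, mul_add, e1,
      sin_add_pi_div_two, sin_pi_div_two, mul_left_comm (r : ℂ) 2, sin_two_mul]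
    ring
  | hyperbolic a =>
    have ha : (a : ℂ) ≠ 0 := by exact_mod_cast (show 0 < a from hK).ne'
    have e1 : (Real.pi : ℂ) * (I * a / 2) / a = Real.pi / 2 * I := by field_simp
    have e2 : (Real.pi : ℂ) * (2 * z) / a = 2 * (Real.pi * z / a) := by ring
    simp only [rho, s, omega, omega1, Finset.Icc_self, Finset.prod_singleton,
      Finset.prod_range_succ, Finset.prod_range_zero, one_mul, zero_div, mul_zero, sinh_zero, cosh_zero, mul_add,
      add_div, e1, e2, sinh_add, sinh_mul_I, cosh_mul_I, cos_pi_div_two, sin_pi_div_two,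
      sinh_two_mul]
    ring
  | elliptic r a =>
    have := s_two_mul_elliptic hK.1 hK.2 z
    have e : Finset.Icc 1 3 = {1, 2, 3} := rfl
    simp only [rho, e, omega, omega1, omega2, Finset.prod_range_succ, Finset.prod_range_zero,
      one_mul, zero_div, add_zero]
    rw [Finset.prod_insert (by simp), Finset.prod_insert (by simp), Finset.prod_singleton,
      ← this]
    simp only [mul_assoc]

theorem s_two_mul' {K : Kind} (hK : K.Valid) (z : ℂ) :
    K.s (2 * z) * ∏ ν ∈ Finset.Icc 1 K.rho, K.s (K.omega ν / 2) =
      2 * (-1) ^ K.rho * ∏ μ ∈ Finset.range (K.rho + 1), K.s (z - K.omega μ / 2) := by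
  have h := s_two_mul hK (-z)
  have : ∀ μ, K.s (-z + K.omega μ / 2) = -1 * K.s (z - K.omega μ / 2) := fun μ => by
    rw [neg_one_mul, ← s_neg hK]
    ring_nf
  simp only [this, Finset.prod_mul_distrib, Finset.prod_const, Finset.card_range, mul_neg,
    s_neg hK, pow_succ] at h
  linear_combination -h

theorem countable_s_affine {K : Kind} (hK : K.Valid) {c : ℂ} (hc : c ≠ 0) (e : ℂ) :
    {z : ℂ | K.s (c * z + e) = 0}.Countable :=
  countable_affine_preimage (countable_s_eq_zero hK) hc e

/-- If the product vanished, the duplication formula would make ∏ s(z + ω_μ/2) vanish for every z,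
although its zeros are countable. -/
theorem prod_half_omega_ne_zero {K : Kind} (hK : K.Valid) :
    ∏ ν ∈ Finset.Icc 1 K.rho, K.s (K.omega ν / 2) ≠ 0 := by
  intro h
  have hc : (⋃ μ ∈ Finset.range (K.rho + 1), {z | K.s (1 * z + K.omega μ / 2) = 0}).Countable :=
    (Finset.range (K.rho + 1)).countable_toSet.biUnion
      fun μ _ => countable_s_affine hK one_ne_zero _
  obtain ⟨z, hz⟩ := (hc.dense_compl ℂ).nonempty
  have h2 := s_two_mul hK z
  rw [h, mul_zero, eq_comm, mul_eq_zero, Finset.prod_eq_zero_iff] at h2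
  obtain ⟨μ, hμ, h3⟩ := h2.resolve_left two_ne_zero
  exact hz (Set.mem_biUnion hμ (by simpa using h3))

end Kind
end SenOperator

/-! ### The partial fraction identity -/

namespace SenOperator

namespace Kind

variable {K : Kind}

/-- The three-term relation with all variables centred at (p + q)/2. It expands s(z - p) s(z - q) in
two products of which one contains s(z - b) and the other s(z - a), so that division by s(z - a) s(z
- b) leaves one pole in each term. -/
theorem three_term_partial (hK : K.Valid) (z a b p q : ℂ) :
    K.s (z - p) * K.s (z - q) * (K.s (a - b) * K.s (a + b - p - q)) =
      K.s (a - p) * K.s (a - q) * (K.s (z - b) * K.s (z - (p + q - b))) -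
        K.s (b - p) * K.s (b - q) * (K.s (z - a) * K.s (z - (p + q - a))) := by
  have h := threeTerm hK (z - (p + q) / 2) ((q - p) / 2) (a - (p + q) / 2) (b - (p + q) / 2)
  rw [show z - (p + q) / 2 + (q - p) / 2 = z - p by ring,
    show z - (p + q) / 2 - (q - p) / 2 = z - q by ring,
    show a - (p + q) / 2 + (b - (p + q) / 2) = a + b - p - q by ring,
    show a - (p + q) / 2 - (b - (p + q) / 2) = a - b by ring,
    show (q - p) / 2 + (a - (p + q) / 2) = a - p by ring,
    show (q - p) / 2 - (a - (p + q) / 2) = -(a - q) by ring,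
    show z - (p + q) / 2 + (b - (p + q) / 2) = z - (p + q - b) by ring,
    show z - (p + q) / 2 - (b - (p + q) / 2) = z - b by ring,
    show a - (p + q) / 2 + (z - (p + q) / 2) = z - (p + q - a) by ring,
    show a - (p + q) / 2 - (z - (p + q) / 2) = -(z - a) by ring,
    show (q - p) / 2 + (b - (p + q) / 2) = b - p by ring,
    show (q - p) / 2 - (b - (p + q) / 2) = -(b - q) by ring] at h
  simp only [s_neg hK] at h
  linear_combination h

/-- Each product on the left is a difference of squares around (p + q)/2, and the common square s((q
- p)/2)² drops out. -/
theorem two_point_difference (hK : K.Valid) (hd : K.Degenerate) (a b p q : ℂ) :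
    K.s (a - p) * K.s (a - q) - K.s (b - p) * K.s (b - q) =
      K.s (a - b) * K.s (a + b - p - q) := by
  have h1 := s_mul_s hK hd (a - (p + q) / 2) ((q - p) / 2)
  have h2 := s_mul_s hK hd (b - (p + q) / 2) ((q - p) / 2)
  have h3 := s_mul_s hK hd (a - (p + q) / 2) (b - (p + q) / 2)
  rw [show a - (p + q) / 2 + (q - p) / 2 = a - p by ring,
    show a - (p + q) / 2 - (q - p) / 2 = a - q by ring] at h1
  rw [show b - (p + q) / 2 + (q - p) / 2 = b - p by ring,
    show b - (p + q) / 2 - (q - p) / 2 = b - q by ring] at h2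
  rw [show a - (p + q) / 2 + (b - (p + q) / 2) = a + b - p - q by ring,
    show a - (p + q) / 2 - (b - (p + q) / 2) = a - b by ring] at h3
  linear_combination h1 - h2 - h3

variable {ι : Type*} [DecidableEq ι]

/-- The sum of the residues of `z ↦ ∏ s(z - y_j) / s(z - x_j)`, for a function `s` normalized by
`s'(0) = 1`. -/
noncomputable def residueSum (s : ℂ → ℂ) (S : Finset ι) (x y : ι → ℂ) : ℂ :=
  ∑ k ∈ S, (∏ j ∈ S, s (x k - y j)) / ∏ j ∈ S.erase k, s (x k - x j)

theorem residueSum_insert {s : ℂ → ℂ} {R : Finset ι} {a : ι} (ha : a ∉ R) (x y : ι → ℂ) (u : ℂ) :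
    residueSum s (insert a R) x (Function.update y a u) =
      s (x a - u) * (∏ j ∈ R, s (x a - y j)) / (∏ j ∈ R, s (x a - x j)) +
      ∑ k ∈ R, s (x k - u) / s (x k - x a) *
        ((∏ j ∈ R, s (x k - y j)) / ∏ j ∈ R.erase k, s (x k - x j)) := by
  have hu : ∀ k, ∏ j ∈ R, s (x k - Function.update y a u j) = ∏ j ∈ R, s (x k - y j) :=
    fun k => Finset.prod_congr rfl fun j hj => by
      rw [Function.update_of_ne (ne_of_mem_of_not_mem hj ha)]
  rw [residueSum, Finset.sum_insert ha, Finset.prod_insert ha, Finset.erase_insert ha,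
    Function.update_self, hu]
  congr 1
  refine Finset.sum_congr rfl fun k hk => ?_
  have hka : k ≠ a := fun h => ha (h ▸ hk)
  rw [Finset.prod_insert ha, Finset.erase_insert_of_ne (Ne.symm hka),
    Finset.prod_insert (fun h => ha (Finset.mem_of_mem_erase h)), Function.update_self, hu,
    mul_div_mul_comm]

theorem residueSum_insert_insert {s : ℂ → ℂ} {R : Finset ι} {a b : ι} (hab : a ≠ b) (ha : a ∉ R)
    (hb : b ∉ R) (x y : ι → ℂ) :
    residueSum s (insert a (insert b R)) x y =
      s (x a - y a) * s (x a - y b) / s (x a - x b) *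
        ((∏ j ∈ R, s (x a - y j)) / (∏ j ∈ R, s (x a - x j))) +
      (s (x b - y a) * s (x b - y b) / s (x b - x a) *
        ((∏ j ∈ R, s (x b - y j)) / (∏ j ∈ R, s (x b - x j))) +
      ∑ k ∈ R, s (x k - y a) * s (x k - y b) / (s (x k - x a) * s (x k - x b)) *
        ((∏ j ∈ R, s (x k - y j)) / ∏ j ∈ R.erase k, s (x k - x j))) := by
  have ha' : a ∉ insert b R := by simp [hab, ha]
  rw [residueSum, Finset.sum_insert ha', Finset.sum_insert hb, Finset.erase_insert ha']
  congr 1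
  · rw [Finset.prod_insert ha', Finset.prod_insert hb, Finset.prod_insert hb]
    ring
  congr 1
  · rw [Finset.prod_insert ha', Finset.prod_insert hb,
      Finset.erase_insert_of_ne hab, Finset.erase_insert hb, Finset.prod_insert ha]
    ring
  · refine Finset.sum_congr rfl fun k hk => ?_
    have hka : a ≠ k := fun h => ha (h ▸ hk)
    have hkb : b ≠ k := fun h => hb (h ▸ hk)
    rw [Finset.prod_insert ha', Finset.prod_insert hb, Finset.erase_insert_of_ne hka,
      Finset.erase_insert_of_ne hkb, Finset.prod_insert (by simp [hab, ha]),
      Finset.prod_insert (by simp [hb])]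
    ring

/-- Expanding s(z - y_a) s(z - y_b) by `three_term_partial` writes the source function as a
combination of two source functions with one pole less. The new zeros y_a + y_b - x_b and y_a + y_b
- x_a preserve ∑(x_k - y_k). -/
theorem residueSum_step (hK : K.Valid) {R : Finset ι} {a b : ι} (hab : a ≠ b) (ha : a ∉ R)
    (hb : b ∉ R) {x y : ι → ℂ}
    (hx : ∀ i ∈ insert a (insert b R), ∀ j ∈ insert a (insert b R), i ≠ j → K.s (x i - x j) ≠ 0) :
    K.s (x a - x b) * K.s (x a + x b - y a - y b) * residueSum K.s (insert a (insert b R)) x y =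
      K.s (x a - y a) * K.s (x a - y b) *
        residueSum K.s (insert a R) x (Function.update y a (y a + y b - x b)) -
      K.s (x b - y a) * K.s (x b - y b) *
        residueSum K.s (insert b R) x (Function.update y b (y a + y b - x a)) := by
  rw [residueSum_insert_insert hab ha hb, residueSum_insert ha, residueSum_insert hb]
  have h1 : K.s (x a - x b) ≠ 0 := hx a (by simp) b (by simp) hab
  rw [mul_add, mul_add, mul_add (K.s (x a - y a) * _), mul_add (K.s (x b - y a) * _),
    Finset.mul_sum, Finset.mul_sum, Finset.mul_sum, add_sub_add_comm, ← Finset.sum_sub_distrib,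
    ← add_assoc, s_sub_comm hK (x b) (x a)]
  congr 1
  · rw [show x a - (y a + y b - x b) = x a + x b - y a - y b by ring,
      show x b - (y a + y b - x a) = x a + x b - y a - y b by ring]
    field_simp
    ring
  · refine Finset.sum_congr rfl fun k hk => ?_
    have h2 : K.s (x k - x a) ≠ 0 := hx k (by simp [hk]) a (by simp) fun h => ha (h ▸ hk)
    have h3 : K.s (x k - x b) ≠ 0 := hx k (by simp [hk]) b (by simp) fun h => hb (h ▸ hk)
    have h4 := three_term_partial hK (x k) (x a) (x b) (y a) (y b)
    generalize (∏ j ∈ R, K.s (x k - y j)) / ∏ j ∈ R.erase k, K.s (x k - x j) = P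
    field_simp
    linear_combination P * h4

/-- The residues of `z ↦ ∏ s(z - y_j) / s(z - x_j)` add up to `s(∑ (x_k - y_k))`, in the elliptic
case under the balancing condition `∑ x_k = ∑ y_k`. -/
theorem residueSum_eq (hK : K.Valid) (S : Finset ι) (x y : ι → ℂ)
    (hx : ∀ i ∈ S, ∀ j ∈ S, i ≠ j → K.s (x i - x j) ≠ 0)
    (hD : K.Degenerate ∨ ∑ k ∈ S, (x k - y k) = 0) :
    residueSum K.s S x y = K.s (∑ k ∈ S, (x k - y k)) := by
  have hcont : Continuous K.s := (differentiable_s hK).continuous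
  induction hn : S.card generalizing S y with
  | zero =>
    rw [Finset.card_eq_zero] at hn
    simp [hn, residueSum, s_zero hK]
  | succ n ih =>
    obtain ⟨a, S', ha', rfl, hS'⟩ := Finset.card_eq_succ.mp hn
    obtain rfl | hne := S'.eq_empty_or_nonempty
    · simp [residueSum]
    obtain ⟨b, hbS⟩ := hne
    obtain ⟨R, hb, rfl⟩ := Finset.insert_erase hbS ▸ (⟨S'.erase b, by simp, rfl⟩ :
      ∃ R, b ∉ R ∧ insert b (S'.erase b) = insert b R)
    have hab : a ≠ b := fun h => ha' (by simp [h])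
    have ha : a ∉ R := fun h => ha' (by simp [h])
    have hx1 : K.s (x a - x b) ≠ 0 := hx a (by simp) b (by simp) hab
    -- The generic case of the induction step, in which the coefficient s(x_a + x_b - y_a - y_b) in
    -- `residueSum_step` can be cancelled.
    have main : ∀ y : ι → ℂ, (K.Degenerate ∨ ∑ k ∈ insert a (insert b R), (x k - y k) = 0) →
        K.s (x a + x b - y a - y b) ≠ 0 →
        residueSum K.s (insert a (insert b R)) x y =
          K.s (∑ k ∈ insert a (insert b R), (x k - y k)) := by
      intro y hD hw
      have hcardR : R.card + 1 = n := by rwa [Finset.card_insert_of_notMem hb] at hS'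
      have hsum : ∀ c : ι, c ∉ R → ∀ u : ℂ, ∑ k ∈ insert c R, (x k - Function.update y c u k) =
          x c - u + ∑ k ∈ R, (x k - y k) := by
        intro c hc u
        rw [Finset.sum_insert hc, Function.update_self]
        congr 1
        exact Finset.sum_congr rfl fun k hk => by
          rw [Function.update_of_ne (ne_of_mem_of_not_mem hk hc)]
      have hsum0 : ∑ k ∈ insert a (insert b R), (x k - y k) =
          x a - y a + (x b - y b + ∑ k ∈ R, (x k - y k)) := by
        rw [Finset.sum_insert ha', Finset.sum_insert hb]
      have s1 := (hsum a ha (y a + y b - x b)).trans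
        (show _ = ∑ k ∈ insert a (insert b R), (x k - y k) by rw [hsum0]; ring)
      have s2 := (hsum b hb (y a + y b - x a)).trans
        (show _ = ∑ k ∈ insert a (insert b R), (x k - y k) by rw [hsum0]; ring)
      have i1 := ih (insert a R) (Function.update y a (y a + y b - x b))
        (fun i hi j hj => hx i (Finset.insert_subset_insert a (Finset.subset_insert b R) hi) j
          (Finset.insert_subset_insert a (Finset.subset_insert b R) hj))
        (by rwa [s1]) (by rwa [Finset.card_insert_of_notMem ha])
      have i2 := ih (insert b R) (Function.update y b (y a + y b - x a))
        (fun i hi j hj => hx i (Finset.subset_insert a _ hi) j (Finset.subset_insert a _ hj))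
        (by rwa [s2]) (by rwa [Finset.card_insert_of_notMem hb])
      rw [s1] at i1
      rw [s2] at i2
      have st := residueSum_step hK hab ha hb hx (y := y)
      rw [i1, i2] at st
      refine mul_left_cancel₀ (mul_ne_zero hx1 hw) (st.trans ?_)
      -- Both smaller sums equal s(∑(x_k - y_k)). In the cases (I)-(III) their coefficients combine
      -- by `two_point_difference`; under balancing both sums are 0.
      rcases hD with hd | h0
      · rw [← two_point_difference hK hd]
        ring
      · rw [h0, s_zero hK]
        ring
    -- Two poles are treated directly: under balancing the coefficient to be cancelled would be s(0)
    -- = 0, and there is no third index by which to perturb it.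
    obtain rfl | ⟨c, hc⟩ := R.eq_empty_or_nonempty
    · have h2 := residueSum_insert_insert (s := K.s) hab ha hb x y
      rw [h2, Finset.sum_insert ha', Finset.sum_insert hb, s_sub_comm hK (x b) (x a)]
      simp only [Finset.prod_empty, Finset.sum_empty, div_one, mul_one, add_zero]
      rw [Finset.sum_insert ha', Finset.sum_insert hb, Finset.sum_empty, add_zero] at hD
      rcases hD with hd | h0
      · have := two_point_difference hK hd (x a) (x b) (y a) (y b)
        rw [show x a - y a + (x b - y b) = x a + x b - y a - y b by ring]
        field_simp
        linear_combination this
      · rw [h0, s_zero hK, show x b - y a = -(x a - y b) by linear_combination h0,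
          show x b - y b = -(x a - y a) by linear_combination h0, s_neg hK, s_neg hK]
        field_simp
        ring
    -- With a third index c the zeros are moved along e_c - e_a. This preserves ∑ y_k but makes the
    -- coefficient nonzero for a dense set of t, and continuity gives t = 0.
    · let e : ι → ℂ := Pi.single c 1 - Pi.single a 1
      have hca : c ≠ a := fun h => ha (h ▸ hc)
      have hcb : c ≠ b := fun h => hb (h ▸ hc)
      have he : ∑ k ∈ insert a (insert b R), e k = 0 := by
        simp only [e, Pi.sub_apply, Finset.sum_sub_distrib]
        rw [Finset.sum_pi_single', Finset.sum_pi_single', if_pos (by simp [hc]), if_pos (by simp),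
          sub_self]
      have hsum : ∀ t : ℂ, ∑ k ∈ insert a (insert b R), (x k - (y k + t * e k)) =
          ∑ k ∈ insert a (insert b R), (x k - y k) := by
        intro t
        simp_rw [← sub_sub]
        rw [Finset.sum_sub_distrib, ← Finset.mul_sum, he, mul_zero, sub_zero]
      have hdense := (countable_s_affine hK one_ne_zero (x a + x b - y a - y b)).dense_compl ℂ
      have hfun := Continuous.ext_on hdense
        (f := fun t => residueSum K.s (insert a (insert b R)) x fun k => y k + t * e k)
        (g := fun _ => K.s (∑ k ∈ insert a (insert b R), (x k - y k)))
        (by unfold residueSum; fun_prop) (by fun_prop) (fun t ht => by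
          refine (main _ (by rwa [hsum]) ?_).trans (by rw [hsum])
          · have ea : e a = -1 := by simp [e, hca.symm]
            have eb : e b = 0 := by simp [e, hcb.symm, hab.symm]
            rw [ea, eb]
            rw [show x a + x b - (y a + t * -1) - (y b + t * 0) =
              1 * t + (x a + x b - y a - y b) by ring]
            exact ht)
      have := congrFun hfun 0
      simpa using this

end Kind
end SenOperator

/-! ### The source identity -/

namespace SenOperator

theorem prod_units_int {α : Type*} [CommMonoid α] (f : ℤˣ → α) :
    ∏ ε : ℤˣ, f ε = f 1 * f (-1) := by
  rw [UnitsInt.univ, Finset.prod_pair (by decide)]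

theorem sum_units_int {α : Type*} [AddCommMonoid α] (f : ℤˣ → α) :
    ∑ ε : ℤˣ, f ε = f 1 + f (-1) := by
  rw [UnitsInt.univ, Finset.sum_pair (by decide)]

theorem prod_erase_eq_prod_ite {ι α : Type*} [DecidableEq ι] [CommMonoid α] (S : Finset ι) (k : ι)
    (f : ι → α) : ∏ j ∈ S.erase k, f j = ∏ j ∈ S, if j = k then 1 else f j := by
  rw [← Finset.prod_erase (a := k) S (by simp)]
  exact Finset.prod_congr rfl fun j hj => by rw [if_neg (Finset.ne_of_mem_erase hj)]

@[simp] theorem sg_one : sg 1 = 1 := by simp [sg]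

@[simp] theorem sg_neg (ε : ℤˣ) : sg (-ε) = -sg ε := by simp [sg]

theorem sg_mul_self (ε : ℤˣ) : sg ε * sg ε = 1 := by
  rcases Int.units_eq_one_or ε with rfl | rfl <;> simp

theorem ne_zero_of_mem_massSet {lam m : ℝ} (hl : lam ≠ 0) (hm : m ∈ massSet lam) : m ≠ 0 := by
  rcases hm with rfl | rfl | rfl | rfl <;> simp [hl]

namespace Kind

variable {K : Kind}

theorem s_half_omega_ne_zero (hK : K.Valid) {ν : ℕ} (h1 : 1 ≤ ν) (h2 : ν ≤ K.rho) :
    K.s (K.omega ν / 2) ≠ 0 :=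
  Finset.prod_ne_zero_iff.mp (prod_half_omega_ne_zero hK) ν (Finset.mem_Icc.mpr ⟨h1, h2⟩)

/-- A difference of two half-periods is a half-period modulo Ω: (ω₁ - ω₂)/2 = ω₃/2 + ω₁, (ω₁ - ω₃)/2
= ω₂/2 + ω₁, (ω₂ - ω₃)/2 = ω₁/2 + ω₂. -/
theorem s_omega_sub_ne_zero (hK : K.Valid) {ν μ : ℕ} (hν : ν ≤ K.rho) (hμ : μ ≤ K.rho)
    (h : ν ≠ μ) : K.s ((K.omega ν - K.omega μ) / 2) ≠ 0 := by
  wlog hlt : ν < μ generalizing ν μ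
  · have := this hμ hν h.symm (by omega)
    rw [← neg_sub, neg_div, s_neg hK]
    exact neg_ne_zero.mpr this
  rcases Nat.eq_zero_or_pos ν with rfl | hpos
  · have h0 : K.omega 0 = 0 := by cases K <;> rfl
    rw [h0, zero_sub, neg_div, s_neg hK]
    exact neg_ne_zero.mpr (s_half_omega_ne_zero hK (by omega) hμ)
  cases K with
  | elliptic r a =>
    obtain ⟨hr, ha⟩ := hK
    have hr' : (r : ℂ) ≠ 0 := by exact_mod_cast hr.ne'
    have w1 := s_elliptic_add_omega1 hr ha
    have w2 := s_elliptic_add_omega2 hr ha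
    have n1 := s_half_omega_ne_zero (K := elliptic r a) ⟨hr, ha⟩ (ν := 1) le_rfl (by simp [rho])
    have n2 := s_half_omega_ne_zero (K := elliptic r a) ⟨hr, ha⟩ (ν := 2) (by simp) (by simp [rho])
    have n3 := s_half_omega_ne_zero (K := elliptic r a) ⟨hr, ha⟩ (ν := 3) (by simp) (by simp [rho])
    simp only [rho] at hμ
    have cases : (ν = 1 ∧ μ = 2) ∨ (ν = 1 ∧ μ = 3) ∨ (ν = 2 ∧ μ = 3) := by omega
    simp only [omega, omega1, omega2] at n1 n2 n3
    rcases cases with ⟨rfl, rfl⟩ | ⟨rfl, rfl⟩ | ⟨rfl, rfl⟩ <;> simp only [omega, omega1, omega2]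
    · intro h0
      have h3 := w1 ((-(Real.pi / r) - I * a) / 2)
      rw [show ((-(Real.pi / r) - I * a) / 2 + Real.pi / r : ℂ) = (Real.pi / r - I * a) / 2 by ring,
        h0, zero_eq_neg] at h3
      exact n3 h3
    · rw [show ((Real.pi / r - (-(Real.pi / r) - I * a)) / 2 : ℂ) =
        I * a / 2 + Real.pi / r by ring, w1]
      exact neg_ne_zero.mpr n2
    · rw [show ((I * a - (-(Real.pi / r) - I * a)) / 2 : ℂ) =
        Real.pi / r / 2 + I * a by ring, w2]
      simpa using n1
  | _ => simp only [rho] at hμ; omega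

end Kind

namespace Model

variable {N : ℕ} (M : Model N)

theorem s_neg (hK : M.kind.Valid) (x : ℂ) : M.s (-x) = -M.s x := Kind.s_neg hK x

theorem s_sg_mul (hK : M.kind.Valid) (ε : ℤˣ) (x : ℂ) : M.s (sg ε * x) = sg ε * M.s x := by
  rcases Int.units_eq_one_or ε with rfl | rfl <;> simp [M.s_neg hK]

/-- The number `a_J` such that the source function has its poles at `±X_J - a_J`. -/
noncomputable def poleShift (m : ℝ) : ℂ := (1 / 4) * I * (M.lam * (m - 1) + 1 / m - 1) * M.β

theorem shiftA_eq (m : ℝ) : M.shiftA m = M.poleShift m + I * M.β / 2 := by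
  simp only [shiftA, poleShift]; ring

theorem shiftB_eq (m : ℝ) : M.shiftB m = M.poleShift m + I * M.lam * M.β / 2 := by
  simp only [shiftB, poleShift]; ring

/-- The index set of the poles of the source function. -/
abbrev PoleIndex : Type :=
  (Fin (M.kind.rho + 1) ⊕ Fin (M.kind.rho + 1)) ⊕ (ℤˣ × Fin N)

/-- The poles of the source function. -/
noncomputable def pole (X : Fin N → ℂ) : M.PoleIndex → ℂ :=
  Sum.elim
    (Sum.elim (fun ν => M.kind.omega ν / 2 + I * M.β / 2)
      fun ν => M.kind.omega ν / 2 + I * M.lam * M.β / 2)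
    fun p => sg p.1 * X p.2 - M.poleShift (M.m p.2)

/-- The zeros of the source function. -/
noncomputable def node (X : Fin N → ℂ) : M.PoleIndex → ℂ :=
  Sum.elim
    (Sum.elim (fun ν => I * M.g ν * M.β) fun ν => I * M.g (M.kind.rho + 1 + ν) * M.β)
    fun p => sg p.1 * X p.2 - M.poleShift (M.m p.2) + I * M.lam * M.m p.2 * M.β

theorem prod_node (X : Fin N → ℂ) (z : ℂ) :
    ∏ j, M.kind.s (z - M.node X j) =
      (∏ μ ∈ Finset.range (2 * M.kind.rho + 2), M.s (z - I * M.g μ * M.β)) *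
        ∏ ε : ℤˣ, ∏ J, M.s (z - sg ε * X J + M.poleShift (M.m J) - I * M.lam * M.m J * M.β) := by
  rw [Fintype.prod_sum_type, Fintype.prod_sum_type, Fintype.prod_prod_type,
    show 2 * M.kind.rho + 2 = (M.kind.rho + 1) + (M.kind.rho + 1) by ring,
    Finset.prod_range_add]
  simp only [node, Sum.elim_inl, Sum.elim_inr]
  rw [Fin.prod_univ_eq_prod_range (fun i => M.kind.s (z - I * M.g i * M.β)),
    Fin.prod_univ_eq_prod_range (fun i => M.kind.s (z - I * M.g (M.kind.rho + 1 + i) * M.β))]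
  congr 1
  refine Finset.prod_congr rfl fun ε _ => Finset.prod_congr rfl fun J _ => ?_
  rw [Model.s]
  congr 1
  ring

/-- The shifts a_J and the X_J cancel between pole and zero; each particle leaves -iλm_Jβ twice,
once for each sign. -/
theorem sum_pole_sub_node (X : Fin N → ℂ) :
    ∑ j, (M.pole X j - M.node X j) =
      ∑ ν ∈ Finset.range (M.kind.rho + 1), M.kind.omega ν - I * M.β * M.balance := by
  rw [Fintype.sum_sum_type, Fintype.sum_sum_type, Fintype.sum_prod_type]
  simp only [pole, node, Sum.elim_inl, Sum.elim_inr]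
  rw [Fin.sum_univ_eq_sum_range
      (fun i => M.kind.omega i / 2 + I * M.β / 2 - I * M.g i * M.β),
    Fin.sum_univ_eq_sum_range (fun i => M.kind.omega i / 2 + I * M.lam * M.β / 2 -
      I * M.g (M.kind.rho + 1 + i) * M.β), sum_units_int, balance]
  have hg : ∑ i ∈ Finset.range (2 * M.kind.rho + 2), (M.g i : ℂ) =
      ∑ i ∈ Finset.range (M.kind.rho + 1), (M.g i : ℂ) +
        ∑ i ∈ Finset.range (M.kind.rho + 1), (M.g (M.kind.rho + 1 + i) : ℂ) := by
    rw [← Finset.sum_range_add]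
    congr 2
    ring
  simp only [sub_add_cancel_left, Finset.sum_neg_distrib, Finset.sum_sub_distrib,
    Finset.sum_add_distrib, Finset.sum_const, Finset.card_range, nsmul_eq_mul, ← Finset.mul_sum,
    ← Finset.sum_mul, ← Finset.sum_div]
  push_cast
  rw [hg]
  ring

/-- The shift inside f_± is a difference of one-particle shifts; this is why the residue at ±X_J -
a_J factors into the f_±. -/
theorem pairShift_eq {m m' : ℝ} (hm : m ≠ 0) (hm' : m' ≠ 0) :
    M.poleShift m' - M.poleShift m =
      -(I * ((m - m') * (M.lam * m * m' - 1) * M.β / (4 * m * m'))) := by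
  have h1 : (m : ℂ) ≠ 0 := by exact_mod_cast hm
  have h2 : (m' : ℂ) ≠ 0 := by exact_mod_cast hm'
  simp only [poleShift]
  field_simp
  ring

theorem pairDen_eq (hK : M.kind.Valid) {m m' : ℝ} (hm : m ≠ 0) (hm' : m' ≠ 0) (ε : ℤˣ)
    (x : ℂ) : M.pairDen ε x m m' = sg ε * M.s (sg ε * x + M.poleShift m' - M.poleShift m) := by
  rw [add_sub_assoc, M.pairShift_eq hm hm', ← M.s_sg_mul hK, pairDen]
  congr 1
  linear_combination -x * sg_mul_self ε

theorem pairNum_eq (hK : M.kind.Valid) {m m' : ℝ} (hm : m ≠ 0) (hm' : m' ≠ 0) (ε : ℤˣ)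
    (x : ℂ) : M.pairNum ε x m m' =
      sg ε * M.s (sg ε * x + M.poleShift m' - M.poleShift m - I * M.lam * m' * M.β) := by
  rw [add_sub_assoc (sg ε * x), M.pairShift_eq hm hm', ← M.s_sg_mul hK, pairNum]
  congr 1
  linear_combination -x * sg_mul_self ε

theorem prod_pair_eq (hK : M.kind.Valid) {m m' : ℝ} (hm : m ≠ 0) (hm' : m' ≠ 0) (ε : ℤˣ)
    (x x' : ℂ) :
    ∏ δ : ℤˣ, M.pairNum ε (x + sg δ * x') m m' / M.pairDen ε (x + sg δ * x') m m' =
      ∏ δ : ℤˣ, M.s (sg ε * x - M.poleShift m - sg δ * x' + M.poleShift m' -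
        I * M.lam * m' * M.β) / M.s (sg ε * x - M.poleShift m - sg δ * x' + M.poleShift m') := by
  have hsg : sg ε ≠ 0 := left_ne_zero_of_mul_eq_one (sg_mul_self ε)
  simp only [M.pairNum_eq hK hm hm', M.pairDen_eq hK hm hm', mul_div_mul_left _ _ hsg]
  rw [prod_units_int, prod_units_int]
  rcases Int.units_eq_one_or ε with rfl | rfl
  · rw [mul_comm]
    congr 3 <;> simp <;> ring_nf
  · congr 3 <;> simp <;> ring_nf

/-- The origin of d(g, m): `poleShift` is 0 for m = 1, 1/λ and -i(λ + 1)β/2 for m = -1, -1/λ. -/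
theorem s_sub_node_eq {m : ℝ} (hl : M.lam ≠ 0) (hm : m ∈ massSet M.lam) (x : ℂ) (g : ℝ) :
    M.s (x - M.poleShift m - I * g * M.β) = M.s (x - I * M.d g m * M.β) := by
  have hl' : (M.lam : ℂ) ≠ 0 := by exact_mod_cast hl
  congr 1
  unfold d
  split_ifs with h
  · rcases h with rfl | rfl
    · simp [poleShift]
    · simp only [poleShift]
      push_cast
      field_simp
      ring
  · rcases hm with rfl | rfl | rfl | rfl
    · simp at h
    · simp only [poleShift]
      push_cast
      ring
    · simp only [poleShift]
      push_cast
      field_simp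
      ring
    · simp at h

/-- Precisely for masses in Λ, the shifts 2a_J + iβ and 2a_J + iλβ are iλmβ and iβ/m in one order or
the other. -/
theorem s_two_pole_eq {m : ℝ} (hl : M.lam ≠ 0) (hm : m ∈ massSet M.lam) (x : ℂ) :
    M.s (2 * (x - M.poleShift m - I * M.β / 2)) *
        M.s (2 * (x - M.poleShift m - I * M.lam * M.β / 2)) =
      M.s (2 * x - I * M.lam * m * M.β) * M.s (2 * x - I * M.β / m) := by
  have hl' : (M.lam : ℂ) ≠ 0 := by exact_mod_cast hl
  have comm : ∀ a b c d : ℂ, (a = c ∧ b = d) ∨ (a = d ∧ b = c) →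
      M.s a * M.s b = M.s c * M.s d := by
    rintro a b c d (⟨rfl, rfl⟩ | ⟨rfl, rfl⟩)
    · rfl
    · exact mul_comm _ _
  apply comm
  simp only [poleShift]
  rcases hm with rfl | rfl | rfl | rfl
  · right; constructor <;> push_cast <;> ring
  · left; constructor <;> push_cast <;> field_simp <;> ring
  · right; constructor <;> push_cast <;> field_simp <;> ring
  · left; constructor <;> push_cast <;> field_simp <;> ring

end Model
end SenOperator

/-! ### Residues of the source function -/

namespace SenOperator

theorem prod_units_int_neg {α : Type*} [CommMonoid α] (f : ℤˣ → α) :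
    ∏ ε : ℤˣ, f (-ε) = ∏ ε : ℤˣ, f ε := by
  rw [prod_units_int, prod_units_int, neg_neg, mul_comm]

namespace Model

variable {N : ℕ} (M : Model N)

theorem prod_sub_pole_erase_inl_inl (X : Fin N → ℂ) (z : ℂ) (ν : Fin (M.kind.rho + 1)) :
    ∏ j ∈ Finset.univ.erase (Sum.inl (Sum.inl ν) : M.PoleIndex), M.kind.s (z - M.pole X j) =
      (∏ μ ∈ (Finset.range (M.kind.rho + 1)).erase (ν : ℕ),
          M.s (z - (M.kind.omega μ / 2 + I * M.β / 2))) *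
        (∏ μ ∈ Finset.range (M.kind.rho + 1),
          M.s (z - (M.kind.omega μ / 2 + I * M.lam * M.β / 2))) *
        ∏ ε : ℤˣ, ∏ J, M.s (z - sg ε * X J + M.poleShift (M.m J)) := by
  rw [prod_erase_eq_prod_ite, prod_erase_eq_prod_ite, Fintype.prod_sum_type,
    Fintype.prod_sum_type, Fintype.prod_prod_type]
  simp only [pole, Sum.elim_inl, Sum.elim_inr, Sum.inl.injEq, reduceCtorEq, if_false, ← Fin.val_inj]
  rw [Fin.prod_univ_eq_prod_range (fun i => if i = (ν : ℕ) then 1 else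
      M.kind.s (z - (M.kind.omega i / 2 + I * M.β / 2))),
    Fin.prod_univ_eq_prod_range (fun i =>
      M.kind.s (z - (M.kind.omega i / 2 + I * M.lam * M.β / 2)))]
  congr 1
  refine Finset.prod_congr rfl fun ε _ => Finset.prod_congr rfl fun J _ => ?_
  rw [Model.s, sub_sub_eq_add_sub, sub_add_eq_add_sub]

theorem prod_sub_pole_erase_inl_inr (X : Fin N → ℂ) (z : ℂ) (ν : Fin (M.kind.rho + 1)) :
    ∏ j ∈ Finset.univ.erase (Sum.inl (Sum.inr ν) : M.PoleIndex), M.kind.s (z - M.pole X j) =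
      (∏ μ ∈ Finset.range (M.kind.rho + 1),
          M.s (z - (M.kind.omega μ / 2 + I * M.β / 2))) *
        (∏ μ ∈ (Finset.range (M.kind.rho + 1)).erase (ν : ℕ),
          M.s (z - (M.kind.omega μ / 2 + I * M.lam * M.β / 2))) *
        ∏ ε : ℤˣ, ∏ J, M.s (z - sg ε * X J + M.poleShift (M.m J)) := by
  rw [prod_erase_eq_prod_ite, prod_erase_eq_prod_ite, Fintype.prod_sum_type,
    Fintype.prod_sum_type, Fintype.prod_prod_type]
  simp only [pole, Sum.elim_inl, Sum.elim_inr, Sum.inl.injEq, Sum.inr.injEq, reduceCtorEq,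
    if_false, ← Fin.val_inj]
  rw [Fin.prod_univ_eq_prod_range (fun i => M.kind.s (z - (M.kind.omega i / 2 + I * M.β / 2))),
    Fin.prod_univ_eq_prod_range (fun i => if i = (ν : ℕ) then 1 else
      M.kind.s (z - (M.kind.omega i / 2 + I * M.lam * M.β / 2)))]
  congr 1
  refine Finset.prod_congr rfl fun ε _ => Finset.prod_congr rfl fun J _ => ?_
  rw [Model.s, sub_sub_eq_add_sub, sub_add_eq_add_sub]

theorem prod_units_prod_split (ε : ℤˣ) (J : Fin N) (f : ℤˣ → Fin N → ℂ) :
    ∏ ε' : ℤˣ, ∏ K, f ε' K =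
      f ε J * f (-ε) J * ∏ K ∈ Finset.univ.erase J, ∏ ε' : ℤˣ, f ε' K := by
  rw [Finset.prod_comm, ← Finset.mul_prod_erase _ _ (Finset.mem_univ J), prod_units_int]
  rcases Int.units_eq_one_or ε with rfl | rfl
  · rfl
  · rw [neg_neg, mul_comm (f 1 J)]

theorem prod_sub_pole_erase_inr (X : Fin N → ℂ) (z : ℂ) (ε : ℤˣ) (J : Fin N) :
    ∏ j ∈ Finset.univ.erase (Sum.inr (ε, J) : M.PoleIndex), M.kind.s (z - M.pole X j) =
      (∏ μ ∈ Finset.range (M.kind.rho + 1),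
          M.s (z - (M.kind.omega μ / 2 + I * M.β / 2))) *
        (∏ μ ∈ Finset.range (M.kind.rho + 1),
          M.s (z - (M.kind.omega μ / 2 + I * M.lam * M.β / 2))) *
        (M.s (z + sg ε * X J + M.poleShift (M.m J)) *
          ∏ K ∈ Finset.univ.erase J, ∏ ε' : ℤˣ, M.s (z - sg ε' * X K + M.poleShift (M.m K))) := by
  rw [prod_erase_eq_prod_ite, Fintype.prod_sum_type,
    Fintype.prod_sum_type, Fintype.prod_prod_type]
  simp only [pole, Sum.elim_inl, Sum.elim_inr, Sum.inr.injEq, reduceCtorEq, if_false,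
    Prod.mk.injEq]
  rw [Fin.prod_univ_eq_prod_range (fun i => M.kind.s (z - (M.kind.omega i / 2 + I * M.β / 2))),
    Fin.prod_univ_eq_prod_range (fun i =>
      M.kind.s (z - (M.kind.omega i / 2 + I * M.lam * M.β / 2))),
    prod_units_prod_split ε J]
  have hne : -ε ≠ ε := by rcases Int.units_eq_one_or ε with rfl | rfl <;> decide
  simp only [and_self, if_true, one_mul, and_true, hne, if_false, sg_neg]
  congr 2
  · rw [Model.s]
    congr 1
    ring
  · refine Finset.prod_congr rfl fun K hK => Finset.prod_congr rfl fun ε' _ => ?_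
    rw [if_neg (fun h => Finset.ne_of_mem_erase hK h.2), Model.s, sub_sub_eq_add_sub,
      sub_add_eq_add_sub]

/-- The residue of the source function at the pole with index `j`, up to the factor `s'(0)`. -/
noncomputable def sourceResidue (X : Fin N → ℂ) (j : M.PoleIndex) : ℂ :=
  (∏ i, M.kind.s (M.pole X j - M.node X i)) /
    ∏ i ∈ Finset.univ.erase j, M.kind.s (M.pole X j - M.pole X i)

theorem sourceResidue_inl_inl (X : Fin N → ℂ) (ν : Fin (M.kind.rho + 1)) :
    M.sourceResidue X (Sum.inl (Sum.inl ν)) =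
      1 / (∏ μ ∈ (Finset.range (M.kind.rho + 1)).erase (ν : ℕ),
        M.s ((M.kind.omega ν - M.kind.omega μ) / 2)) *
      ((∏ μ ∈ Finset.range (2 * M.kind.rho + 2),
          M.s (M.kind.omega ν / 2 + I * M.β / 2 - I * M.g μ * M.β)) /
        (∏ μ ∈ Finset.range (M.kind.rho + 1),
          M.s ((M.kind.omega ν - M.kind.omega μ + I * (1 - M.lam) * M.β) / 2)) *
        (∏ δ : ℤˣ, ∏ J,
          M.s (sg δ * X J + M.kind.omega ν / 2 + M.shiftA (M.m J) - I * M.lam * M.m J * M.β) /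
            M.s (sg δ * X J + M.kind.omega ν / 2 + M.shiftA (M.m J)))) := by
  rw [sourceResidue, prod_node, prod_sub_pole_erase_inl_inl, ← prod_units_int_neg]
  simp only [pole, Sum.elim_inl, Finset.prod_div_distrib, shiftA_eq, sg_neg]
  have e1 : ∀ μ, M.kind.omega ν / 2 + I * M.β / 2 - (M.kind.omega μ / 2 + I * M.β / 2) =
      (M.kind.omega ν - M.kind.omega μ) / 2 := fun μ => by ring
  have e2 : ∀ μ, M.kind.omega ν / 2 + I * M.β / 2 - (M.kind.omega μ / 2 + I * M.lam * M.β / 2) =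
      (M.kind.omega ν - M.kind.omega μ + I * (1 - M.lam) * M.β) / 2 := fun μ => by ring
  have e3 : ∀ (δ : ℤˣ) (J : Fin N), M.kind.omega ν / 2 + I * M.β / 2 - -sg δ * X J +
      M.poleShift (M.m J) = sg δ * X J + M.kind.omega ν / 2 +
        (M.poleShift (M.m J) + I * M.β / 2) := fun δ J => by ring
  rw [← prod_units_int_neg (fun ε => ∏ J, M.s (_ - sg ε * X J + M.poleShift (M.m J)))]
  simp only [e1, e2, e3, sg_neg]
  ring

theorem sourceResidue_inl_inr (X : Fin N → ℂ) (ν : Fin (M.kind.rho + 1)) :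
    M.sourceResidue X (Sum.inl (Sum.inr ν)) =
      1 / (∏ μ ∈ (Finset.range (M.kind.rho + 1)).erase (ν : ℕ),
        M.s ((M.kind.omega ν - M.kind.omega μ) / 2)) *
      ((∏ μ ∈ Finset.range (2 * M.kind.rho + 2),
          M.s (M.kind.omega ν / 2 + I * M.lam * M.β / 2 - I * M.g μ * M.β)) /
        (∏ μ ∈ Finset.range (M.kind.rho + 1),
          M.s ((M.kind.omega ν - M.kind.omega μ + I * (M.lam - 1) * M.β) / 2)) *
        (∏ δ : ℤˣ, ∏ J,
          M.s (sg δ * X J + M.kind.omega ν / 2 + M.shiftB (M.m J) - I * M.lam * M.m J * M.β) /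
            M.s (sg δ * X J + M.kind.omega ν / 2 + M.shiftB (M.m J)))) := by
  rw [sourceResidue, prod_node, prod_sub_pole_erase_inl_inr, ← prod_units_int_neg]
  simp only [pole, Sum.elim_inl, Sum.elim_inr, Finset.prod_div_distrib, shiftB_eq, sg_neg]
  have e1 : ∀ μ, M.kind.omega ν / 2 + I * M.lam * M.β / 2 -
      (M.kind.omega μ / 2 + I * M.lam * M.β / 2) =
      (M.kind.omega ν - M.kind.omega μ) / 2 := fun μ => by ring
  have e2 : ∀ μ, M.kind.omega ν / 2 + I * M.lam * M.β / 2 - (M.kind.omega μ / 2 + I * M.β / 2) =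
      (M.kind.omega ν - M.kind.omega μ + I * (M.lam - 1) * M.β) / 2 := fun μ => by ring
  have e3 : ∀ (δ : ℤˣ) (J : Fin N), M.kind.omega ν / 2 + I * M.lam * M.β / 2 - -sg δ * X J +
      M.poleShift (M.m J) = sg δ * X J + M.kind.omega ν / 2 +
        (M.poleShift (M.m J) + I * M.lam * M.β / 2) := fun δ J => by ring
  rw [← prod_units_int_neg (fun ε => ∏ J, M.s (_ - sg ε * X J + M.poleShift (M.m J)))]
  simp only [e1, e2, e3, sg_neg]
  ring

theorem s_two_mul_halfPeriodProd (hK : M.kind.Valid) (z : ℂ) :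
    M.s (2 * z) * M.halfPeriodProd =
      2 * (-1) ^ M.kind.rho *
        ∏ μ ∈ Finset.range (M.kind.rho + 1), M.s (z - M.kind.omega μ / 2) :=
  Kind.s_two_mul' hK z

/-- At z = εX_J - a_J the duplication formula turns the factors of the half-period poles into
s(2εX_J - iλm_Jβ) s(2εX_J - iβ/m_J). The first cancels the zero attached to -εX_J, the second is a
denominator of 𝒱_J^ε, and the zero attached to εX_J itself gives -s(iλm_Jβ). -/
theorem sourceResidue_inr (hM : M.Admissible) {X : Fin N → ℂ} (hX : X ∈ M.regularSet)
    (ε : ℤˣ) (J : Fin N) :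
    M.halfPeriodProd ^ 2 * M.sourceResidue X (Sum.inr (ε, J)) =
      -4 * (M.s (I * M.lam * M.m J * M.β) * M.V ε J X) := by
  obtain ⟨hK, hβ, hl, hm, -⟩ := hM
  have hH : M.halfPeriodProd ≠ 0 := Kind.prod_half_omega_ne_zero hK
  have hmJ : ∀ J, M.m J ≠ 0 := fun J => ne_zero_of_mem_massSet hl (hm J)
  rw [sourceResidue, prod_node, prod_sub_pole_erase_inr, prod_units_prod_split ε J]
  simp only [pole, Sum.elim_inr, V, M.prod_pair_eq hK (hmJ _) (hmJ _), Finset.prod_div_distrib,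
    M.s_sub_node_eq hl (hm J), sg_neg]
  set z := sg ε * X J - M.poleShift (M.m J) with hz
  have d1 := M.s_two_mul_halfPeriodProd hK (z - I * M.β / 2)
  have d2 := M.s_two_mul_halfPeriodProd hK (z - I * M.lam * M.β / 2)
  have d3 := M.s_two_pole_eq hl (hm J) (sg ε * X J)
  have e1 : ∀ μ, z - I * M.β / 2 - M.kind.omega μ / 2 = z - (M.kind.omega μ / 2 + I * M.β / 2) :=
    fun μ => by ring
  have e2 : ∀ μ, z - I * M.lam * M.β / 2 - M.kind.omega μ / 2 =
    z - (M.kind.omega μ / 2 + I * M.lam * M.β / 2) := fun μ => by ring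
  simp only [e1] at d1
  simp only [e2] at d2
  rw [← hz] at d3
  have hA : ∏ μ ∈ Finset.range (M.kind.rho + 1),
      M.s (z - (M.kind.omega μ / 2 + I * M.β / 2)) ≠ 0 := by
    refine Finset.prod_ne_zero_iff.mpr fun μ hμ => ?_
    have := (hX.2 μ (by simpa [Nat.lt_succ_iff] using hμ) (-ε) J).1
    rw [shiftA_eq] at this
    rw [show z - (M.kind.omega μ / 2 + I * M.β / 2) = -(sg (-ε) * X J + M.kind.omega μ / 2 +
      (M.poleShift (M.m J) + I * M.β / 2)) by rw [hz, sg_neg]; ring, M.s_neg hK]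
    exact neg_ne_zero.mpr this
  have hB : ∏ μ ∈ Finset.range (M.kind.rho + 1),
      M.s (z - (M.kind.omega μ / 2 + I * M.lam * M.β / 2)) ≠ 0 := by
    refine Finset.prod_ne_zero_iff.mpr fun μ hμ => ?_
    have := (hX.2 μ (by simpa [Nat.lt_succ_iff] using hμ) (-ε) J).2
    rw [shiftB_eq] at this
    rw [show z - (M.kind.omega μ / 2 + I * M.lam * M.β / 2) = -(sg (-ε) * X J +
      M.kind.omega μ / 2 + (M.poleShift (M.m J) + I * M.lam * M.β / 2)) by rw [hz, sg_neg]; ring,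
      M.s_neg hK]
    exact neg_ne_zero.mpr this
  have h2 : M.s (2 * (sg ε * X J)) ≠ 0 := by
    have := (hX.1 ε J).1
    rwa [mul_assoc, mul_left_comm] at this
  have e3 : z - sg ε * X J + M.poleShift (M.m J) - I * M.lam * M.m J * M.β =
      -(I * M.lam * M.m J * M.β) := by rw [hz]; ring
  have e4 : z - -sg ε * X J + M.poleShift (M.m J) - I * M.lam * M.m J * M.β =
      2 * (sg ε * X J) - I * M.lam * M.m J * M.β := by rw [hz]; ring
  have e5 : z + sg ε * X J + M.poleShift (M.m J) = 2 * (sg ε * X J) := by rw [hz]; ring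
  have e6 : sg ε * 2 * X J = 2 * (sg ε * X J) := by ring
  rw [e3, e4, e5, e6, M.s_neg hK]
  have hsq : ((-1 : ℂ) ^ M.kind.rho) ^ 2 = 1 := by rw [← pow_mul, mul_comm, pow_mul]; simp
  generalize (∏ μ ∈ Finset.range (M.kind.rho + 1),
      M.s (z - (M.kind.omega μ / 2 + I * M.β / 2))) = A at *
  generalize (∏ μ ∈ Finset.range (M.kind.rho + 1),
      M.s (z - (M.kind.omega μ / 2 + I * M.lam * M.β / 2))) = B at *
  have key : M.halfPeriodProd ^ 2 * (M.s (2 * (sg ε * X J) - I * M.lam * M.m J * M.β) *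
      M.s (2 * (sg ε * X J) - I * M.β / M.m J)) = 4 * (A * B) := by
    rw [← d3]
    linear_combination M.s (2 * (z - I * M.lam * M.β / 2)) * M.halfPeriodProd * d1 +
      2 * (-1) ^ M.kind.rho * A * d2 + 4 * A * B * hsq
  -- That the cancelled factor is nonzero is not part of `regularSet`; it follows because the
  -- half-period products A and B are nonzero.
  have hne : M.s (2 * (sg ε * X J) - I * M.lam * M.m J * M.β) ≠ 0 ∧
      M.s (2 * (sg ε * X J) - I * M.β / M.m J) ≠ 0 := by
    have : M.halfPeriodProd ^ 2 * (M.s (2 * (sg ε * X J) - I * M.lam * M.m J * M.β) *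
      M.s (2 * (sg ε * X J) - I * M.β / M.m J)) ≠ 0 := by
      rw [key]
      exact mul_ne_zero (by norm_num) (mul_ne_zero hA hB)
    exact mul_ne_zero_iff.mp (right_ne_zero_of_mul this)
  obtain ⟨hP, hQ⟩ := hne
  generalize M.s (2 * (sg ε * X J) - I * M.lam * M.m J * M.β) = P at *
  generalize M.s (2 * (sg ε * X J) - I * M.β / M.m J) = Q at *
  have key2 : M.halfPeriodProd ^ 2 * P / (A * B) = 4 / Q := by
    rw [div_eq_div_iff (mul_ne_zero hA hB) hQ]
    linear_combination key
  simp only [div_mul_eq_div_div]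
  rw [div_mul_eq_div_div] at key2
  linear_combination (-M.s (I * M.lam * M.m J * M.β) * (∏ μ ∈ Finset.range (2 * M.kind.rho + 2),
    M.s (sg ε * X J - I * M.d (M.g μ) (M.m J) * M.β)) / M.s (2 * (sg ε * X J)) *
    ((∏ K ∈ Finset.univ.erase J, ∏ δ : ℤˣ, M.s (z - sg δ * X K + M.poleShift (M.m K) -
      I * M.lam * M.m K * M.β)) / ∏ K ∈ Finset.univ.erase J, ∏ δ : ℤˣ,
        M.s (z - sg δ * X K + M.poleShift (M.m K)))) * key2

theorem s_pole_sub_pole_ne_zero (hM : M.Admissible) (h0 : M.V0Defined) {X : Fin N → ℂ}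
    (hX : X ∈ M.regularSet) {i j : M.PoleIndex} (hij : i ≠ j) :
    M.kind.s (M.pole X i - M.pole X j) ≠ 0 := by
  obtain ⟨hK, hβ, hl, hm, -⟩ := hM
  have hmJ : ∀ J, M.m J ≠ 0 := fun J => ne_zero_of_mem_massSet hl (hm J)
  have symm : ∀ {u v : ℂ}, M.kind.s (u - v) ≠ 0 → M.kind.s (v - u) ≠ 0 := fun {u v} h => by
    rw [Kind.s_sub_comm hK]
    exact neg_ne_zero.mpr h
  have hA : ∀ (ν : Fin (M.kind.rho + 1)) (ε : ℤˣ) (J : Fin N),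
      M.kind.s (M.kind.omega ν / 2 + I * M.β / 2 - (sg ε * X J - M.poleShift (M.m J))) ≠ 0 := by
    intro ν ε J
    have := (hX.2 ν (Nat.lt_succ_iff.mp ν.2) (-ε) J).1
    rw [shiftA_eq, sg_neg] at this
    convert this using 2
    rw [Model.s]
    congr 1
    ring
  have hB : ∀ (ν : Fin (M.kind.rho + 1)) (ε : ℤˣ) (J : Fin N),
      M.kind.s (M.kind.omega ν / 2 + I * M.lam * M.β / 2 -
        (sg ε * X J - M.poleShift (M.m J))) ≠ 0 := by
    intro ν ε J
    have := (hX.2 ν (Nat.lt_succ_iff.mp ν.2) (-ε) J).2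
    rw [shiftB_eq, sg_neg] at this
    convert this using 2
    rw [Model.s]
    congr 1
    ring
  have hAB : ∀ ν μ : Fin (M.kind.rho + 1),
      M.kind.s (M.kind.omega ν / 2 + I * M.β / 2 -
        (M.kind.omega μ / 2 + I * M.lam * M.β / 2)) ≠ 0 := by
    intro ν μ
    have := (h0 ν (Nat.lt_succ_iff.mp ν.2) μ (Nat.lt_succ_iff.mp μ.2)).1
    convert this using 2
    rw [Model.s]
    congr 1
    ring
  have hν : ∀ ν μ : Fin (M.kind.rho + 1), ν ≠ μ → ∀ c : ℂ,
      M.kind.s (M.kind.omega ν / 2 + c - (M.kind.omega μ / 2 + c)) ≠ 0 := by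
    intro ν μ h c
    rw [add_sub_add_right_eq_sub, ← sub_div]
    exact Kind.s_omega_sub_ne_zero hK (Nat.lt_succ_iff.mp ν.2) (Nat.lt_succ_iff.mp μ.2)
      (fun h' => h (Fin.ext h'))
  rcases i with (ν | ν) | ⟨ε, J⟩ <;> rcases j with (μ | μ) | ⟨ε', J'⟩ <;>
    simp only [pole, Sum.elim_inl, Sum.elim_inr]
  · exact hν ν μ (fun h => hij (by rw [h])) _
  · exact hAB ν μ
  · exact hA ν ε' J'
  · exact symm (hAB μ ν)
  · exact hν ν μ (fun h => hij (by rw [h])) _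
  · exact hB ν ε' J'
  · exact symm (hA μ ε J)
  · exact symm (hB μ ε J)
  · by_cases hJ : J' = J
    · subst hJ
      have hε : ε' = -ε := by
        have : ε ≠ ε' := fun h => hij (by rw [h])
        rcases Int.units_eq_one_or ε with rfl | rfl <;>
          rcases Int.units_eq_one_or ε' with rfl | rfl <;> simp_all
      have := (hX.1 ε J').1
      rw [hε, sg_neg]
      convert this using 2
      rw [Model.s]
      congr 1
      ring
    -- The sign δ = -εε' gives ε(X_J + δX_{J'}) = εX_J - ε'X_{J'}.
    · have := (hX.1 ε J).2.2 J' hJ (-(ε * ε'))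
      rw [M.pairDen_eq hK (hmJ _) (hmJ _)] at this
      have h2 := right_ne_zero_of_mul this
      convert h2 using 2
      rw [Model.s]
      congr 1
      have hmul : sg (ε * ε') = sg ε * sg ε' := by simp [sg]
      rw [sg_neg, hmul]
      linear_combination (sg ε' * X J') * sg_mul_self ε

theorem exp_factor_eq_one (hb : M.BalancedIfElliptic) {ν : ℕ} (hν : ν ≤ M.kind.rho) :
    exp (-M.kind.rParam * Kind.xi ν * M.balance * M.β) = 1 := by
  unfold BalancedIfElliptic at hb
  rcases hk : M.kind with _ | r | a | ⟨r, a⟩ <;> rw [hk] at hb hν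
  · simp [Kind.rParam]
  · have : ν = 0 ∨ ν = 1 := by simp only [Kind.rho] at hν; omega
    rcases this with rfl | rfl <;> simp [Kind.xi]
  · simp [Kind.rParam]
  · simp only at hb
    simp [hb]

/-- In the elliptic case ω₃ = -ω₁ - ω₂ makes ∑ ω_ν vanish, so B = 0 is exactly the equality of the
sums of poles and zeros. -/
theorem degenerate_or_balanced (hb : M.BalancedIfElliptic) :
    M.kind.Degenerate ∨
      ∑ ν ∈ Finset.range (M.kind.rho + 1), M.kind.omega ν - I * M.β * M.balance = 0 := by
  unfold BalancedIfElliptic at hb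
  rcases hk : M.kind with _ | r | a | ⟨r, a⟩ <;> rw [hk] at hb
  · exact Or.inl trivial
  · exact Or.inl trivial
  · exact Or.inl trivial
  · right
    simp only at hb
    simp [hb, Kind.rho, Finset.sum_range_succ, Kind.omega]

/-- The residues of the source function, added up by `residueSum_eq` and multiplied by -¼ ∏
s(ω_ν/2)². -/
theorem source_identity (hM : M.Admissible) (h0 : M.V0Defined) (hb : M.BalancedIfElliptic)
    {X : Fin N → ℂ} (hX : X ∈ M.regularSet) :
    ∑ ε : ℤˣ, ∑ J, M.s (I * M.lam * M.m J * M.β) * M.V ε J X + M.V0 X = M.eigenvalue := by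
  classical
  have hK := hM.1
  have hres := Kind.residueSum_eq hK Finset.univ (M.pole X) (M.node X)
    (fun i _ j _ hij => M.s_pole_sub_pole_ne_zero hM h0 hX hij)
    (by rw [sum_pole_sub_node]; exact M.degenerate_or_balanced hb)
  rw [sum_pole_sub_node, Kind.s_sub_comm hK] at hres
  change ∑ j, M.sourceResidue X j = _ at hres
  rw [Fintype.sum_sum_type, Fintype.sum_sum_type, Fintype.sum_prod_type] at hres
  have hV : ∑ ε : ℤˣ, ∑ J, M.s (I * M.lam * M.m J * M.β) * M.V ε J X =
      -(1 / 4) * M.halfPeriodProd ^ 2 * ∑ ε : ℤˣ, ∑ J, M.sourceResidue X (Sum.inr (ε, J)) := by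
    rw [Finset.mul_sum]
    refine Finset.sum_congr rfl fun ε _ => ?_
    rw [Finset.mul_sum]
    refine Finset.sum_congr rfl fun J _ => ?_
    linear_combination (1 / 4) * M.sourceResidue_inr hM hX ε J
  have hV0 : M.V0 X = -(1 / 4) * M.halfPeriodProd ^ 2 *
      (∑ ν, M.sourceResidue X (Sum.inl (Sum.inl ν)) +
        ∑ ν, M.sourceResidue X (Sum.inl (Sum.inr ν))) := by
    rw [V0, ← Finset.sum_add_distrib, ← Fin.sum_univ_eq_sum_range]
    congr 1
    refine Finset.sum_congr rfl fun ν _ => ?_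
    rw [sourceResidue_inl_inl, sourceResidue_inl_inr,
      M.exp_factor_eq_one hb (Nat.lt_succ_iff.mp ν.2), mul_add]
  rw [hV, hV0, eigenvalue, Model.s]
  linear_combination -(1 / 4) * M.halfPeriodProd ^ 2 * hres

end Model
end SenOperator

/-! ### Conjugation by the square root of the weight function -/

namespace SenOperator

theorem massSet_trichotomy {lam m m' : ℝ} (hl : lam ≠ 0) (hm : m ∈ massSet lam)
    (hm' : m' ∈ massSet lam) :
    m' = m ∨ m' = -m ∨ m' = 1 / (lam * m) ∨ m' = -1 / (lam * m) := by
  rcases hm with rfl | rfl | rfl | rfl <;> rcases hm' with rfl | rfl | rfl | rfl <;>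
    field_simp <;> simp

theorem IsGammaFunction.step {s : ℂ → ℂ} {G : ℂ → ℂ → ℂ} (hG : IsGammaFunction s G)
    {β m : ℝ} (hβ : β ≠ 0) (hm : m ≠ 0) :
    ∃ c : ℂ, c ≠ 0 ∧ ∀ x, s x ≠ 0 → G (x + I * β / (2 * m)) (β / m) =
      c * s x * G (x - I * β / (2 * m)) (β / m) := by
  obtain ⟨c, hc, h⟩ := hG (β / m) (by
    rw [← ofReal_div, ofReal_re]
    exact div_ne_zero hβ hm)
  refine ⟨c, hc, fun x hx => ?_⟩
  rw [show x + I * β / (2 * m) = x + I * (β / m) / 2 by ring,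
    show x - I * β / (2 * m) = x - I * (β / m) / 2 by ring]
  exact h x hx

namespace Model

variable {N : ℕ} (M : Model N)

/-- The one-variable part of `𝒱_J^ε`. -/
noncomputable def singleV (ε : ℤˣ) (x : ℂ) (m : ℝ) : ℂ :=
  (∏ ν ∈ Finset.range (2 * M.kind.rho + 2), M.s (sg ε * x - I * M.d (M.g ν) m * M.β)) /
    (M.s (sg ε * 2 * x) * M.s (sg ε * 2 * x - I * M.β / m))

/-- The one-particle part of detailed balance. The nonvanishing hypotheses make the equation of G
available at every point used, and make all divisions genuine. -/
theorem psiSq_shift (hM : M.Admissible) {G : ℂ → ℂ → ℂ} (hG : IsGammaFunction M.s G) {m : ℝ}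
    (hm : m ≠ 0) {x : ℂ} (h1 : M.psiSq G x m ≠ 0) (h2 : M.psiSq G (x - I * (M.β / m)) m ≠ 0)
    (h3 : M.singleV 1 x m ≠ 0) (h4 : M.singleV (-1) (x - I * (M.β / m)) m ≠ 0) :
    M.psiSq G (x - I * (M.β / m)) m * M.singleV (-1) (x - I * (M.β / m)) m =
      M.singleV 1 x m * M.psiSq G x m := by
  obtain ⟨c, hc, hg⟩ := hG.step hM.2.1.ne' hm
  simp only [singleV, sg_neg, sg_one, one_mul] at h3 h4 ⊢
  simp only [psiSq] at h1 h2 ⊢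
  have hm' : (m : ℂ) ≠ 0 := by exact_mod_cast hm
  obtain ⟨t, ht⟩ : ∃ t, t = I * M.β / (2 * m) := ⟨_, rfl⟩
  have ht2 : I * (M.β / m) = 2 * t := by rw [ht]; field_simp
  have ht3 : I * M.β / m = 2 * t := by rw [ht]; field_simp
  rw [← ht] at h1 h2 hg ⊢
  rw [ht2] at h2 h4 ⊢
  rw [ht3] at h3 h4 ⊢
  generalize hγ : (fun x => G x (M.β / m)) = γ at *
  simp only [funext_iff] at hγ
  simp only [hγ] at h1 h2 hg ⊢
  simp only [ne_eq, div_eq_zero_iff, mul_eq_zero, Finset.prod_eq_zero_iff, not_or] at h1 h2 h3 h4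
  obtain ⟨h3a, h3b, h3c⟩ := h3
  obtain ⟨h4a, h4b, h4c⟩ := h4
  push Not at h3a h4a
  -- The argument 2x moves by 4t, which is two steps of the difference equation for each of the two
  -- numerator factors.
  have hnum : γ (2 * (x - 2 * t) + t) * γ (-2 * (x - 2 * t) + t) *
      (M.s (2 * x) * M.s (2 * x - 2 * t)) =
      γ (2 * x + t) * γ (-2 * x + t) *
        (M.s (-1 * 2 * (x - 2 * t)) * M.s (-1 * 2 * (x - 2 * t) - 2 * t)) := by
    have g1 := hg _ h3b
    have g2 := hg _ h3c
    have g3 := hg _ h4b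
    have g4 := hg _ h4c
    rw [show 2 * x - 2 * t + t = 2 * x - t by ring,
      show 2 * x - 2 * t - t = 2 * (x - 2 * t) + t by ring] at g2
    rw [show -1 * 2 * (x - 2 * t) + t = -2 * (x - 2 * t) + t by ring] at g3
    rw [show -1 * 2 * (x - 2 * t) - 2 * t + t = -1 * 2 * (x - 2 * t) - t by ring,
      show -1 * 2 * (x - 2 * t) - 2 * t - t = -2 * x + t by ring] at g4
    rw [g3, g4, g1, g2]
    ring
  have hden : (∏ ν ∈ Finset.range (2 * M.kind.rho + 2),
        (γ (x - 2 * t + t - I * M.d (M.g ν) m * M.β) *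
          γ (-(x - 2 * t) + t - I * M.d (M.g ν) m * M.β))) *
        ∏ ν ∈ Finset.range (2 * M.kind.rho + 2), M.s (x - I * M.d (M.g ν) m * M.β) =
      (∏ ν ∈ Finset.range (2 * M.kind.rho + 2), (γ (x + t - I * M.d (M.g ν) m * M.β) *
        γ (-x + t - I * M.d (M.g ν) m * M.β))) *
        ∏ ν ∈ Finset.range (2 * M.kind.rho + 2),
          M.s (-1 * (x - 2 * t) - I * M.d (M.g ν) m * M.β) := by
    rw [← Finset.prod_mul_distrib, ← Finset.prod_mul_distrib]
    refine Finset.prod_congr rfl fun ν hν => ?_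
    have g1 := hg _ (h3a ν hν)
    have g2 := hg _ (h4a ν hν)
    generalize I * M.d (M.g ν) m * M.β = e at *
    rw [show x - e + t = x + t - e by ring, show x - e - t = x - 2 * t + t - e by ring] at g1
    rw [show -1 * (x - 2 * t) - e + t = -(x - 2 * t) + t - e by ring,
      show -1 * (x - 2 * t) - e - t = -x + t - e by ring] at g2
    rw [g1, g2]
    ring
  have hb : (M.s (2 * x) * M.s (2 * x - 2 * t)) ≠ 0 := mul_ne_zero h3b h3c
  have hb' : (M.s (-1 * 2 * (x - 2 * t)) * M.s (-1 * 2 * (x - 2 * t) - 2 * t)) ≠ 0 :=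
    mul_ne_zero h4b h4c
  have hp : ∏ ν ∈ Finset.range (2 * M.kind.rho + 2), (γ (x + t - I * M.d (M.g ν) m * M.β) *
        γ (-x + t - I * M.d (M.g ν) m * M.β)) ≠ 0 := by
    rw [Finset.prod_ne_zero_iff]
    intro ν hν h
    exact h1.2 ⟨ν, hν, mul_eq_zero.mp h⟩
  have hp' : ∏ ν ∈ Finset.range (2 * M.kind.rho + 2),
        (γ (x - 2 * t + t - I * M.d (M.g ν) m * M.β) *
          γ (-(x - 2 * t) + t - I * M.d (M.g ν) m * M.β)) ≠ 0 := by
    rw [Finset.prod_ne_zero_iff]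
    intro ν hν h
    exact h2.2 ⟨ν, hν, mul_eq_zero.mp h⟩
  rw [div_mul_div_comm, div_mul_div_comm, div_eq_div_iff (mul_ne_zero hp' hb')
    (mul_ne_zero hb hp)]
  generalize (∏ ν ∈ Finset.range (2 * M.kind.rho + 2), (γ (x + t - I * M.d (M.g ν) m * M.β) *
        γ (-x + t - I * M.d (M.g ν) m * M.β))) = P at *
  generalize (∏ ν ∈ Finset.range (2 * M.kind.rho + 2),
        (γ (x - 2 * t + t - I * M.d (M.g ν) m * M.β) *
          γ (-(x - 2 * t) + t - I * M.d (M.g ν) m * M.β))) = P' at *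
  generalize (M.s (2 * x) * M.s (2 * x - 2 * t)) = B at *
  generalize (M.s (-1 * 2 * (x - 2 * t)) * M.s (-1 * 2 * (x - 2 * t) - 2 * t)) = B' at *
  generalize (∏ ν ∈ Finset.range (2 * M.kind.rho + 2), M.s (x - I * M.d (M.g ν) m * M.β)) = A at *
  generalize (∏ ν ∈ Finset.range (2 * M.kind.rho + 2),
          M.s (-1 * (x - 2 * t) - I * M.d (M.g ν) m * M.β)) = A' at *
  linear_combination A' * P * hnum - (γ (2 * x + t) * γ (-2 * x + t)) * B' * hden

section pair

variable {M}
variable {G : ℂ → ℂ → ℂ} {m m' : ℝ} {w : ℂ}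

/-- The behaviour of `φ(w; a, b)² φ(-w; a, b)²` under the shift of `w` by `-iβ/m`, where `(a, b)`
is `(m, m')` or `(m', m)`. -/
def PhiSqShift (M : Model N) (G : ℂ → ℂ → ℂ) (w : ℂ) (m m' a b : ℝ) : Prop :=
  M.phiSq G w a b * M.phiSq G (-w) a b ≠ 0 →
  M.phiSq G (w - I * (M.β / m)) a b * M.phiSq G (-(w - I * (M.β / m))) a b ≠ 0 →
  M.pairNum 1 w m m' / M.pairDen 1 w m m' ≠ 0 →
  M.pairNum (-1) (w - I * (M.β / m)) m m' / M.pairDen (-1) (w - I * (M.β / m)) m m' ≠ 0 →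
  M.phiSq G (w - I * (M.β / m)) a b * M.phiSq G (-(w - I * (M.β / m))) a b *
      (M.pairNum (-1) (w - I * (M.β / m)) m m' / M.pairDen (-1) (w - I * (M.β / m)) m m') =
    M.pairNum 1 w m m' / M.pairDen 1 w m m' * (M.phiSq G w a b * M.phiSq G (-w) a b)

theorem phiSqShift_same (hM : M.Admissible) (hG : IsGammaFunction M.s G) (hm : m ≠ 0) :
    M.PhiSqShift G w m m m m := by
  obtain ⟨c, hc, hg⟩ := hG.step hM.2.1.ne' hm
  have hm' : (m : ℂ) ≠ 0 := by exact_mod_cast hm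
  obtain ⟨t, ht⟩ : ∃ t, t = I * M.β / (2 * m) := ⟨_, rfl⟩
  obtain ⟨l, hl⟩ : ∃ l, l = I * M.lam * m * M.β := ⟨_, rfl⟩
  have ht2 : I * (M.β / m) = 2 * t := by rw [ht]; field_simp
  have hneg := M.s_neg hM.1
  simp only [PhiSqShift, phiSq, if_true, pairNum, pairDen, sub_self, zero_mul, zero_div, mul_zero,
    sub_zero, sg_one, sg_neg, one_mul, neg_mul, sub_neg_eq_add, ht2, ← ht, ← hl] at hg ⊢
  generalize hγ : (fun x => G x (M.β / m)) = γ at *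
  simp only [funext_iff] at hγ
  simp only [hγ] at hg ⊢
  intro h1 h2 h3 h4
  simp only [ne_eq, div_eq_zero_iff, mul_eq_zero, not_or] at h1 h2 h3 h4
  have q1 : M.s (-(w - 2 * t)) ≠ 0 := by rw [hneg]; exact neg_ne_zero.mpr h4.2
  have q2 : M.s (-(w - 2 * t + l)) ≠ 0 := by rw [hneg]; exact neg_ne_zero.mpr h4.1
  have g1 := hg _ h3.2
  have g2 := hg _ h3.1
  have g3 := hg _ q1
  have g4 := hg _ q2
  rw [show w - t = w - 2 * t + t by ring] at g1
  rw [show w - l - t = w - 2 * t - l + t by ring] at g2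
  rw [show -(w - 2 * t) - t = -w + t by ring, hneg] at g3
  rw [show -(w - 2 * t + l) + t = -(w - 2 * t) - l + t by ring,
    show -(w - 2 * t + l) - t = -w - l + t by ring, hneg] at g4
  rw [g1, g2, g3, g4]
  have k1 := h1.2.1
  have k2 := h1.2.2
  have k3 := h2.1.1
  have k4 := h2.1.2
  have k5 := h3.1
  have k6 := h3.2
  have k7 := h4.1
  have k8 := h4.2
  field_simp

/-- For opposite masses f_-(w - iβ/m) = 1/f_+(w), so φ² has to produce f_+²; hence the square of G
in this case. -/
theorem phiSqShift_neg (hM : M.Admissible) (hG : IsGammaFunction M.s G) (hm : m ≠ 0) :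
    M.PhiSqShift G w m (-m) m (-m) := by
  obtain ⟨c, hc, hg⟩ := hG.step hM.2.1.ne' hm
  have hm' : (m : ℂ) ≠ 0 := by exact_mod_cast hm
  obtain ⟨t, ht⟩ : ∃ t, t = I * M.β / (2 * m) := ⟨_, rfl⟩
  obtain ⟨l, hl⟩ : ∃ l, l = I * M.lam * m * M.β / 2 := ⟨_, rfl⟩
  have ht2 : I * (M.β / m) = 2 * t := by rw [ht]; field_simp
  have hneg := M.s_neg hM.1
  have hc0 : I * ((m - (-m : ℝ)) * (M.lam * m * (-m : ℝ) - 1) * M.β / (4 * m * (-m : ℝ))) =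
      l + t := by
    rw [hl, ht]; push_cast; field_simp; ring
  have hl2 : I * M.lam * (-m : ℝ) * M.β = -(2 * l) := by rw [hl]; push_cast; ring
  have hne : -m ≠ m := fun h => hm (by linarith)
  simp only [PhiSqShift, phiSq, if_neg hne, if_true, pairNum, pairDen, sg_one, sg_neg, one_mul,
    neg_mul, sub_neg_eq_add, hc0, hl2, ht2, ← ht, ← hl] at hg ⊢
  generalize hγ : (fun x => G x (M.β / m)) = γ at *
  simp only [funext_iff] at hγ
  simp only [hγ] at hg ⊢
  intro h1 h2 h3 h4
  simp only [ne_eq, div_eq_zero_iff, mul_eq_zero, not_or] at h1 h2 h3 h4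
  have q1 : M.s (-(w - 2 * t + (l + t))) ≠ 0 := by rw [hneg]; exact neg_ne_zero.mpr h4.2
  have g1 := hg _ h3.2
  have g2 := hg _ q1
  rw [show w - (l + t) + t = w - l by ring, show w - (l + t) - t = w - 2 * t - l by ring] at g1
  rw [show -(w - 2 * t + (l + t)) + t = -(w - 2 * t) - l by ring,
    show -(w - 2 * t + (l + t)) - t = -w - l by ring, hneg] at g2
  have r1 : w - (l + t) + 2 * l = w - 2 * t + (l + t) := by ring
  have r2 : w - 2 * t + (l + t) + -(2 * l) = w - (l + t) := by ring
  simp only [r1, r2] at h3 h4 ⊢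
  rw [g1, g2]
  have k1 := h3.1
  have k2 := h3.2
  field_simp

/-- The reversed order of masses involves G(·; -β/m), whose difference equation is used separately:
G(·; α) and G(·; -α) are not assumed to be related. -/
theorem phiSqShift_neg' (hM : M.Admissible) (hG : IsGammaFunction M.s G) (hm : m ≠ 0) :
    M.PhiSqShift G w m (-m) (-m) m := by
  obtain ⟨c, hc, hg⟩ := hG.step hM.2.1.ne' (neg_ne_zero.mpr hm)
  have hm' : (m : ℂ) ≠ 0 := by exact_mod_cast hm
  obtain ⟨t, ht⟩ : ∃ t, t = I * M.β / (2 * m) := ⟨_, rfl⟩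
  obtain ⟨l, hl⟩ : ∃ l, l = I * M.lam * m * M.β / 2 := ⟨_, rfl⟩
  have ht2 : I * (M.β / m) = 2 * t := by rw [ht]; field_simp
  have ht3 : I * M.β / (2 * (-m : ℝ)) = -t := by rw [ht]; push_cast; field_simp
  have hneg := M.s_neg hM.1
  have hc0 : I * ((m - (-m : ℝ)) * (M.lam * m * (-m : ℝ) - 1) * M.β / (4 * m * (-m : ℝ))) =
      l + t := by
    rw [hl, ht]; push_cast; field_simp; ring
  have hl2 : I * M.lam * (-m : ℝ) * M.β = -(2 * l) := by rw [hl]; push_cast; ring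
  have hne : m ≠ -m := fun h => hm (by linarith)
  simp only [PhiSqShift, phiSq, if_neg hne, neg_neg, if_true, pairNum, pairDen, sg_one, sg_neg,
    one_mul, neg_mul, sub_neg_eq_add, hc0, hl2, ht2, ht3] at hg ⊢
  generalize hγ : (fun x => G x (M.β / (-m : ℝ))) = γ at *
  simp only [funext_iff] at hγ
  simp only [hγ] at hg ⊢
  have r3 : ∀ x, x - -(2 * l) / 2 = x + l := fun x => by ring
  simp only [r3]
  intro h1 h2 h3 h4
  simp only [ne_eq, div_eq_zero_iff, mul_eq_zero, not_or] at h1 h2 h3 h4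
  have q1 : M.s (-(w - (l + t))) ≠ 0 := by rw [hneg]; exact neg_ne_zero.mpr h3.2
  have g1 := hg _ h4.2
  have g2 := hg _ q1
  rw [show w - 2 * t + (l + t) + -t = w - 2 * t + l by ring,
    show w - 2 * t + (l + t) + t = w + l by ring] at g1
  rw [show -(w - (l + t)) + -t = -w + l by ring,
    show -(w - (l + t)) + t = -(w - 2 * t) + l by ring, hneg] at g2
  have r1 : w - (l + t) + 2 * l = w - 2 * t + (l + t) := by ring
  have r2 : w - 2 * t + (l + t) - 2 * l = w - (l + t) := by ring
  simp only [r1, r2] at h3 h4 ⊢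
  rw [g1, g2]
  have k1 := h3.1
  have k2 := h3.2
  field_simp

/-- Since λmm' = 1, the shift inside f_± vanishes and λm'β = β/m: f_+(w) = s(w - iβ/m)/s(w), and
f_-(w - iβ/m) is its inverse. -/
theorem phiSqShift_inv (hM : M.Admissible) (hm : m ≠ 0) {a b : ℝ} (h1 : m' = 1 / (M.lam * m))
    (hab : (fun x => M.phiSq G x a b) = M.s) : M.PhiSqShift G w m m' a b := by
  have hm' : (m : ℂ) ≠ 0 := by exact_mod_cast hm
  have hl' : (M.lam : ℂ) ≠ 0 := by exact_mod_cast hM.2.2.1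
  have hneg := M.s_neg hM.1
  obtain ⟨t, ht⟩ : ∃ t, t = I * (M.β / m) := ⟨_, rfl⟩
  have hc0 : I * ((m - m') * (M.lam * m * m' - 1) * M.β / (4 * m * m')) = 0 := by
    rw [h1]; push_cast; field_simp; simp
  have hl2 : I * M.lam * m' * M.β = t := by rw [ht, h1]; push_cast; field_simp
  simp only [funext_iff] at hab
  simp only [PhiSqShift, hab, pairNum, pairDen, sg_one, sg_neg, one_mul, neg_mul, sub_neg_eq_add,
    hc0, hl2, ← ht, sub_zero, add_zero, sub_add_cancel]
  intro h1 h2 h3 h4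
  simp only [ne_eq, div_eq_zero_iff, mul_eq_zero, not_or] at h1 h2 h3 h4
  have k1 := h3.1
  have k2 := h3.2
  rw [hneg, hneg]
  field_simp

/-- Here λm' = -1/m, so numerator and denominator of f_± are values of `s` one step apart, and φ² =
1/s telescopes without G. -/
theorem phiSqShift_neg_inv (hM : M.Admissible) (hm : m ≠ 0) {a b : ℝ}
    (h1 : m' = -1 / (M.lam * m))
    (hab : (fun x => M.phiSq G x a b) =
      fun x => (M.s (x - I * M.lam * m * M.β / 2 + I * M.β / (2 * m)))⁻¹) :
    M.PhiSqShift G w m m' a b := by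
  have hm' : (m : ℂ) ≠ 0 := by exact_mod_cast hm
  have hl' : (M.lam : ℂ) ≠ 0 := by exact_mod_cast hM.2.2.1
  have hneg := M.s_neg hM.1
  obtain ⟨t, ht⟩ : ∃ t, t = I * M.β / (2 * m) := ⟨_, rfl⟩
  obtain ⟨l, hl⟩ : ∃ l, l = I * M.lam * m * M.β / 2 := ⟨_, rfl⟩
  have ht2 : I * (M.β / m) = 2 * t := by rw [ht]; field_simp
  have hc0 : I * ((m - m') * (M.lam * m * m' - 1) * M.β / (4 * m * m')) = l + t := by
    rw [h1, hl, ht]; push_cast; field_simp; ring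
  have hl2 : I * M.lam * m' * M.β = -(2 * t) := by rw [ht, h1]; push_cast; field_simp
  simp only [funext_iff, ← ht, ← hl] at hab
  simp only [PhiSqShift, hab, pairNum, pairDen, sg_one, sg_neg, one_mul, neg_mul, sub_neg_eq_add,
    hc0, hl2, ht2]
  intro h1 h2 h3 h4
  have r1 : w - (l + t) + 2 * t = w - l + t := by ring
  have r2 : w - 2 * t - l + t = w - (l + t) := by ring
  have r3 : -(w - 2 * t) - l + t = -(w - 2 * t + (l + t) + -(2 * t)) := by ring
  have r4 : -w - l + t = -(w - 2 * t + (l + t)) := by ring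
  rw [r1] at h3
  simp only [r1, r2, r3, r4, hneg] at h1 h2 h3 h4 ⊢
  simp only [ne_eq, div_eq_zero_iff, not_or] at h3 h4
  have k1 := h3.1
  have k2 := h3.2
  have k3 := h4.1
  have k4 := h4.2
  generalize M.s (w - 2 * t + (l + t) + -(2 * t)) = A at *
  generalize M.s (w - 2 * t + (l + t)) = B at *
  field_simp

theorem phiSqShift_mass (hM : M.Admissible) (hG : IsGammaFunction M.s G)
    (hm : m ∈ massSet M.lam) (hm' : m' ∈ massSet M.lam) :
    M.PhiSqShift G w m m' m m' ∧ M.PhiSqShift G w m m' m' m := by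
  have hl := hM.2.2.1
  have h0 := ne_zero_of_mem_massSet hl hm
  have h0' := ne_zero_of_mem_massSet hl hm'
  by_cases e1 : m' = m
  · rw [e1]
    exact ⟨phiSqShift_same hM hG h0, phiSqShift_same hM hG h0⟩
  by_cases e2 : m' = -m
  · rw [e2]
    exact ⟨phiSqShift_neg hM hG h0, phiSqShift_neg' hM hG h0⟩
  have e1' : m ≠ m' := Ne.symm e1
  have e2' : m ≠ -m' := fun h => e2 (by rw [h, neg_neg])
  by_cases e3 : m' = 1 / (M.lam * m)
  · have e3' : m = 1 / (M.lam * m') := by rw [e3]; field_simp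
    refine ⟨phiSqShift_inv hM h0 e3 ?_, phiSqShift_inv hM h0 e3 ?_⟩
    · ext x
      simp only [phiSq, if_neg e1, if_neg e2, if_pos e3]
    · ext x
      simp only [phiSq, if_neg e1', if_neg e2', if_pos e3']
  · have e3' : m ≠ 1 / (M.lam * m') := fun h => e3 (by rw [h]; field_simp)
    have e4 : m' = -1 / (M.lam * m) := by
      have := massSet_trichotomy hl hm hm'
      tauto
    have hc : (m : ℂ) ≠ 0 := by exact_mod_cast h0
    have hlc : (M.lam : ℂ) ≠ 0 := by exact_mod_cast hl
    refine ⟨phiSqShift_neg_inv hM h0 e4 ?_, phiSqShift_neg_inv hM h0 e4 ?_⟩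
    · ext x
      simp only [phiSq, if_neg e1, if_neg e2, if_neg e3]
    -- Exchanging the masses turns λm into -1/m and 1/m into -λm, so both orders give the same φ².
    · ext x
      simp only [phiSq, if_neg e1', if_neg e2', if_neg e3']
      congr 2
      rw [e4]
      push_cast
      field_simp
      ring

end pair

end Model
end SenOperator

/-! ### Detailed balance for Φ² and removal of the square roots -/

namespace SenOperator

/-- Isolates the pairs that contain J. The order inside a pair is kept because φ² depends on the
order of its masses. -/
theorem prod_lt_pairs_split {N : ℕ} (F : Fin N → Fin N → ℂ) (J : Fin N) :
    ∏ L, ∏ K ∈ Finset.univ.filter (fun K => L < K), F L K =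
      (∏ K ∈ Finset.univ.erase J, if J < K then F J K else F K J) *
        ∏ L ∈ Finset.univ.erase J, ∏ K ∈ Finset.univ.erase J, if L < K then F L K else 1 := by
  simp only [Finset.prod_filter]
  rw [← Finset.mul_prod_erase _ _ (Finset.mem_univ J)]
  have h1 : ∏ K, (if J < K then F J K else 1) =
      ∏ K ∈ Finset.univ.erase J, if J < K then F J K else 1 :=
    (Finset.prod_erase _ (by simp)).symm
  have h2 : ∀ L, ∏ K, (if L < K then F L K else 1) =
      (if L < J then F L J else 1) * ∏ K ∈ Finset.univ.erase J, if L < K then F L K else 1 :=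
    fun L => (Finset.mul_prod_erase _ _ (Finset.mem_univ J)).symm
  simp only [h1, h2]
  rw [Finset.prod_mul_distrib, ← mul_assoc, ← Finset.prod_mul_distrib]
  congr 1
  refine Finset.prod_congr rfl fun K hK => ?_
  rcases lt_or_gt_of_ne (Finset.ne_of_mem_erase hK) with h | h
  · rw [if_neg h.not_gt, if_pos h, if_neg h.not_gt, one_mul]
  · rw [if_pos h, if_pos h, if_neg h.not_gt, mul_one]

theorem prod_signs_eq (f : ℂ → ℂ) (x y : ℂ) :
    ∏ ε : ℤˣ, ∏ ε' : ℤˣ, f (sg ε * x + sg ε' * y) =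
      ∏ δ : ℤˣ, f (x + sg δ * y) * f (-(x + sg δ * y)) := by
  simp only [prod_units_int, sg_neg, sg_one, one_mul, neg_mul, neg_add, neg_neg]
  ring

theorem prod_signs_eq' (f : ℂ → ℂ) (x y : ℂ) :
    ∏ ε : ℤˣ, ∏ ε' : ℤˣ, f (sg ε * y + sg ε' * x) =
      ∏ δ : ℤˣ, f (x + sg δ * y) * f (-(x + sg δ * y)) := by
  rw [Finset.prod_comm, ← prod_signs_eq]
  simp only [add_comm]

namespace Model

variable {N : ℕ} (M : Model N)

/-- The factor of `Φ²` that couples `X_J` to `X_K`. -/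
noncomputable def pairFactor (G : ℂ → ℂ → ℂ) (J K : Fin N) (x y : ℂ) : ℂ :=
  ∏ δ : ℤˣ, (if J < K then
    M.phiSq G (x + sg δ * y) (M.m J) (M.m K) * M.phiSq G (-(x + sg δ * y)) (M.m J) (M.m K)
    else M.phiSq G (x + sg δ * y) (M.m K) (M.m J) * M.phiSq G (-(x + sg δ * y)) (M.m K) (M.m J))

/-- The part of `Φ²` that does not depend on `X_J`. -/
noncomputable def restFactor (G : ℂ → ℂ → ℂ) (J : Fin N) (X : Fin N → ℂ) : ℂ :=
  (∏ L ∈ Finset.univ.erase J, M.psiSq G (X L) (M.m L)) *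
    ∏ L ∈ Finset.univ.erase J, ∏ K ∈ Finset.univ.erase J, if L < K then
      ∏ ε : ℤˣ, ∏ ε' : ℤˣ, M.phiSq G (sg ε * X L + sg ε' * X K) (M.m L) (M.m K) else 1

theorem PhiSq_eq (G : ℂ → ℂ → ℂ) (J : Fin N) (X : Fin N → ℂ) :
    M.PhiSq G X = M.psiSq G (X J) (M.m J) *
      (∏ K ∈ Finset.univ.erase J, M.pairFactor G J K (X J) (X K)) * M.restFactor G J X := by
  rw [PhiSq, prod_lt_pairs_split _ J, ← Finset.mul_prod_erase _ _ (Finset.mem_univ J), restFactor]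
  have : ∀ K ∈ Finset.univ.erase J, (if J < K then
      ∏ ε : ℤˣ, ∏ ε' : ℤˣ, M.phiSq G (sg ε * X J + sg ε' * X K) (M.m J) (M.m K) else
      ∏ ε : ℤˣ, ∏ ε' : ℤˣ, M.phiSq G (sg ε * X K + sg ε' * X J) (M.m K) (M.m J)) =
        M.pairFactor G J K (X J) (X K) := by
    intro K _
    unfold pairFactor
    split_ifs with h
    · exact prod_signs_eq (fun z => M.phiSq G z (M.m J) (M.m K)) (X J) (X K)
    · exact prod_signs_eq' (fun z => M.phiSq G z (M.m K) (M.m J)) (X J) (X K)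
  rw [Finset.prod_congr rfl this]
  ring

theorem restFactor_update (G : ℂ → ℂ → ℂ) (J : Fin N) (X : Fin N → ℂ) (x : ℂ) :
    M.restFactor G J (Function.update X J x) = M.restFactor G J X := by
  unfold restFactor
  congr 1
  · refine Finset.prod_congr rfl fun L hL => ?_
    rw [Function.update_of_ne (Finset.ne_of_mem_erase hL)]
  · refine Finset.prod_congr rfl fun L hL => Finset.prod_congr rfl fun K hK => ?_
    rw [Function.update_of_ne (Finset.ne_of_mem_erase hL),
      Function.update_of_ne (Finset.ne_of_mem_erase hK)]

/-- The factor of `𝒱_J^ε` that couples `X_J` to `X_K`. -/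
noncomputable def pairV (ε : ℤˣ) (J K : Fin N) (x y : ℂ) : ℂ :=
  ∏ δ : ℤˣ, M.pairNum ε (x + sg δ * y) (M.m J) (M.m K) /
    M.pairDen ε (x + sg δ * y) (M.m J) (M.m K)

theorem V_eq (ε : ℤˣ) (J : Fin N) (X : Fin N → ℂ) :
    M.V ε J X = M.singleV ε (X J) (M.m J) *
      ∏ K ∈ Finset.univ.erase J, M.pairV ε J K (X J) (X K) := rfl

theorem pairFactor_shift (hM : M.Admissible) {G : ℂ → ℂ → ℂ} (hG : IsGammaFunction M.s G)
    (J K : Fin N) (x y : ℂ) (h1 : M.pairFactor G J K x y ≠ 0)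
    (h2 : M.pairFactor G J K (x - I * (M.β / M.m J)) y ≠ 0)
    (h3 : M.pairV 1 J K x y ≠ 0) (h4 : M.pairV (-1) J K (x - I * (M.β / M.m J)) y ≠ 0) :
    M.pairFactor G J K (x - I * (M.β / M.m J)) y *
        M.pairV (-1) J K (x - I * (M.β / M.m J)) y =
      M.pairV 1 J K x y * M.pairFactor G J K x y := by
  unfold pairFactor pairV at *
  rw [Finset.prod_ne_zero_iff] at h1 h2 h3 h4
  rw [← Finset.prod_mul_distrib, ← Finset.prod_mul_distrib]
  refine Finset.prod_congr rfl fun δ hδ => ?_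
  have h := phiSqShift_mass (w := x + sg δ * y) hM hG (hM.2.2.2.1 J) (hM.2.2.2.1 K)
  have e : x - I * (M.β / M.m J) + sg δ * y = x + sg δ * y - I * (M.β / M.m J) := by ring
  have h1 := h1 δ hδ
  have h2 := h2 δ hδ
  have h3 := h3 δ hδ
  have h4 := h4 δ hδ
  rw [e] at h2 h4 ⊢
  split_ifs at h1 h2 ⊢ with hJK
  · exact h.1 h1 h2 h3 h4
  · exact h.2 h1 h2 h3 h4

/-- Detailed balance: only the factors of Φ² that contain X_J change, and each of them matches its
factor of 𝒱_J^±. -/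
theorem PhiSq_mul_V_shift (hM : M.Admissible) {G : ℂ → ℂ → ℂ} (hG : IsGammaFunction M.s G)
    (J : Fin N) {X : Fin N → ℂ} (h1 : M.PhiSq G X ≠ 0) (h2 : M.PhiSq G (M.shiftPt 1 J X) ≠ 0)
    (h3 : M.V 1 J X ≠ 0) (h4 : M.V (-1) J (M.shiftPt 1 J X) ≠ 0) :
    M.PhiSq G (M.shiftPt 1 J X) * M.V (-1) J (M.shiftPt 1 J X) = M.V 1 J X * M.PhiSq G X := by
  rw [M.PhiSq_eq G J] at h1 h2
  rw [M.V_eq] at h3 h4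
  rw [M.PhiSq_eq G J, M.PhiSq_eq G J X, M.V_eq, M.V_eq]
  have e1 : M.shiftPt 1 J X J = X J - I * (M.β / M.m J) := by simp [shiftPt]
  have e2 : ∀ f : ℂ → Fin N → ℂ, ∏ K ∈ Finset.univ.erase J, f (M.shiftPt 1 J X K) K =
      ∏ K ∈ Finset.univ.erase J, f (X K) K := fun f => Finset.prod_congr rfl fun K hK => by
    rw [shiftPt, Function.update_of_ne (Finset.ne_of_mem_erase hK)]
  have e3 : M.restFactor G J (M.shiftPt 1 J X) = M.restFactor G J X := M.restFactor_update G J X _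
  rw [e1, e3, e2 (fun y K => M.pairFactor G J K (X J - I * (M.β / M.m J)) y)] at h2 ⊢
  rw [e1, e2 (fun y K => M.pairV (-1) J K (X J - I * (M.β / M.m J)) y)] at h4
  rw [e2 (fun y K => M.pairV (-1) J K (X J - I * (M.β / M.m J)) y)]
  simp only [ne_eq, mul_eq_zero, not_or] at h1 h2 h3 h4
  have a1 := M.psiSq_shift hM hG (ne_zero_of_mem_massSet hM.2.2.1 (hM.2.2.2.1 J)) h1.1.1 h2.1.1
    h3.1 h4.1
  have a2 : (∏ K ∈ Finset.univ.erase J, M.pairFactor G J K (X J - I * (M.β / M.m J)) (X K)) *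
      ∏ K ∈ Finset.univ.erase J, M.pairV (-1) J K (X J - I * (M.β / M.m J)) (X K) =
      (∏ K ∈ Finset.univ.erase J, M.pairV 1 J K (X J) (X K)) *
        ∏ K ∈ Finset.univ.erase J, M.pairFactor G J K (X J) (X K) := by
    rw [← Finset.prod_mul_distrib, ← Finset.prod_mul_distrib]
    exact Finset.prod_congr rfl fun K hK => M.pairFactor_shift hM hG J K _ _
      (Finset.prod_ne_zero_iff.mp h1.1.2 K hK) (Finset.prod_ne_zero_iff.mp h2.1.2 K hK)
      (Finset.prod_ne_zero_iff.mp h3.2 K hK) (Finset.prod_ne_zero_iff.mp h4.2 K hK)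
  generalize (∏ K ∈ Finset.univ.erase J, M.pairFactor G J K (X J - I * (M.β / M.m J)) (X K)) = A
    at *
  generalize (∏ K ∈ Finset.univ.erase J,
    M.pairV (-1) J K (X J - I * (M.β / M.m J)) (X K)) = B at *
  generalize (∏ K ∈ Finset.univ.erase J, M.pairV 1 J K (X J) (X K)) = C at *
  generalize (∏ K ∈ Finset.univ.erase J, M.pairFactor G J K (X J) (X K)) = D at *
  linear_combination (M.restFactor G J X * A * B) * a1 +
    (M.restFactor G J X * M.singleV 1 (X J) (M.m J) * M.psiSq G (X J) (M.m J)) * a2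

theorem shiftPt_shiftPt_neg (ε : ℤˣ) (J : Fin N) (X : Fin N → ℂ) :
    M.shiftPt ε J (M.shiftPt (-ε) J X) = X := by
  simp [shiftPt]

theorem continuous_s (hM : M.Admissible) : Continuous M.s :=
  (Kind.differentiable_s hM.1).continuous

/-- Because division by zero gives zero, 𝒱_J^ε ≠ 0 on U already excludes vanishing denominators. -/
theorem continuousOn_V (hM : M.Admissible) {U : Set (Fin N → ℂ)} (ε : ℤˣ) (J : Fin N)
    (hU : ∀ X ∈ U, M.V ε J X ≠ 0) : ContinuousOn (M.V ε J) U := by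
  have hs := M.continuous_s hM
  have hne : ∀ X ∈ U, (M.s (sg ε * 2 * X J) * M.s (sg ε * 2 * X J - I * M.β / M.m J) ≠ 0) ∧
      ∀ K ∈ Finset.univ.erase J, ∀ δ ∈ (Finset.univ : Finset ℤˣ),
        M.pairDen ε (X J + sg δ * X K) (M.m J) (M.m K) ≠ 0 := by
    intro X hX
    have h := hU X hX
    rw [M.V_eq, mul_ne_zero_iff] at h
    refine ⟨fun h0 => h.1 (by rw [singleV, h0, div_zero]), fun K hK δ hδ h0 => ?_⟩
    have h2 := Finset.prod_ne_zero_iff.mp h.2 K hK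
    rw [pairV] at h2
    exact Finset.prod_ne_zero_iff.mp h2 δ hδ (by rw [h0, div_zero])
  refine ContinuousOn.mul (ContinuousOn.div ?_ ?_ fun X hX => (hne X hX).1) ?_
  · exact Continuous.continuousOn (by fun_prop)
  · exact Continuous.continuousOn (by fun_prop)
  · refine continuousOn_finsetProd _ fun K hK => continuousOn_finsetProd _ fun δ hδ =>
      ContinuousOn.div ?_ ?_ fun X hX => (hne X hX).2 K hK δ hδ
    · unfold pairNum
      exact Continuous.continuousOn (by fun_prop)
    · unfold pairDen
      exact Continuous.continuousOn (by fun_prop)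

theorem continuous_shiftPt (ε : ℤˣ) (J : Fin N) : Continuous (M.shiftPt ε J) := by
  unfold shiftPt
  fun_prop

/-- The branch of the root of `𝒱_J^+` determined by branches of `Φ` and of the root of `𝒱_J^-`. -/
noncomputable def plusRoot (Φ : Fn N) (Rm : Fin N → Fn N) (J : Fin N) : Fn N := fun X =>
  M.V 1 J X * Φ X / (Rm J (M.shiftPt 1 J X) * Φ (M.shiftPt 1 J X))

section conj

variable {M} {G : ℂ → ℂ → ℂ} {U : Set (Fin N → ℂ)} {Φ : Fn N} {Rm Rp : Fin N → Fn N}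

theorem root_ne_zero {R f : Fn N} (hR : IsRootOn U R f) {X : Fin N → ℂ} (hX : X ∈ U)
    (h : f X ≠ 0) : R X ≠ 0 := by
  intro h0
  apply h
  rw [← hR.2 X hX, h0, zero_pow two_ne_zero]

theorem plusRoot_mul (hU : M.IsDomain G U) (hΦ : IsRootOn U Φ (M.PhiSq G))
    (hRm : ∀ J, IsRootOn U (Rm J) (M.V (-1) J)) (J : Fin N) {X : Fin N → ℂ} (hX : X ∈ U) :
    M.plusRoot Φ Rm J X * (Rm J (M.shiftPt 1 J X) * Φ (M.shiftPt 1 J X)) = M.V 1 J X * Φ X := by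
  have hX' := hU.1 X hX 1 J
  exact div_mul_cancel₀ _ (mul_ne_zero
    (root_ne_zero (hRm J) hX' ((hU.2 _ hX').2 (-1) J)) (root_ne_zero hΦ hX' (hU.2 _ hX').1))

/-- Its square is (𝒱_J^+)² Φ²(X) / (𝒱_J^-(X') Φ²(X')), which is 𝒱_J^+ by detailed balance. -/
theorem isRootOn_plusRoot (hM : M.Admissible) (hG : IsGammaFunction M.s G)
    (hU : M.IsDomain G U) (hΦ : IsRootOn U Φ (M.PhiSq G))
    (hRm : ∀ J, IsRootOn U (Rm J) (M.V (-1) J)) (J : Fin N) :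
    IsRootOn U (M.plusRoot Φ Rm J) (M.V 1 J) := by
  have hmaps : Set.MapsTo (M.shiftPt 1 J) U U := fun X hX => hU.1 X hX 1 J
  have hcs := (M.continuous_shiftPt 1 J).continuousOn (s := U)
  have hne : ∀ X ∈ U, Rm J (M.shiftPt 1 J X) * Φ (M.shiftPt 1 J X) ≠ 0 := fun X hX =>
    mul_ne_zero (root_ne_zero (hRm J) (hmaps hX) ((hU.2 _ (hmaps hX)).2 (-1) J))
      (root_ne_zero hΦ (hmaps hX) (hU.2 _ (hmaps hX)).1)
  refine ⟨?_, fun X hX => ?_⟩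
  · exact ((M.continuousOn_V hM 1 J fun X hX => (hU.2 X hX).2 1 J).mul hΦ.1).div
      (((hRm J).1.comp hcs hmaps).mul (hΦ.1.comp hcs hmaps)) hne
  · have hX' := hmaps hX
    have key := M.PhiSq_mul_V_shift hM hG J (hU.2 X hX).1 (hU.2 _ hX').1 ((hU.2 X hX).2 1 J)
      ((hU.2 _ hX').2 (-1) J)
    rw [plusRoot, div_pow, div_eq_iff (pow_ne_zero 2 (hne X hX)), mul_pow, mul_pow,
      (hRm J).2 _ hX', hΦ.2 _ hX', hΦ.2 X hX]
    linear_combination -M.V 1 J X * key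

theorem conjOp_eq_reducedOp (hM : M.Admissible) (hG : IsGammaFunction M.s G)
    (hU : M.IsDomain G U) (hΦ : IsRootOn U Φ (M.PhiSq G))
    (hRp : ∀ J, ∀ X ∈ U,
      Rp J X * (Rm J (M.shiftPt 1 J X) * Φ (M.shiftPt 1 J X)) = M.V 1 J X * Φ X) :
    OpEqOn U (M.conjOp Φ (branches Rp Rm)) M.reducedOp := by
  intro F X hX
  have hΦX := root_ne_zero hΦ hX (hU.2 X hX).1
  have key : ∀ (ε : ℤˣ) (J : Fin N), branches Rp Rm ε J X *
      (branches Rp Rm (-ε) J (M.shiftPt ε J X) * Φ (M.shiftPt ε J X)) = M.V ε J X * Φ X := by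
    intro ε J
    rcases Int.units_eq_one_or ε with rfl | rfl
    · simpa [branches] using hRp J X hX
    -- For ε = -1 the hypothesis on `Rp` is used at the preimage of X under the shift, together with
    -- detailed balance there.
    · have hX' := hU.1 X hX (-1) J
      have e : M.shiftPt 1 J (M.shiftPt (-1) J X) = X := M.shiftPt_shiftPt_neg 1 J X
      have h1 := hRp J _ hX'
      have h2 := M.PhiSq_mul_V_shift hM hG J (hU.2 _ hX').1 (by rw [e]; exact (hU.2 X hX).1)
        ((hU.2 _ hX').2 1 J) (by rw [e]; exact (hU.2 X hX).2 (-1) J)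
      rw [e] at h1 h2
      rw [← hΦ.2 X hX, ← hΦ.2 _ hX'] at h2
      have hne : (-1 : ℤˣ) ≠ 1 := by decide
      simp only [branches, neg_neg, if_true, if_neg hne]
      refine mul_right_cancel₀ hΦX ?_
      linear_combination Φ (M.shiftPt (-1) J X) * h1 - h2
  rw [conjOp, senOp, reducedOp, mul_add, Finset.mul_sum]
  congr 1
  · refine Finset.sum_congr rfl fun ε _ => ?_
    rw [Finset.mul_sum]
    refine Finset.sum_congr rfl fun J _ => ?_
    simp only [shiftOp]
    rw [inv_mul_eq_iff_eq_mul₀ hΦX]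
    linear_combination M.s (I * M.lam * M.m J * M.β) * F (M.shiftPt ε J X) * key ε J
  · field_simp

/-- On a preconnected set two continuous roots of a nonvanishing function agree up to one global
sign; `Rp` is compared with `plusRoot`. -/
theorem exists_signs (hM : M.Admissible) (hG : IsGammaFunction M.s G)
    (hU : M.IsDomain G U) (hconn : IsPreconnected U) (hΦ : IsRootOn U Φ (M.PhiSq G))
    (hRp : ∀ J, IsRootOn U (Rp J) (M.V 1 J)) (hRm : ∀ J, IsRootOn U (Rm J) (M.V (-1) J)) :
    ∃ σ : Fin N → ℤˣ, OpEqOn U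
      (M.conjOp Φ (branches (fun J X => sg (σ J) * Rp J X) Rm)) M.reducedOp := by
  have h : ∀ J, ∃ σ : ℤˣ, ∀ X ∈ U, sg σ * Rp J X = M.plusRoot Φ Rm J X := by
    intro J
    have hr := isRootOn_plusRoot hM hG hU hΦ hRm J
    rcases hconn.eq_or_eq_neg_of_sq_eq (hRp J).1 hr.1
      (fun X hX => by simp only [Pi.pow_apply]; rw [(hRp J).2 X hX, hr.2 X hX])
      (fun {X} hX => root_ne_zero hr hX ((hU.2 X hX).2 1 J)) with h | h
    · exact ⟨1, fun X hX => by rw [sg_one, one_mul, h hX]⟩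
    · exact ⟨-1, fun X hX => by rw [h hX]; simp⟩
  choose σ hσ using h
  refine ⟨σ, conjOp_eq_reducedOp hM hG hU hΦ fun J X hX => ?_⟩
  rw [hσ J X hX, plusRoot_mul hU hΦ hRm J hX]

end conj

end Model
end SenOperator

/-! ### Necessity of the balancing condition in the elliptic case -/

namespace SenOperator

namespace Kind

theorem s_elliptic_add_int_mul {r a : ℝ} (hr : 0 < r) (ha : 0 < a) (k : ℤ) (x : ℂ) :
    (elliptic r a).s (x + k * (I * a)) =
      (-1) ^ k * exp (r * a * k ^ 2) * exp (-(2 * I * r * k * x)) * (elliptic r a).s x := by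
  have h1 : (-1 : ℂ) ≠ 0 := by norm_num
  induction k using Int.induction_on with
  | zero => simp
  | succ n ih =>
    have e1 : (x + ((n : ℤ) + 1 : ℤ) * (I * a) : ℂ) = x + (n : ℤ) * (I * a) + I * a := by
      push_cast; ring
    have e2 : exp (r * a) * exp (-(2 * I * r * (x + (n : ℤ) * (I * a)))) * (exp (r * a * (n : ℤ) ^ 2) *
        exp (-(2 * I * r * (n : ℤ) * x))) = exp (r * a * ((n : ℤ) + 1 : ℤ) ^ 2) *
          exp (-(2 * I * r * ((n : ℤ) + 1 : ℤ) * x)) := by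
      simp only [← exp_add]
      congr 1
      push_cast
      linear_combination (-2 * r * a * n : ℂ) * I_sq
    rw [e1, s_elliptic_add_omega2 hr ha, ih, zpow_add_one₀ h1]
    linear_combination (-(-1) ^ (n : ℤ) * (elliptic r a).s x) * e2
  | pred n ih =>
    have e1 : (x + (-(n : ℤ) : ℤ) * (I * a) : ℂ) =
        x + (-(n : ℤ) - 1 : ℤ) * (I * a) + I * a := by
      push_cast; ring
    rw [e1, s_elliptic_add_omega2 hr ha] at ih
    have e2 : exp (r * a) * exp (-(2 * I * r * (x + (-(n : ℤ) - 1 : ℤ) * (I * a)))) *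
        (exp (r * a * (-(n : ℤ) - 1 : ℤ) ^ 2) * exp (-(2 * I * r * (-(n : ℤ) - 1 : ℤ) * x))) =
        exp (r * a * (-(n : ℤ) : ℤ) ^ 2) * exp (-(2 * I * r * (-(n : ℤ) : ℤ) * x)) := by
      simp only [← exp_add]
      congr 1
      push_cast
      linear_combination (2 * r * a * (n + 1) : ℂ) * I_sq
    have hne : exp (r * a) * exp (-(2 * I * r * (x + (-(n : ℤ) - 1 : ℤ) * (I * a)))) ≠ 0 := by
      simp
    refine mul_left_cancel₀ hne ?_
    have e3 : (-1 : ℂ) ^ (-(n : ℤ) - 1) = -(-1) ^ (-(n : ℤ)) := by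
      rw [zpow_sub_one₀ h1]; norm_num
    rw [e3]
    linear_combination -ih + (-1) ^ (-(n : ℤ)) * (elliptic r a).s x * e2

theorem s_elliptic_add_int_mul_eq_zero_iff {r a : ℝ} (hr : 0 < r) (ha : 0 < a) (k : ℤ) (x : ℂ) :
    (elliptic r a).s (x + k * (I * a)) = 0 ↔ (elliptic r a).s x = 0 := by
  rw [s_elliptic_add_int_mul hr ha]
  simp only [mul_eq_zero, exp_ne_zero, or_false, false_or,
    zpow_ne_zero k (show (-1 : ℂ) ≠ 0 by norm_num)]

end Kind

namespace Model

variable {N : ℕ} (M : Model N)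

/-- Translation of `X` by integer multiples of the period `ia`. -/
noncomputable def translate (a : ℝ) (n : Fin N → ℤ) (X : Fin N → ℂ) : Fin N → ℂ :=
  fun K => X K + n K * (I * a)

theorem sg_eq_cast (ε : ℤˣ) : sg ε = ((ε : ℤ) : ℂ) := rfl

section elliptic

variable {M} {r a : ℝ}

theorem s_add_int_mul (hk : M.kind = Kind.elliptic r a) (hr : 0 < r) (ha : 0 < a) (k : ℤ) (x : ℂ) :
    M.s (x + k * (I * a)) =
      (-1) ^ k * exp (r * a * k ^ 2) * exp (-(2 * I * r * k * x)) * M.s x := by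
  simp only [Model.s, hk]
  exact Kind.s_elliptic_add_int_mul hr ha k x

theorem s_ne_zero_of_add (hk : M.kind = Kind.elliptic r a) (hr : 0 < r) (ha : 0 < a) (k : ℤ)
    {x y : ℂ} (hy : y = x + k * (I * a)) (hx : M.s x ≠ 0) : M.s y ≠ 0 := by
  rw [hy, Model.s, hk, Ne, Kind.s_elliptic_add_int_mul_eq_zero_iff hr ha, ← hk]
  exact hx

theorem translate_mem_regularSet (hk : M.kind = Kind.elliptic r a) (hr : 0 < r) (ha : 0 < a)
    (n : Fin N → ℤ) {X : Fin N → ℂ} (hX : X ∈ M.regularSet) :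
    translate a n X ∈ M.regularSet := by
  refine ⟨fun ε J => ⟨?_, ?_, fun K hK δ => ?_⟩, fun ν hν δ J => ⟨?_, ?_⟩⟩
  · refine s_ne_zero_of_add hk hr ha ((ε : ℤ) * 2 * n J) ?_ (hX.1 ε J).1
    rw [translate, sg_eq_cast]
    push_cast
    ring
  · refine s_ne_zero_of_add hk hr ha ((ε : ℤ) * 2 * n J) ?_ (hX.1 ε J).2.1
    rw [translate, sg_eq_cast]
    push_cast
    ring
  · refine s_ne_zero_of_add hk hr ha (n J + (δ : ℤ) * n K) ?_ ((hX.1 ε J).2.2 K hK δ)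
    simp only [translate, sg_eq_cast]
    push_cast
    ring
  · refine s_ne_zero_of_add hk hr ha ((δ : ℤ) * n J) ?_ (hX.2 ν hν δ J).1
    rw [translate, sg_eq_cast]
    push_cast
    ring
  · refine s_ne_zero_of_add hk hr ha ((δ : ℤ) * n J) ?_ (hX.2 ν hν δ J).2
    rw [translate, sg_eq_cast]
    push_cast
    ring

/-- In a quotient the multipliers cancel, up to an exponential in the difference c of the arguments.
-/
theorem s_ratio_add (hk : M.kind = Kind.elliptic r a) (hr : 0 < r) (ha : 0 < a) (k : ℤ)
    (w c : ℂ) : M.s (w + k * (I * a) - c) / M.s (w + k * (I * a)) =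
      exp (2 * I * r * k * c) * (M.s (w - c) / M.s w) := by
  rw [show w + k * (I * a) - c = w - c + k * (I * a) by ring, s_add_int_mul hk hr ha,
    s_add_int_mul hk hr ha]
  have e : exp (-(2 * I * r * k * (w - c))) =
      exp (2 * I * r * k * c) * exp (-(2 * I * r * k * w)) := by
    rw [← exp_add]; congr 1; ring
  have hne : (-1 : ℂ) ^ k * exp (r * a * k ^ 2) * exp (-(2 * I * r * k * w)) ≠ 0 := by
    simp [zpow_ne_zero]
  rw [e, ← mul_div_mul_left (M.s (w - c)) (M.s w) hne]
  ring

/-- For every particle the factors with δ = 1 and δ = -1 acquire reciprocal exponentials. -/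
theorem V0_translate (hk : M.kind = Kind.elliptic r a) (hr : 0 < r) (ha : 0 < a)
    (n : Fin N → ℤ) (X : Fin N → ℂ) : M.V0 (translate a n X) = M.V0 X := by
  have key : ∀ (c : ℂ) (u : Fin N → ℂ), ∏ δ : ℤˣ, ∏ J,
      M.s (sg δ * translate a n X J + c + u J - I * M.lam * M.m J * M.β) /
        M.s (sg δ * translate a n X J + c + u J) =
      ∏ δ : ℤˣ, ∏ J, M.s (sg δ * X J + c + u J - I * M.lam * M.m J * M.β) /
        M.s (sg δ * X J + c + u J) := by
    intro c u
    rw [Finset.prod_comm, Finset.prod_comm (s := Finset.univ (α := ℤˣ))]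
    refine Finset.prod_congr rfl fun J _ => ?_
    have : ∀ δ : ℤˣ, sg δ * translate a n X J + c + u J =
        sg δ * X J + c + u J + ((δ : ℤ) * n J : ℤ) * (I * a) := fun δ => by
      rw [translate, sg_eq_cast]; push_cast; ring
    simp only [this, s_ratio_add hk hr ha]
    rw [Finset.prod_mul_distrib, prod_units_int (fun δ : ℤˣ => exp _), ← exp_add]
    have e : (2 * I * r * (((1 : ℤˣ) : ℤ) * n J : ℤ) * (I * M.lam * M.m J * M.β) +
        2 * I * r * (((-1 : ℤˣ) : ℤ) * n J : ℤ) * (I * M.lam * M.m J * M.β) : ℂ) = 0 := by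
      push_cast; ring
    rw [e, exp_zero, one_mul]
  simp only [V0, key]

theorem pairV_translate (hk : M.kind = Kind.elliptic r a) (hr : 0 < r) (ha : 0 < a) (ε : ℤˣ)
    (J K : Fin N) (j k : ℤ) (x y : ℂ) :
    M.pairV ε J K (x + j * (I * a)) (y + k * (I * a)) =
      exp (-(2 * r * M.β * sg ε * j) * (2 * M.lam * M.m K)) * M.pairV ε J K x y := by
  unfold pairV
  have : ∀ δ : ℤˣ, M.pairNum ε (x + j * (I * a) + sg δ * (y + k * (I * a))) (M.m J) (M.m K) /
      M.pairDen ε (x + j * (I * a) + sg δ * (y + k * (I * a))) (M.m J) (M.m K) =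
      exp (2 * I * r * (j + (δ : ℤ) * k : ℤ) * (sg ε * I * M.lam * M.m K * M.β)) *
        (M.pairNum ε (x + sg δ * y) (M.m J) (M.m K) /
          M.pairDen ε (x + sg δ * y) (M.m J) (M.m K)) := by
    intro δ
    unfold pairNum pairDen
    rw [← s_ratio_add hk hr ha]
    congr 2 <;> rw [sg_eq_cast δ] <;> push_cast <;> ring
  rw [Finset.prod_congr rfl fun δ _ => this δ, Finset.prod_mul_distrib,
    prod_units_int (fun δ : ℤˣ => exp _), ← exp_add]
  congr 2
  push_cast
  linear_combination (4 * r * j * sg ε * M.lam * M.m K * M.β : ℂ) * I_sq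

/-- The combination is the same for all masses in Λ; the term 2λm supplies the contribution K = J
that is absent from the product over K ≠ J. -/
theorem sum_d (hM : M.Admissible) {m : ℝ}
    (hm : m ∈ massSet M.lam) :
    ∑ ν ∈ Finset.range 8, M.d (M.g ν) m - 2 / m - 2 * M.lam * m =
      ∑ ν ∈ Finset.range 8, M.g ν - 2 * (M.lam + 1) := by
  have hl := hM.2.2.1
  by_cases h : m = 1 ∨ m = 1 / M.lam
  · simp only [d, if_pos h]
    rcases h with rfl | rfl <;> field_simp <;> ring
  · simp only [d, if_neg h, Finset.sum_sub_distrib, Finset.sum_const, Finset.card_range]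
    rcases hm with rfl | rfl | rfl | rfl
    · simp at h
    · ring
    · field_simp
      ring
    · simp at h

/-- Eight numerator factors balance two denominator factors with doubled argument, since 8 = 2·2².
The parts quadratic in j and linear in x cancel, and only the parameters remain in the exponent. -/
theorem singleV_translate (hk : M.kind = Kind.elliptic r a) (hr : 0 < r) (ha : 0 < a) (ε : ℤˣ)
    (j : ℤ) (x : ℂ) (m : ℝ) : M.singleV ε (x + j * (I * a)) m =
      exp (-(2 * r * M.β * sg ε * j) *
        ((∑ ν ∈ Finset.range 8, M.d (M.g ν) m - 2 / m : ℝ) : ℂ)) * M.singleV ε x m := by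
  have hrho : 2 * M.kind.rho + 2 = 8 := by rw [hk]; rfl
  have hsq : sg ε * sg ε = 1 := sg_mul_self ε
  unfold singleV
  rw [hrho]
  have hnum : ∏ ν ∈ Finset.range 8, M.s (sg ε * (x + j * (I * a)) - I * M.d (M.g ν) m * M.β) =
      (exp (r * a * j ^ 2) ^ 8 * exp (-(16 * I * r * j * x)) *
        exp (-(2 * r * M.β * sg ε * j) * (∑ ν ∈ Finset.range 8, M.d (M.g ν) m : ℝ))) *
      ∏ ν ∈ Finset.range 8, M.s (sg ε * x - I * M.d (M.g ν) m * M.β) := by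
    have : ∀ ν, M.s (sg ε * (x + j * (I * a)) - I * M.d (M.g ν) m * M.β) =
        ((-1) ^ ((ε : ℤ) * j) * exp (r * a * j ^ 2) * exp (-(2 * I * r * j * x)) *
          exp (-(2 * r * M.β * sg ε * j) * M.d (M.g ν) m)) *
          M.s (sg ε * x - I * M.d (M.g ν) m * M.β) := by
      intro ν
      rw [show sg ε * (x + j * (I * a)) - I * M.d (M.g ν) m * M.β =
        sg ε * x - I * M.d (M.g ν) m * M.β + ((ε : ℤ) * j : ℤ) * (I * a) by
          rw [sg_eq_cast]; push_cast; ring, s_add_int_mul hk hr ha]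
      congr 1
      have e1 : (r * a * ((ε : ℤ) * j : ℤ) ^ 2 : ℂ) = r * a * j ^ 2 := by
        push_cast
        rw [← sg_eq_cast]
        linear_combination (r * a * j ^ 2 : ℂ) * hsq
      have e4 : exp (-(2 * I * r * ((ε : ℤ) * j : ℤ) * (sg ε * x - I * M.d (M.g ν) m * M.β))) =
          exp (-(2 * I * r * j * x)) * exp (-(2 * r * M.β * sg ε * j) * M.d (M.g ν) m) := by
        rw [← exp_add]
        congr 1
        push_cast
        rw [← sg_eq_cast]
        linear_combination (-2 * I * r * j * x) * hsq +
          (2 * r * sg ε * j * M.d (M.g ν) m * M.β) * I_sq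
      rw [e1, e4]
      ring
    rw [Finset.prod_congr rfl fun ν _ => this ν, Finset.prod_mul_distrib, Finset.prod_mul_distrib,
      Finset.prod_const, Finset.card_range, ← exp_sum, ← Finset.mul_sum, mul_pow, mul_pow]
    have e2 : ((-1 : ℂ) ^ ((ε : ℤ) * j)) ^ 8 = 1 := by
      rw [← zpow_natCast, ← zpow_mul, mul_comm, zpow_mul]
      norm_num
    have e3 : exp (-(2 * I * r * j * x)) ^ 8 = exp (-(16 * I * r * j * x)) := by
      rw [← exp_nat_mul]; congr 1; push_cast; ring
    rw [e2, e3, one_mul]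
    push_cast
    rfl
  have hden : ∀ c : ℂ, M.s (sg ε * 2 * (x + j * (I * a)) - c) =
      exp (r * a * j ^ 2) ^ 4 * exp (-(8 * I * r * j * x)) * exp (4 * I * r * sg ε * j * c) *
        M.s (sg ε * 2 * x - c) := by
    intro c
    rw [show sg ε * 2 * (x + j * (I * a)) - c = sg ε * 2 * x - c +
      (2 * ((ε : ℤ) * j) : ℤ) * (I * a) by rw [sg_eq_cast]; push_cast; ring,
      s_add_int_mul hk hr ha, zpow_mul]
    norm_num
    rw [← exp_nat_mul, ← exp_add, ← exp_add, ← exp_add]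
    left
    congr 1
    push_cast
    rw [← sg_eq_cast]
    linear_combination (4 * r * a * j ^ 2 - 8 * I * r * j * x) * hsq
  have hden0 := hden 0
  rw [sub_zero, sub_zero, mul_zero, exp_zero, mul_one] at hden0
  have e : exp (-(2 * r * M.β * sg ε * j) *
        ((∑ ν ∈ Finset.range 8, M.d (M.g ν) m - 2 / m : ℝ) : ℂ)) =
      exp (-(2 * r * M.β * sg ε * j) * (∑ ν ∈ Finset.range 8, M.d (M.g ν) m : ℝ)) /
        exp (4 * I * r * sg ε * j * (I * M.β / m)) := by
    rw [← exp_sub]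
    congr 1
    push_cast
    linear_combination (4 * r * sg ε * j * M.β / m) * I_sq
  have e16 : exp (-(16 * I * r * j * x)) = exp (-(8 * I * r * j * x)) ^ 2 := by
    rw [← exp_nat_mul]; congr 1; push_cast; ring
  have hne : exp (r * a * j ^ 2) ^ 8 * exp (-(8 * I * r * j * x)) ^ 2 ≠ 0 := by simp
  rw [hnum, hden0, hden, e, e16, div_mul_div_comm,
    ← mul_div_mul_left (exp (-(2 * r * M.β * sg ε * j) *
      (∑ ν ∈ Finset.range 8, M.d (M.g ν) m : ℝ)) * _) _ hne]
  congr 1 <;> ring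

/-- The translations of the other particles drop out because the two signs δ contribute (n_J + n_K)
+ (n_J - n_K) = 2n_J. -/
theorem V_translate (hM : M.Admissible) (hk : M.kind = Kind.elliptic r a) (hr : 0 < r) (ha : 0 < a)
    (n : Fin N → ℤ) (X : Fin N → ℂ) (ε : ℤˣ) (J : Fin N) :
    M.V ε J (translate a n X) = exp (-(2 * r * M.β * sg ε * n J) * M.balance) * M.V ε J X := by
  have hrho : M.kind.rho = 3 := by rw [hk]; rfl
  simp only [V_eq, translate]
  rw [singleV_translate hk hr ha, Finset.prod_congr rfl fun K _ =>
    pairV_translate hk hr ha ε J K (n J) (n K) (X J) (X K), Finset.prod_mul_distrib, ← exp_sum,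
    ← Finset.mul_sum]
  have hb : M.balance = ∑ ν ∈ Finset.range 8, M.d (M.g ν) (M.m J) - 2 / M.m J +
      ∑ K ∈ Finset.univ.erase J, 2 * M.lam * M.m K := by
    have h1 := sum_d hM (hM.2.2.2.1 J)
    have h2 := Finset.add_sum_erase Finset.univ (fun K => 2 * M.lam * M.m K) (Finset.mem_univ J)
    rw [balance, hrho]
    simp only [← Finset.mul_sum] at h2 ⊢
    push_cast
    linear_combination -h1 - h2
  rw [hb, mul_mul_mul_comm, ← exp_add]
  congr 2
  push_cast
  ring

/-- The mass 1/(λm_J) also lies in Λ, so iλm_Jβ is of the form iβ/m and is not a lattice point. -/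
theorem s_lam_mul_ne_zero (hM : M.Admissible) (hk : M.kind = Kind.elliptic r a) (J : Fin N) :
    M.s (I * M.lam * M.m J * M.β) ≠ 0 := by
  intro h
  obtain ⟨hK, -, hl, hm, hΩ⟩ := hM
  rw [hk] at hK
  rw [Model.s, hk] at h
  obtain ⟨k, l, hkl⟩ := Kind.exists_of_s_elliptic_eq_zero hK.1 hK.2 h
  have hm0 := ne_zero_of_mem_massSet hl (hm J)
  have hm' : 1 / (M.lam * M.m J) ∈ massSet M.lam := by
    have := hm J
    simp only [massSet, Set.mem_insert_iff, Set.mem_singleton_iff] at this ⊢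
    rcases this with h | h | h | h <;> rw [h] <;> field_simp <;> simp
  apply hΩ _ hm' 1 one_ne_zero
  have hm0' : (M.m J : ℂ) ≠ 0 := by exact_mod_cast hm0
  have hl' : (M.lam : ℂ) ≠ 0 := by exact_mod_cast hl
  rw [hk]
  convert Kind.mem_Omega_elliptic r a k l using 1
  rw [← hkl]
  push_cast
  field_simp

end elliptic

end Model
end SenOperator

/-! ### Analytic continuation along a coordinate line -/

namespace SenOperator

namespace Model

variable {N : ℕ} {M : Model N}

/-- The zeroth-order coefficient of `reducedOp` applied to constants. -/
noncomputable def constTerm (M : Model N) (X : Fin N → ℂ) : ℂ :=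
  ∑ ε : ℤˣ, ∑ J, M.s (I * M.lam * M.m J * M.β) * M.V ε J X + M.V0 X

/-- On the constant function 1 all differences in `subtractedOp` vanish. -/
theorem constTerm_eq_of_opEqOn {W : Set (Fin N → ℂ)}
    (h : OpEqOn W M.reducedOp M.subtractedOp) {X : Fin N → ℂ} (hX : X ∈ W) :
    M.constTerm X = M.eigenvalue := by
  have := h (fun _ => 1) X hX
  simpa [reducedOp, subtractedOp, shiftOp, constTerm] using this

/-- A coordinate line, written as an affine function of the parameter. -/
theorem update_eq_affine (X : Fin N → ℂ) (J : Fin N) (z : ℂ) (K : Fin N) :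
    Function.update X J z K = (if K = J then 1 else 0) * z + (if K = J then 0 else X K) := by
  by_cases h : K = J
  · subst h; simp
  · simp [h]

/-- An affine argument is either constant, where one good point suffices, or injective, where the
zeros of `s` have a countable preimage. -/
theorem eventually_s_affine_ne_zero (hM : M.Admissible) {f : ℂ → ℂ} (c e : ℂ)
    (hf : ∀ z, f z = c * z + e) (h : ∃ z, M.s (f z) ≠ 0) :
    ∀ᶠ z in Filter.cocountable, M.s (f z) ≠ 0 := by
  rw [Filter.Eventually, Filter.mem_cocountable]
  by_cases hc : c = 0
  · obtain ⟨z₀, hz₀⟩ := h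
    convert Set.countable_empty
    rw [Set.compl_empty_iff, Set.eq_univ_iff_forall]
    intro z
    have : f z = f z₀ := by rw [hf, hf, hc, zero_mul, zero_mul]
    change M.s (f z) ≠ 0
    rwa [this]
  · refine (Kind.countable_s_affine hM.1 hc e).mono fun z hz => ?_
    change M.kind.s (c * z + e) = 0
    rw [← hf]
    exact not_not.mp hz

theorem eventually_s_affine_ne_zero' (hM : M.Admissible) {f : ℂ → ℂ} (c e : ℂ)
    (hf : ∀ z, f z = c * z + e) (hc : c ≠ 0) :
    ∀ᶠ z in Filter.cocountable, M.s (f z) ≠ 0 := by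
  refine eventually_s_affine_ne_zero hM c e hf ?_
  obtain ⟨z, hz⟩ := ((Kind.countable_s_affine hM.1 hc e).dense_compl ℂ).nonempty
  refine ⟨z, fun h => hz ?_⟩
  rw [hf] at h
  exact h

theorem eventually_mem_regularSet (hM : M.Admissible) {X : Fin N → ℂ} (hX : X ∈ M.regularSet)
    (J₀ : Fin N) :
    ∀ᶠ z in Filter.cocountable, Function.update X J₀ z ∈ M.regularSet := by
  have hz0 : Function.update X J₀ (X J₀) ∈ M.regularSet := by rwa [Function.update_eq_self]
  have h1 : ∀ᶠ z in Filter.cocountable, ∀ (ε : ℤˣ) (J : Fin N),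
      M.s (sg ε * 2 * Function.update X J₀ z J) ≠ 0 ∧
      M.s (sg ε * 2 * Function.update X J₀ z J - I * M.β / M.m J) ≠ 0 ∧
        ∀ K, K ≠ J → ∀ δ : ℤˣ, M.pairDen ε (Function.update X J₀ z J +
          sg δ * Function.update X J₀ z K) (M.m J) (M.m K) ≠ 0 := by
    refine Filter.eventually_all.mpr fun ε => Filter.eventually_all.mpr fun J =>
      Filter.Eventually.and ?_ (Filter.Eventually.and ?_ (Filter.eventually_all.mpr fun K =>
        Filter.eventually_imp_distrib_left.mpr fun hK => Filter.eventually_all.mpr fun δ => ?_))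
    · refine eventually_s_affine_ne_zero hM (sg ε * 2 * if J = J₀ then 1 else 0)
        (sg ε * 2 * if J = J₀ then 0 else X J) (fun z => ?_) ⟨_, (hz0.1 ε J).1⟩
      rw [update_eq_affine]
      ring
    · refine eventually_s_affine_ne_zero hM (sg ε * 2 * if J = J₀ then 1 else 0)
        (sg ε * 2 * (if J = J₀ then 0 else X J) - I * M.β / M.m J) (fun z => ?_)
        ⟨_, (hz0.1 ε J).2.1⟩
      rw [update_eq_affine]
      ring
    · refine eventually_s_affine_ne_zero hM
        ((if J = J₀ then 1 else 0) + sg δ * if K = J₀ then 1 else 0)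
        ((if J = J₀ then 0 else X J) + (sg δ * if K = J₀ then 0 else X K) -
          sg ε * I * ((M.m J - M.m K) * (M.lam * M.m J * M.m K - 1) * M.β /
            (4 * M.m J * M.m K))) (fun z => ?_) ⟨_, (hz0.1 ε J).2.2 K hK δ⟩
      rw [update_eq_affine, update_eq_affine]
      ring
  have h2 : ∀ᶠ z in Filter.cocountable, ∀ ν ∈ Set.Iic M.kind.rho, ∀ (δ : ℤˣ) (J : Fin N),
      M.s (sg δ * Function.update X J₀ z J + M.kind.omega ν / 2 + M.shiftA (M.m J)) ≠ 0 ∧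
      M.s (sg δ * Function.update X J₀ z J + M.kind.omega ν / 2 + M.shiftB (M.m J)) ≠ 0 := by
    refine (Filter.eventually_all_finite (Set.finite_Iic _)).mpr fun ν hν =>
      Filter.eventually_all.mpr fun δ => Filter.eventually_all.mpr fun J =>
        Filter.Eventually.and ?_ ?_
    · refine eventually_s_affine_ne_zero hM (sg δ * if J = J₀ then 1 else 0)
        ((sg δ * if J = J₀ then 0 else X J) + M.kind.omega ν / 2 + M.shiftA (M.m J))
        (fun z => ?_) ⟨_, (hz0.2 ν hν δ J).1⟩
      rw [update_eq_affine]
      ring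
    · refine eventually_s_affine_ne_zero hM (sg δ * if J = J₀ then 1 else 0)
        ((sg δ * if J = J₀ then 0 else X J) + M.kind.omega ν / 2 + M.shiftB (M.m J))
        (fun z => ?_) ⟨_, (hz0.2 ν hν δ J).2⟩
      rw [update_eq_affine]
      ring
  filter_upwards [h1, h2] with z hz1 hz2
  exact ⟨hz1, hz2⟩

theorem eventually_V_ne_zero (hM : M.Admissible) {X : Fin N → ℂ} (hX : X ∈ M.regularSet)
    (J₀ : Fin N) :
    ∀ᶠ z in Filter.cocountable, M.V 1 J₀ (Function.update X J₀ z) ≠ 0 := by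
  have h1 : ∀ᶠ z in Filter.cocountable, ∀ ν ∈ Set.Iio (2 * M.kind.rho + 2),
      M.s (sg 1 * Function.update X J₀ z J₀ - I * M.d (M.g ν) (M.m J₀) * M.β) ≠ 0 := by
    refine (Filter.eventually_all_finite (Set.finite_Iio _)).mpr fun ν _ => ?_
    refine eventually_s_affine_ne_zero' hM 1 (-(I * M.d (M.g ν) (M.m J₀) * M.β)) (fun z => ?_)
      one_ne_zero
    rw [Function.update_self, sg_one]
    ring
  have h2 : ∀ᶠ z in Filter.cocountable, ∀ K, K ≠ J₀ → ∀ δ : ℤˣ, M.pairNum 1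
      (Function.update X J₀ z J₀ + sg δ * Function.update X J₀ z K) (M.m J₀) (M.m K) ≠ 0 := by
    refine Filter.eventually_all.mpr fun K => Filter.eventually_imp_distrib_left.mpr fun hK =>
      Filter.eventually_all.mpr fun δ => ?_
    refine eventually_s_affine_ne_zero' hM 1 (sg δ * X K - sg 1 * I * ((M.m J₀ - M.m K) *
      (M.lam * M.m J₀ * M.m K - 1) * M.β / (4 * M.m J₀ * M.m K)) -
        sg 1 * I * M.lam * M.m K * M.β) (fun z => ?_) one_ne_zero
    rw [Function.update_self, Function.update_of_ne hK]
    ring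
  filter_upwards [h1, h2, eventually_mem_regularSet hM hX J₀] with z hz1 hz2 hz3
  refine mul_ne_zero (div_ne_zero ?_ (mul_ne_zero (hz3.1 1 J₀).1 (hz3.1 1 J₀).2.1)) ?_
  · exact Finset.prod_ne_zero_iff.mpr fun ν hν => hz1 ν (Finset.mem_range.mp hν)
  · refine Finset.prod_ne_zero_iff.mpr fun K hK => Finset.prod_ne_zero_iff.mpr fun δ _ => ?_
    exact div_ne_zero (hz2 K (Finset.ne_of_mem_erase hK) δ)
      ((hz3.1 1 J₀).2.2 K (Finset.ne_of_mem_erase hK) δ)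

theorem analyticAt_constTerm (hM : M.Admissible) (X : Fin N → ℂ) (J₀ : Fin N) {z : ℂ}
    (hz : Function.update X J₀ z ∈ M.regularSet) :
    AnalyticAt ℂ (fun z => M.constTerm (Function.update X J₀ z)) z := by
  have hline : ∀ K, AnalyticAt ℂ (fun z => Function.update X J₀ z K) z := by
    intro K
    simp only [update_eq_affine]
    fun_prop
  have hs : ∀ {f : ℂ → ℂ}, AnalyticAt ℂ f z → AnalyticAt ℂ (fun z => M.s (f z)) z :=
    fun {f} hf => ((Kind.differentiable_s hM.1).analyticAt (f z)).comp hf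
  have hV : ∀ ε J, AnalyticAt ℂ (fun z => M.V ε J (Function.update X J₀ z)) z := by
    intro ε J
    have hJ := hline J
    refine AnalyticAt.fun_mul (AnalyticAt.fun_div ?_ ?_ ?_) ?_
    · exact Finset.analyticAt_fun_prod _ fun ν _ => hs (by fun_prop)
    · exact AnalyticAt.fun_mul (hs (by fun_prop)) (hs (by fun_prop))
    · exact mul_ne_zero (hz.1 ε J).1 (hz.1 ε J).2.1
    · refine Finset.analyticAt_fun_prod _ fun K hK => Finset.analyticAt_fun_prod _ fun δ _ => ?_
      have hK' := hline K
      refine AnalyticAt.fun_div ?_ ?_ ((hz.1 ε J).2.2 K (Finset.ne_of_mem_erase hK) δ)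
      · exact hs (by fun_prop)
      · exact hs (by fun_prop)
  have hV0 : AnalyticAt ℂ (fun z => M.V0 (Function.update X J₀ z)) z := by
    refine AnalyticAt.fun_mul analyticAt_const (Finset.analyticAt_fun_sum _ fun ν hν => ?_)
    have hν' : ν ≤ M.kind.rho := Nat.lt_succ_iff.mp (Finset.mem_range.mp hν)
    refine AnalyticAt.fun_mul analyticAt_const (AnalyticAt.fun_add
      (AnalyticAt.fun_mul analyticAt_const ?_) (AnalyticAt.fun_mul analyticAt_const ?_))
    · refine Finset.analyticAt_fun_prod _ fun δ _ => Finset.analyticAt_fun_prod _ fun J _ => ?_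
      have hJ := hline J
      exact AnalyticAt.fun_div (hs (by fun_prop)) (hs (by fun_prop)) (hz.2 ν hν' δ J).1
    · refine Finset.analyticAt_fun_prod _ fun δ _ => Finset.analyticAt_fun_prod _ fun J _ => ?_
      have hJ := hline J
      exact AnalyticAt.fun_div (hs (by fun_prop)) (hs (by fun_prop)) (hz.2 ν hν' δ J).2
  unfold constTerm
  refine AnalyticAt.fun_add (Finset.analyticAt_fun_sum _ fun ε _ =>
    Finset.analyticAt_fun_sum _ fun J _ => AnalyticAt.fun_mul analyticAt_const (hV ε J)) hV0

/-- The complement of a countable set in ℂ is connected, so the identity theorem carries the value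
from W along the whole regular part of the line. -/
theorem constTerm_eq_on_line (hM : M.Admissible) {W : Set (Fin N → ℂ)} (hW : IsOpen W)
    (hWr : W ⊆ M.regularSet) {c : ℂ} (h : ∀ X ∈ W, M.constTerm X = c) {X : Fin N → ℂ} (hX : X ∈ W)
    (J₀ : Fin N) {z : ℂ} (hz : Function.update X J₀ z ∈ M.regularSet) :
    M.constTerm (Function.update X J₀ z) = c := by
  have hc := eventually_mem_regularSet hM (hWr hX) J₀
  rw [Filter.Eventually, Filter.mem_cocountable] at hc
  have hconn := (hc.isPathConnected_compl_of_one_lt_rank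
    (by rw [rank_real_complex]; exact_mod_cast one_lt_two)).isConnected.isPreconnected
  rw [compl_compl] at hconn
  have hcont : Continuous fun z => Function.update X J₀ z := by fun_prop
  have hX' : Function.update X J₀ (X J₀) ∈ W := by rwa [Function.update_eq_self]
  refine AnalyticOnNhd.eqOn_of_preconnected_of_eventuallyEq
    (f := fun z => M.constTerm (Function.update X J₀ z)) (g := fun _ => c)
    (fun z hz => analyticAt_constTerm hM X J₀ hz) (fun _ _ => analyticAt_const) hconn
    (z₀ := X J₀) (hWr hX') ?_ hz
  filter_upwards [hcont.continuousAt.preimage_mem_nhds (hW.mem_nhds hX')] with y hy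
  exact h _ hy

/-- Translating X_{J₀} alone changes only the two terms with J = J₀. -/
theorem constTerm_translate (hM : M.Admissible) {r a : ℝ} (hk : M.kind = Kind.elliptic r a)
    (hr : 0 < r) (ha : 0 < a) (J₀ : Fin N) (k : ℕ) (X : Fin N → ℂ) :
    M.constTerm (translate a (Pi.single J₀ (k : ℤ)) X) - M.constTerm X =
      M.s (I * M.lam * M.m J₀ * M.β) *
        ((exp (-(2 * r * M.β * M.balance)) ^ k - 1) * M.V 1 J₀ X +
          ((exp (-(2 * r * M.β * M.balance)) ^ k)⁻¹ - 1) * M.V (-1) J₀ X) := by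
  have key : ∀ ε : ℤˣ, ∑ J, M.s (I * M.lam * M.m J * M.β) *
      M.V ε J (translate a (Pi.single J₀ (k : ℤ)) X) -
        ∑ J, M.s (I * M.lam * M.m J * M.β) * M.V ε J X =
      M.s (I * M.lam * M.m J₀ * M.β) *
        ((exp (-(2 * r * M.β * sg ε * k) * M.balance) - 1) * M.V ε J₀ X) := by
    intro ε
    rw [← Finset.sum_sub_distrib, Finset.sum_eq_single J₀]
    · rw [V_translate hM hk hr ha, Pi.single_eq_same]
      push_cast
      ring
    · intro J _ hJ
      rw [V_translate hM hk hr ha, Pi.single_eq_of_ne hJ]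
      simp
    · simp
  have k1 := key 1
  have k2 := key (-1)
  have e1 : exp (-(2 * r * M.β * sg 1 * k) * M.balance) =
      exp (-(2 * r * M.β * M.balance)) ^ k := by
    rw [← exp_nat_mul, sg_one]; congr 1; ring
  have e2 : exp (-(2 * r * M.β * sg (-1) * k) * M.balance) =
      (exp (-(2 * r * M.β * M.balance)) ^ k)⁻¹ := by
    rw [← exp_nat_mul, ← exp_neg, sg_neg, sg_one]; congr 1; ring
  rw [e1] at k1
  rw [e2] at k2
  rw [constTerm, constTerm, V0_translate hk hr ha, sum_units_int, sum_units_int]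
  linear_combination k1 + k2

theorem translate_single (a : ℝ) (J₀ : Fin N) (k : ℤ) (X : Fin N → ℂ) (z : ℂ) :
    translate a (Pi.single J₀ k) (Function.update X J₀ z) =
      Function.update X J₀ (z + k * (I * a)) := by
  ext K
  by_cases h : K = J₀
  · subst h; simp [translate]
  · simp [translate, h]

theorem balanced_of_opEqOn (hM : M.Admissible) (hN : 0 < N) {W : Set (Fin N → ℂ)}
    (hW : IsOpen W) (hne : W.Nonempty) (hWr : W ⊆ M.regularSet)
    (h : OpEqOn W M.reducedOp M.subtractedOp) : M.BalancedIfElliptic := by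
  rcases hk : M.kind with _ | r | a | ⟨r, a⟩ <;> simp only [BalancedIfElliptic, hk]
  have hra : 0 < r ∧ 0 < a := by have := hM.1; rwa [hk] at this
  obtain ⟨hr, ha⟩ := hra
  by_contra hB
  obtain ⟨X, hX⟩ := hne
  let J₀ : Fin N := ⟨0, hN⟩
  have hev := (eventually_mem_regularSet hM (hWr hX) J₀).and (eventually_V_ne_zero hM (hWr hX) J₀)
  rw [Filter.Eventually, Filter.mem_cocountable] at hev
  obtain ⟨z, hz⟩ := (hev.dense_compl ℂ).nonempty
  rw [compl_compl] at hz
  obtain ⟨hz1, hz2⟩ := hz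
  have hconst : ∀ {y : ℂ}, Function.update X J₀ y ∈ M.regularSet →
      M.constTerm (Function.update X J₀ y) = M.eigenvalue := fun hy =>
    constTerm_eq_on_line hM hW hWr (fun Y hY => constTerm_eq_of_opEqOn h hY) hX J₀ hy
  have hstep : ∀ k : ℕ, (exp (-(2 * r * M.β * M.balance)) ^ k - 1) *
      M.V 1 J₀ (Function.update X J₀ z) + ((exp (-(2 * r * M.β * M.balance)) ^ k)⁻¹ - 1) *
      M.V (-1) J₀ (Function.update X J₀ z) = 0 := by
    intro k
    have h1 := constTerm_translate hM hk hr ha J₀ k (Function.update X J₀ z)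
    have h2 := translate_mem_regularSet hk hr ha (Pi.single J₀ (k : ℤ)) hz1
    rw [translate_single] at h1 h2
    rw [hconst hz1, hconst h2, sub_self, eq_comm, mul_eq_zero] at h1
    exact h1.resolve_left (s_lam_mul_ne_zero hM hk J₀)
  have hu : exp (-(2 * r * M.β * M.balance)) =
      ((Real.exp (-(2 * r * M.β * M.balance)) : ℝ) : ℂ) := by push_cast; rfl
  have hx : -(2 * r * M.β * M.balance) ≠ 0 := by
    have := hM.2.1.ne'
    simp [hr.ne', this, hB]
  have hu0 : exp (-(2 * r * M.β * M.balance)) ≠ 0 := exp_ne_zero _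
  have hu1 : exp (-(2 * r * M.β * M.balance)) ≠ 1 := by
    rw [hu]
    norm_cast
    rwa [Real.exp_eq_one_iff]
  have hu2 : exp (-(2 * r * M.β * M.balance)) + 1 ≠ 0 := by
    rw [hu]
    norm_cast
    positivity
  -- k = 1 gives 𝒱^- = u 𝒱^+; inserted into k = 2 this leaves (u - 1)²(u + 1) 𝒱^+ = 0, which is
  -- impossible.
  have s1 := hstep 1
  have s2 := hstep 2
  generalize exp (-(2 * r * M.β * M.balance)) = u at *
  generalize M.V 1 J₀ (Function.update X J₀ z) = A at *
  generalize M.V (-1) J₀ (Function.update X J₀ z) = B at *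
  have hu1' : u - 1 ≠ 0 := sub_ne_zero.mpr hu1
  have t1 : B = u * A := by
    field_simp at s1
    refine mul_left_cancel₀ hu1' ?_
    linear_combination -s1
  rw [t1] at s2
  field_simp at s2
  have : (u - 1) * (u - 1) * (u + 1) * A = 0 := by linear_combination s2
  simp [hu1', hu2, hz2] at this

theorem reducedOp_eq_subtractedOp (hM : M.Admissible) (h0 : M.V0Defined)
    (hb : M.BalancedIfElliptic) : OpEqOn M.regularSet M.reducedOp M.subtractedOp := by
  intro F X hX
  have h := M.source_identity hM h0 hb hX
  rw [reducedOp, subtractedOp, ← h]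
  simp only [mul_sub, Finset.sum_sub_distrib, add_mul, Finset.sum_mul]
  ring

end Model
end SenOperator

/-! ### The main theorem -/

theorem mainTheorem5 (N : ℕ) (M : SenOperator.Model N) (hM : M.Admissible)
    (G : ℂ → ℂ → ℂ) (hG : SenOperator.IsGammaFunction M.s G) :
    -- Every choice of branches of `Φ` and of the roots of `𝒱_J^-` is completed by branches of the
    -- roots of `𝒱_J^+` such that `𝒜 = Φ⁻¹ ∘ ℋ ∘ Φ` has the two asserted forms.
    (∀ U : Set (Fin N → ℂ), M.IsDomain G U →
      ∀ (Φ : SenOperator.Fn N) (Rm : Fin N → SenOperator.Fn N),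
        SenOperator.IsRootOn U Φ (M.PhiSq G) →
        (∀ J, SenOperator.IsRootOn U (Rm J) (M.V (-1) J)) →
        ∃ Rp : Fin N → SenOperator.Fn N,
          (∀ J, SenOperator.IsRootOn U (Rp J) (M.V 1 J)) ∧
          SenOperator.OpEqOn U (M.conjOp Φ (SenOperator.Model.branches Rp Rm)) M.reducedOp ∧
          (M.V0Defined → M.BalancedIfElliptic →
            SenOperator.OpEqOn (U ∩ M.regularSet)
              (M.conjOp Φ (SenOperator.Model.branches Rp Rm)) M.subtractedOp) ∧
          (M.V0Defined → 0 < N →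
            ∀ W : Set (Fin N → ℂ), IsOpen W → W.Nonempty → W ⊆ U ∩ M.regularSet →
              SenOperator.OpEqOn W
                (M.conjOp Φ (SenOperator.Model.branches Rp Rm)) M.subtractedOp →
              M.BalancedIfElliptic)) ∧
    -- On a connected domain all branches have this property up to the sign of those of `𝒱_J^+`.
    (∀ U : Set (Fin N → ℂ), M.IsDomain G U → IsPreconnected U →
      ∀ (Φ : SenOperator.Fn N) (Rp Rm : Fin N → SenOperator.Fn N),
        SenOperator.IsRootOn U Φ (M.PhiSq G) →
        (∀ J, SenOperator.IsRootOn U (Rp J) (M.V 1 J)) →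
        (∀ J, SenOperator.IsRootOn U (Rm J) (M.V (-1) J)) →
        ∃ σ : Fin N → ℤˣ,
          SenOperator.OpEqOn U
            (M.conjOp Φ
              (SenOperator.Model.branches (fun J X => SenOperator.sg (σ J) * Rp J X) Rm))
            M.reducedOp) ∧
    -- The two forms of the operator agree, in the elliptic case exactly under balancing.
    (M.V0Defined →
      (M.BalancedIfElliptic →
        SenOperator.OpEqOn M.regularSet M.reducedOp M.subtractedOp) ∧
      (0 < N →
        ∀ W : Set (Fin N → ℂ), IsOpen W → W.Nonempty → W ⊆ M.regularSet →
          SenOperator.OpEqOn W M.reducedOp M.subtractedOp →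
          M.BalancedIfElliptic)) := by
  have part2 : M.V0Defined → (M.BalancedIfElliptic →
      SenOperator.OpEqOn M.regularSet M.reducedOp M.subtractedOp) ∧
      (0 < N → ∀ W : Set (Fin N → ℂ), IsOpen W → W.Nonempty → W ⊆ M.regularSet →
        SenOperator.OpEqOn W M.reducedOp M.subtractedOp → M.BalancedIfElliptic) :=
    fun h0 => ⟨fun hb => SenOperator.Model.reducedOp_eq_subtractedOp hM h0 hb,
      fun hN _ hW hne hWr h => SenOperator.Model.balanced_of_opEqOn hM hN hW hne hWr h⟩
  refine ⟨fun U hU Φ Rm hΦ hRm => ?_, fun U hU hconn Φ Rp Rm hΦ hRp hRm =>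
    SenOperator.Model.exists_signs hM hG hU hconn hΦ hRp hRm, part2⟩
  have heq := SenOperator.Model.conjOp_eq_reducedOp hM hG hU hΦ
    (fun J X hX => SenOperator.Model.plusRoot_mul hU hΦ hRm J hX)
  refine ⟨M.plusRoot Φ Rm, SenOperator.Model.isRootOn_plusRoot hM hG hU hΦ hRm, heq,
    fun h0 hb F X hX => ?_, fun h0 hN W hW hne hWU h => ?_⟩
  · rw [heq F X hX.1]
    exact (part2 h0).1 hb F X hX.2
  · refine (part2 h0).2 hN W hW hne (fun X hX => (hWU hX).2) fun F X hX => ?_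
    rw [← heq F X (hWU hX).1]
    exact h F X hX
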